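/- **Language.** Finite types are generated from $0$ (natural numbers), $\Omega$ (points) and $S$ (events) by $\rho,\tau\mapsto\rho(\tau)$ (functions from $\tau$ to $\rho$); $1:=0(0)$. Terms are built by application from typed variables and the constants: zero and successor, the combinators $\Pi,\Sigma$ of all types (which provide $\lambda$-abstraction), recursors $\underline R_{\underline\rho}$ for simultaneous primitive recursion over all tuples of types; $\mathrm{eq}$ of type $0(\Omega)(\Omega)$, $\in$ of type $0(S)(\Omega)$, $\cup$ of type $S(S)(S)$, $(\cdot)^c$ of type $S(S)$, $\emptyset$ of type $S$, $c_\Omega$ of type $\Omega$; $\mathbb P$ of type $1(S)$; $[\cdot,\cdot]$ of type $0(1)(1)(1)$; $(\cdot)^{-1}$ of type $0(\Omega)(0(1))(1(\Omega))$; $I$ of type $0(1(\Omega))$, $\|\cdot\|_\infty$ and $\int\cdot\,d\mathbb P$ of type $1(1(\Omega))$; $X$ of type $1(\Omega)(0)$ and $P$ of type $S(0)(0)(0)$. Formulas are built with $\bot,\wedge,\vee,\to,\forall,\exists$ from equations $s=_0t$ between terms of type $0$. Abbreviations: $x\in A$ is $\in xA=_00$; $x=_\Omega y$ is $\mathrm{eq}\,xy=_00$;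 $A=_SB$ is $\forall x^\Omega(x\in A\leftrightarrow x\in B)$; equality at function types is pointwise; $A\cap B:=(A^c\cup B^c)^c$; $f\in I$, $r\in[a,b]$, $x\in f^{-1}A$ mean that $If$, $[a,b](r)$, $f^{-1}Ax$ is $=_00$. Finite unions $\bigcup_{i=n}^mA(i)$ are defined by recursion ($\emptyset$ if $m<n$), and $\bigcap_{i=n}^mA(i):=(\bigcup_{i=n}^mA(i)^c)^c$. Rationals are coded by natural numbers through the Cantor pairing function; reals are represented by type-$1$ objects $x$, read as the fast converging Cauchy sequence $\widehat x$ of rationals, with the usual primitive recursive operations and with $=_{\mathbb R}$, $<_{\mathbb R}$, $\le_{\mathbb R}$ defined accordingly; naturals and rationals are embedded as constant sequences. $\chi_A$ is $\lambda x.(\in x A^c)$, with real value $1$ on $A$ and $0$ off $A$. **The system $\mathcal F^\omega[\mathbb P,\mathrm{Integral},X]$.** It consists of classical many-sorted logic; the axioms of $\mathsf{WE}\text{-}\mathsf{PA}^\omega$ over these types ($=_0$ is an equivalence relation, successor axioms, induction for all formulas, defining equations of $\Pi,\Sigma,\underline R$) with the quantifier-free extensionality rule (from $A_0\to s=_\rho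 t$ infer $A_0\to r[s]=_\tau r[t]$, for $A_0$ quantifier-free); the schema $\mathsf{QF}\text{-}\mathsf{AC}$, $\forall\underline x\exists\underline yA_0(\underline x,\underline y)\to\exists\underline Y\forall\underline xA_0(\underline x,\underline Y\underline x)$ for tuples of all types and quantifier-free $A_0$; the schema $\mathsf{DC}$, $\forall x^0,\underline y\exists\underline zA(x,\underline y,\underline z)\to\exists\underline f\forall x^0A(x,\underline f(x),\underline f(Sx))$ for tuples of all types and arbitrary $A$; and the universal closures of: - $\mathrm{eq}\,xy\le_01$; $=_\Omega$ is an equivalence relation; $\in xA\le_01$; $x\notin\emptyset$; $x\in A\cup B\leftrightarrow x\in A\vee x\in B$; $x\in A^c\leftrightarrow x\notin A$. - $0\le_{\mathbb R}\mathbb P(A)\le_{\mathbb R}1$; $\mathbb P(\emptyset)=_{\mathbb R}0$; $\mathbb P(A\cup B)=_{\mathbb R}\mathbb P(A)+\mathbb P(B)-\mathbb P(A\cap B)$; $\exists x^\Omega(\mathbb P(A)>_{\mathbb R}\mathbb P(B)\to x\in A\wedge x\notin B)$. - $[a,b](r)\le_01$; $r\in[a,b]\to a\le_{\mathbb R}r\le_{\mathbb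 R}b$; $a<_{\mathbb R}r<_{\mathbb R}b\to r\in[a,b]$; $a\le_{\mathbb R}b\to a\in[a,b]\wedge b\in[a,b]$. - $f^{-1}Ax\le_01$; $x\in f^{-1}A\leftrightarrow A(f(x))=_00$ (for $A$ of type $0(1)$). - $If\le_01$; $\lambda x.(\in xA)\in I$ (values read as reals); $\exists A^S\forall x^\Omega(f\in I\to(x\in f^{-1}([a,b])\leftrightarrow x\in A))$; $f\in I\to|f(x)|\le_{\mathbb R}\|f\|_\infty$; $\exists x^\Omega(f\in I\to\|f\|_\infty-2^{-k}\le_{\mathbb R}|f(x)|)$; $f,g\in I\to\alpha f+\beta g\in I$; $f\in I\to|f|\in I$. - $\int\chi_A\,d\mathbb P=_{\mathbb R}\mathbb P(A)$; $f,g\in I\to\int(\alpha f+\beta g)\,d\mathbb P=_{\mathbb R}\alpha\int f\,d\mathbb P+\beta\int g\,d\mathbb P$; $\exists A^{S(0)}\bigl(f\in I\to\int\bigl|f-\sum_{i=0}^{2^{k+1}b_f-1}(-b_f+\tfrac i{2^k})\chi_{A(i)}\bigr|d\mathbb P\le_{\mathbb R}2^{-k}\bigr)$ with $b_f:=\|f\|_\infty(0)+1$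 (the value at $0$ of the sequence $\|f\|_\infty$, as a natural number); $\exists x^\Omega(f\in I\wedge\int f\,d\mathbb P<_{\mathbb R}-2^{-k}\to f(x)\le_{\mathbb R}-2^{-k})$. - $X(n)\in I$; $x\in P(a,b,c)\leftrightarrow x\in(|X(c)-X(b)|)^{-1}([0,2^{-a}])$. **Theorem.** $\mathcal F^\omega[\mathbb P,\mathrm{Integral},X]$ proves: if $X$ converges almost uniformly metastable pointwisely, i.e. $$\forall k^0,a^0,F^1\,\exists b^0\ \ \mathbb P\Bigl(\bigcap_{m=0}^b\bigcup_{i=m}^{F(m)}\bigcup_{j=m}^{F(m)}P(a,i,j)^c\Bigr)\le_{\mathbb R}2^{-k},$$ then $X$ converges almost uniformly with respect to finite unions, i.e. $$\forall k^0,a^0\,\exists b^0\,\forall c^0\ \ \mathbb P\Bigl(\bigcup_{i=b}^c\bigcup_{j=b}^cP(a,i,j)^c\Bigr)\le_{\mathbb R}2^{-k}.$$ -/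

import Mathlib

namespace PContent

/-! # Types, terms and formulas -/

/-- Finite types over the ground types `0` (`nat`), `Ω` (`pt`) and `S` (`ev`).
`arr σ τ` is the type of functions from `σ` to `τ`, in bracket notation `τ(σ)`. -/
inductive Ty : Type
  | nat : Ty
  | pt : Ty
  | ev : Ty
  | arr : Ty → Ty → Ty

infixr:60 " ⇝ " => Ty.arr

/-- The type `1 = 0(0)`; its objects also code real numbers. -/
abbrev Ty.one : Ty := Ty.nat ⇝ Ty.nat

/-- The type `1(Ω)` of (codes of) real-valued functions on `Ω`. -/
abbrev Ty.fn : Ty := Ty.pt ⇝ Ty.one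

open Ty

/-- Contexts, and finite tuples of types. -/
abbrev Ctx : Type := List Ty

/-- `Var Γ τ`: positions of type `τ` in the context `Γ` (typed de Bruijn indices). -/
inductive Var : Ctx → Ty → Type
  | zero {Γ : Ctx} {τ : Ty} : Var (τ :: Γ) τ
  | succ {Γ : Ctx} {σ τ : Ty} (v : Var Γ τ) : Var (σ :: Γ) τ

/-- The position that corresponds to `v` in the tuple of the types `f ρ`. -/
def Var.map (f : Ty → Ty) : {Γ : Ctx} → {τ : Ty} → Var Γ τ → Var (Γ.map f) (f τ)
  | _, _, .zero => .zero
  | _, _, .succ v => .succ (Var.map f v)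

/-- `arrs [ρ₁, …, ρₖ] τ` is `ρ₁ ⇝ … ⇝ ρₖ ⇝ τ`. -/
@[reducible] def arrs : List Ty → Ty → Ty
  | [], τ => τ
  | ρ :: ρs, τ => ρ ⇝ arrs ρs τ

/-- The type of the step functional `zᵢ` in simultaneous recursion over the tuple `ρs`, where
`τ` is the `i`-th type of the tuple. -/
abbrev stepTy (ρs : List Ty) (τ : Ty) : Ty := arrs ρs (nat ⇝ τ)

/-- The type of the recursor `Rᵢ` for the tuple `ρs`, where `τ` is its `i`-th type. -/
abbrev recTy (ρs : List Ty) (τ : Ty) : Ty :=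
  nat ⇝ arrs ρs (arrs (ρs.map (stepTy ρs)) τ)

/-- The constants of the language. -/
inductive Const : Ty → Type
  | zero : Const nat
  | succ : Const (nat ⇝ nat)
  /-- Schönfinkel's combinator `Π x y = x`. -/
  | proj (ρ τ : Ty) : Const (ρ ⇝ τ ⇝ ρ)
  /-- Schönfinkel's combinator `Σ x y z = x z (y z)`. -/
  | comb (δ ρ τ : Ty) : Const ((δ ⇝ ρ ⇝ τ) ⇝ (δ ⇝ ρ) ⇝ δ ⇝ τ)
  /-- Simultaneous primitive recursion in all finite types. -/
  | recur (ρs : List Ty) {τ : Ty} (i : Var ρs τ) : Const (recTy ρs τ)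
  /-- Equality on `Ω`. -/
  | eqPt : Const (pt ⇝ pt ⇝ nat)
  /-- Membership of points in events. -/
  | mem : Const (pt ⇝ ev ⇝ nat)
  | union : Const (ev ⇝ ev ⇝ ev)
  | compl : Const (ev ⇝ ev)
  | empty : Const ev
  /-- The point `c_Ω`. -/
  | point : Const pt
  /-- The probability content `ℙ`. -/
  | prob : Const (ev ⇝ one)
  /-- Characteristic functions of closed intervals `[a, b]`. -/
  | interval : Const (one ⇝ one ⇝ one ⇝ nat)
  /-- The inverse image `f⁻¹ A`, subsets being given by characteristic functions. -/
  | inv : Const (fn ⇝ (one ⇝ nat) ⇝ pt ⇝ nat)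
  /-- The characteristic function of the class `I` of bounded weakly Borel-measurable functions. -/
  | intClass : Const (fn ⇝ nat)
  /-- The supremum norm. -/
  | supNorm : Const (fn ⇝ one)
  /-- The integral. -/
  | integral : Const (fn ⇝ one)
  /-- The sequence `X` of functions. -/
  | seqX : Const (nat ⇝ fn)
  /-- The functional `P`, giving the events `P(a, b, c) = {|X c - X b| ∈ [0, 2⁻ᵃ]}`. -/
  | setP : Const (nat ⇝ nat ⇝ nat ⇝ ev)

/-- Terms of type `τ` with variables in `Γ`. -/
inductive Tm (Γ : Ctx) : Ty → Type
  | var {τ : Ty} (v : Var Γ τ) : Tm Γ τ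
  | const {τ : Ty} (c : Const τ) : Tm Γ τ
  | app {σ τ : Ty} (s : Tm Γ (σ ⇝ τ)) (t : Tm Γ σ) : Tm Γ τ

infixl:100 " ⬝ " => Tm.app

/-- Substitutions for the variables of `Γ` by terms over `Δ`; also used for tuples of terms over
`Δ` whose types are listed in `Γ`. -/
abbrev Sub (Γ Δ : Ctx) : Type := (τ : Ty) → Var Γ τ → Tm Δ τ

def Tm.subst {Γ Δ : Ctx} (s : Sub Γ Δ) : {τ : Ty} → Tm Γ τ → Tm Δ τ
  | _, .var v => s _ v
  | _, .const c => .const c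
  | _, .app t u => .app (Tm.subst s t) (Tm.subst s u)

def Sub.id (Γ : Ctx) : Sub Γ Γ := fun _ v => .var v

/-- The substitution that renames every variable into the context with one more variable. -/
def Sub.shift (Γ : Ctx) (σ : Ty) : Sub Γ (σ :: Γ) := fun _ v => .var (.succ v)

/-- Weakening: `t` in the context with one more variable. -/
def Tm.wk {Γ : Ctx} {σ τ : Ty} (t : Tm Γ τ) : Tm (σ :: Γ) τ := t.subst (Sub.shift Γ σ)

def Sub.cons {Γ Δ : Ctx} {σ : Ty} (t : Tm Δ σ) (s : Sub Γ Δ) : Sub (σ :: Γ) Δ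
  | _, .zero => t
  | _, .succ v => s _ v

/-- The substitution `s` under a binder. -/
def Sub.lift {Γ Δ : Ctx} (σ : Ty) (s : Sub Γ Δ) : Sub (σ :: Γ) (σ :: Δ) :=
  Sub.cons (.var .zero) (fun _ v => (s _ v).wk)

/-- Joining two tuples of terms. -/
def Sub.append {Γ Δ : Ctx} : (ρs : List Ty) → Sub ρs Δ → Sub Γ Δ → Sub (ρs ++ Γ) Δ
  | [], _, s => s
  | _ :: ρs, r, s => Sub.cons (r _ .zero) (Sub.append ρs (fun _ v => r _ (.succ v)) s)

/-- Application of a term to a tuple of terms. -/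
def Tm.apps {Γ : Ctx} {τ : Ty} : (ρs : List Ty) → Tm Γ (arrs ρs τ) → Sub ρs Γ → Tm Γ τ
  | [], t, _ => t
  | _ :: ρs, t, s => Tm.apps ρs (t ⬝ s _ .zero) (fun _ v => s _ (.succ v))

def Var.inl {Γ : Ctx} {τ : Ty} : {ρs : List Ty} → Var ρs τ → Var (ρs ++ Γ) τ
  | _, .zero => .zero
  | _, .succ v => .succ (Var.inl v)

def Var.inr {Γ : Ctx} {τ : Ty} : (ρs : List Ty) → Var Γ τ → Var (ρs ++ Γ) τ
  | [], v => v
  | _ :: ρs, v => .succ (Var.inr ρs v)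

/-- Formulas: equality at type `0` is the only primitive relation. -/
inductive Fml : Ctx → Type
  | eq {Γ : Ctx} (s t : Tm Γ nat) : Fml Γ
  | bot {Γ : Ctx} : Fml Γ
  | imp {Γ : Ctx} (A B : Fml Γ) : Fml Γ
  | and {Γ : Ctx} (A B : Fml Γ) : Fml Γ
  | or {Γ : Ctx} (A B : Fml Γ) : Fml Γ
  | all {Γ : Ctx} (σ : Ty) (A : Fml (σ :: Γ)) : Fml Γ
  | ex {Γ : Ctx} (σ : Ty) (A : Fml (σ :: Γ)) : Fml Γ

namespace Fml

def neg {Γ : Ctx} (A : Fml Γ) : Fml Γ := imp A bot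

def iff {Γ : Ctx} (A B : Fml Γ) : Fml Γ := and (imp A B) (imp B A)

def subst : {Γ Δ : Ctx} → Sub Γ Δ → Fml Γ → Fml Δ
  | _, _, s, eq t u => eq (t.subst s) (u.subst s)
  | _, _, _, bot => bot
  | _, _, s, imp A B => imp (subst s A) (subst s B)
  | _, _, s, and A B => and (subst s A) (subst s B)
  | _, _, s, or A B => or (subst s A) (subst s B)
  | _, _, s, all σ A => all σ (subst (s.lift σ) A)
  | _, _, s, ex σ A => ex σ (subst (s.lift σ) A)

def wk {Γ : Ctx} {σ : Ty} (A : Fml Γ) : Fml (σ :: Γ) := A.subst (Sub.shift Γ σ)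

/-- `A[t/x]` for the innermost variable `x`. -/
def inst {Γ : Ctx} {σ : Ty} (A : Fml (σ :: Γ)) (t : Tm Γ σ) : Fml Γ :=
  A.subst (Sub.cons t (Sub.id Γ))

/-- Quantifier-free formulas. -/
def QF : {Γ : Ctx} → Fml Γ → Prop
  | _, eq _ _ => True
  | _, bot => True
  | _, imp A B => QF A ∧ QF B
  | _, and A B => QF A ∧ QF B
  | _, or A B => QF A ∧ QF B
  | _, all _ _ => False
  | _, ex _ _ => False

/-- Universal quantification over a tuple of variables. -/
def alls {Γ : Ctx} : (ρs : List Ty) → Fml (ρs ++ Γ) → Fml Γ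
  | [], A => A
  | ρ :: ρs, A => alls ρs (all ρ A)

/-- Existential quantification over a tuple of variables. -/
def exs {Γ : Ctx} : (ρs : List Ty) → Fml (ρs ++ Γ) → Fml Γ
  | [], A => A
  | ρ :: ρs, A => exs ρs (ex ρ A)

end Fml

infixr:25 " ⟹ " => Fml.imp
infixr:35 " ⋏ " => Fml.and
infixr:30 " ⋎ " => Fml.or
infix:20 " ⇔' " => Fml.iff

section Vars
variable {Γ : Ctx} {a b c d e f : Ty}

abbrev v0 : Tm (a :: Γ) a := .var .zero
abbrev v1 : Tm (b :: a :: Γ) a := .var (.succ .zero)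
abbrev v2 : Tm (c :: b :: a :: Γ) a := .var (.succ (.succ .zero))
abbrev v3 : Tm (d :: c :: b :: a :: Γ) a := .var (.succ (.succ (.succ .zero)))
abbrev v4 : Tm (e :: d :: c :: b :: a :: Γ) a := .var (.succ (.succ (.succ (.succ .zero))))
abbrev v5 : Tm (f :: e :: d :: c :: b :: a :: Γ) a :=
  .var (.succ (.succ (.succ (.succ (.succ .zero)))))

end Vars

/-! # Lambda abstraction by combinators -/

/-- `t` without the innermost variable, if that variable does not occur in `t`. -/
def Tm.drop {Γ : Ctx} {σ : Ty} : {τ : Ty} → Tm (σ :: Γ) τ → Option (Tm Γ τ)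
  | _, .var .zero => none
  | _, .var (.succ v) => some (.var v)
  | _, .const c => some (.const c)
  | _, .app s t =>
    match s.drop, t.drop with
    | some s', some t' => some (s' ⬝ t')
    | _, _ => none

/-- `λx.t` for the innermost variable `x` of `t`: it is `Σ Π Π` if `t` is `x`, `Π t` if `x` does
not occur in `t`, and `Σ (λx.r) (λx.u)` if `t` is an application `r u` in which `x` occurs. -/
def lam {Γ : Ctx} {σ : Ty} : {τ : Ty} → Tm (σ :: Γ) τ → Tm Γ (σ ⇝ τ)
  | _, .var .zero => .const (.comb σ (σ ⇝ σ) σ) ⬝ .const (.proj σ (σ ⇝ σ)) ⬝ .const (.proj σ σ)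
  | _, .var (.succ v) => .const (.proj _ σ) ⬝ .var v
  | _, .const c => .const (.proj _ σ) ⬝ .const c
  | _, .app s t =>
    match (s ⬝ t).drop with
    | some u => .const (.proj _ σ) ⬝ u
    | none => .const (.comb σ _ _) ⬝ lam s ⬝ lam t

/-! # Arithmetic -/

section Arithmetic
variable {Γ : Ctx}

def zero : Tm Γ nat := .const .zero

def succ (t : Tm Γ nat) : Tm Γ nat := .const .succ ⬝ t

def n1 : Tm Γ nat := succ zero

def n2 : Tm Γ nat := succ n1

/-- The recursor for a single type: `rc 0 y z = y` and `rc (S x) y z = z (rc x y z) x`. -/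
def rc {ρ : Ty} (x : Tm Γ nat) (y : Tm Γ ρ) (z : Tm Γ (ρ ⇝ nat ⇝ ρ)) : Tm Γ ρ :=
  Tm.app (Tm.app (Tm.app (Tm.const (.recur [ρ] .zero) : Tm Γ (nat ⇝ ρ ⇝ (ρ ⇝ nat ⇝ ρ) ⇝ ρ)) x) y) z

def predT : Tm Γ (nat ⇝ nat) := lam (rc v0 zero (lam (lam v0)))
def pred (t : Tm Γ nat) : Tm Γ nat := predT ⬝ t

def addT : Tm Γ (nat ⇝ nat ⇝ nat) := lam (lam (rc v0 v1 (lam (lam (succ v1)))))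
def add (s t : Tm Γ nat) : Tm Γ nat := addT ⬝ s ⬝ t

/-- Truncated subtraction. -/
def monusT : Tm Γ (nat ⇝ nat ⇝ nat) := lam (lam (rc v0 v1 (lam (lam (pred v1)))))
def monus (s t : Tm Γ nat) : Tm Γ nat := monusT ⬝ s ⬝ t

def mulT : Tm Γ (nat ⇝ nat ⇝ nat) := lam (lam (rc v0 zero (lam (lam (add v1 v3)))))
def mul (s t : Tm Γ nat) : Tm Γ nat := mulT ⬝ s ⬝ t

/-- `n ↦ 2ⁿ`. -/
def powT : Tm Γ (nat ⇝ nat) := lam (rc v0 n1 (lam (lam (add v1 v1))))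
def pow (t : Tm Γ nat) : Tm Γ nat := powT ⬝ t

/-- `sg n` is `0` if `n = 0` and `1` otherwise. -/
def sgT : Tm Γ (nat ⇝ nat) := lam (monus n1 (monus n1 v0))
def sg (t : Tm Γ nat) : Tm Γ nat := sgT ⬝ t

/-- The remainder of `n` modulo `2`. -/
def parT : Tm Γ (nat ⇝ nat) := lam (rc v0 zero (lam (lam (monus n1 v1))))
def par (t : Tm Γ nat) : Tm Γ nat := parT ⬝ t

/-- The integer part of `n / 2`. -/
def halfT : Tm Γ (nat ⇝ nat) := lam (rc v0 zero (lam (lam (add v1 (par v0)))))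
def half (t : Tm Γ nat) : Tm Γ nat := halfT ⬝ t

/-- `|s - t|` on the natural numbers; it is `0` iff `s = t`. -/
def dist (s t : Tm Γ nat) : Tm Γ nat := add (monus s t) (monus t s)

/-- `leastT f n` is the least `k < n` with `f k = 0` if there is one, and `n` otherwise. -/
def leastT : Tm Γ (one ⇝ nat ⇝ nat) :=
  lam (lam (rc v0 zero (lam (lam (add v1 (mul (monus n1 (monus v0 v1)) (sg (v3 ⬝ v0))))))))
def least (f : Tm Γ Ty.one) (n : Tm Γ nat) : Tm Γ nat := leastT ⬝ f ⬝ n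

/-- `bminT f n` is the least `u ≤ n` with `f u = 0` if there is one, and `0` otherwise. -/
def bminT : Tm Γ (one ⇝ nat ⇝ nat) :=
  lam (lam (mul (least v1 (succ v0)) (monus n1 (monus (least v1 (succ v0)) v0))))
def bmin (f : Tm Γ Ty.one) (n : Tm Γ nat) : Tm Γ nat := bminT ⬝ f ⬝ n

/-- `(n + m)² + 3n + m`. -/
def pairPolyT : Tm Γ (nat ⇝ nat ⇝ nat) :=
  lam (lam (add (add (mul (add v1 v0) (add v1 v0)) (mul (succ n2) v1)) v0))
def pairPoly (s t : Tm Γ nat) : Tm Γ nat := pairPolyT ⬝ s ⬝ t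

/-- The pairing function: `j n m` is the least `u ≤ (n + m)² + 3n + m` with
`2u = (n + m)² + 3n + m`. -/
def jT : Tm Γ (nat ⇝ nat ⇝ nat) :=
  lam (lam (bmin (lam (dist (mul n2 v0) (pairPoly v2 v1))) (pairPoly v1 v0)))
def j (s t : Tm Γ nat) : Tm Γ nat := jT ⬝ s ⬝ t

/-- The first projection: the least `n ≤ z` such that `2z = (n + m)² + 3n + m` for some
`m ≤ z`. -/
def j1T : Tm Γ (nat ⇝ nat) :=
  lam (bmin (lam (monus (least (lam (dist (mul n2 v2) (pairPoly v1 v0))) (succ v1)) v1)) v0)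
def j1 (t : Tm Γ nat) : Tm Γ nat := j1T ⬝ t

/-- The second projection: the least `m ≤ z` such that `2z = (n + m)² + 3n + m` for some
`n ≤ z`. -/
def j2T : Tm Γ (nat ⇝ nat) :=
  lam (bmin (lam (monus (least (lam (dist (mul n2 v2) (pairPoly v0 v1))) (succ v1)) v1)) v0)
def j2 (t : Tm Γ nat) : Tm Γ nat := j2T ⬝ t

/-- The relation `s ≤₀ t`. -/
def le0 (s t : Tm Γ nat) : Fml Γ := .eq (monus s t) zero

/-! # Rational numbers

The natural number `j n m` codes the rational `(n / 2) / (m + 1)` if `n` is even, and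
`-((n + 1) / 2) / (m + 1)` if `n` is odd. -/

/-- The numerator of the positive part of the rational coded by `z`. -/
def posT : Tm Γ (nat ⇝ nat) := lam (mul (monus n1 (par (j1 v0))) (half (j1 v0)))
def pos (t : Tm Γ nat) : Tm Γ nat := posT ⬝ t

/-- The numerator of the negative part of the rational coded by `z`. -/
def ngvT : Tm Γ (nat ⇝ nat) := lam (mul (par (j1 v0)) (succ (half (j1 v0))))
def ngv (t : Tm Γ nat) : Tm Γ nat := ngvT ⬝ t

/-- The (positive) denominator. -/
def den (t : Tm Γ nat) : Tm Γ nat := succ (j2 t)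

/-- A code of the rational `(p - q) / d`, for `d > 0`. -/
def mkQT : Tm Γ (nat ⇝ nat ⇝ nat ⇝ nat) :=
  lam (lam (lam
    (j (add (mul n2 (monus v2 v1)) (monus (mul n2 (monus v1 v2)) n1)) (pred v0))))
def mkQ (p q d : Tm Γ nat) : Tm Γ nat := mkQT ⬝ p ⬝ q ⬝ d

def addQT : Tm Γ (nat ⇝ nat ⇝ nat) :=
  lam (lam (mkQ
    (add (mul (pos v1) (den v0)) (mul (pos v0) (den v1)))
    (add (mul (ngv v1) (den v0)) (mul (ngv v0) (den v1)))
    (mul (den v1) (den v0))))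
def addQ (s t : Tm Γ nat) : Tm Γ nat := addQT ⬝ s ⬝ t

def negQT : Tm Γ (nat ⇝ nat) := lam (mkQ (ngv v0) (pos v0) (den v0))
def negQ (t : Tm Γ nat) : Tm Γ nat := negQT ⬝ t

def subQ (s t : Tm Γ nat) : Tm Γ nat := addQ s (negQ t)

def absQT : Tm Γ (nat ⇝ nat) := lam (mkQ (add (pos v0) (ngv v0)) zero (den v0))
def absQ (t : Tm Γ nat) : Tm Γ nat := absQT ⬝ t

def mulQT : Tm Γ (nat ⇝ nat ⇝ nat) :=
  lam (lam (mkQ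
    (add (mul (pos v1) (pos v0)) (mul (ngv v1) (ngv v0)))
    (add (mul (pos v1) (ngv v0)) (mul (ngv v1) (pos v0)))
    (mul (den v1) (den v0))))
def mulQ (s t : Tm Γ nat) : Tm Γ nat := mulQT ⬝ s ⬝ t

/-- A number that is `0` iff the rational coded by `s` is at most the one coded by `t`. -/
def cmpQT : Tm Γ (nat ⇝ nat ⇝ nat) :=
  lam (lam (monus
    (add (mul (pos v1) (den v0)) (mul (ngv v0) (den v1)))
    (add (mul (pos v0) (den v1)) (mul (ngv v1) (den v0)))))
def cmpQ (s t : Tm Γ nat) : Tm Γ nat := cmpQT ⬝ s ⬝ t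

def leQ (s t : Tm Γ nat) : Fml Γ := .eq (cmpQ s t) zero

def ltQ (s t : Tm Γ nat) : Fml Γ := (leQ t s).neg

/-- The rational `n / 2ᵏ`. -/
def dyadQ (n k : Tm Γ nat) : Tm Γ nat := mkQ n zero (pow k)

/-- The rational `2⁻ᵏ`. -/
def invPowQ (k : Tm Γ nat) : Tm Γ nat := dyadQ n1 k

/-! # Real numbers

A real number is represented by a sequence of codes of rationals, i.e. by an object of type `1`. -/

/-- `hat x` agrees with `x` up to the first `k` with `|x k - x (k + 1)| ≥ 2^(-k-1)` and is
constant from there on. -/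
def hatT : Tm Γ (one ⇝ one) :=
  lam (lam (v1 ⬝ least
    (lam (cmpQ (invPowQ (succ v0)) (absQ (subQ (v2 ⬝ v0) (v2 ⬝ succ v0))))) v0))
def hat (x : Tm Γ Ty.one) (n : Tm Γ nat) : Tm Γ nat := hatT ⬝ x ⬝ n

/-- The constant sequence of a rational. -/
def constRT : Tm Γ (nat ⇝ one) := lam (lam v1)
def constR (q : Tm Γ nat) : Tm Γ Ty.one := constRT ⬝ q

/-- The natural number `n` as a real number. -/
def natR (n : Tm Γ nat) : Tm Γ Ty.one := constR (mkQ n zero n1)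

/-- The real number `2⁻ᵏ`. -/
def invPowR (k : Tm Γ nat) : Tm Γ Ty.one := constR (invPowQ k)

def addRT : Tm Γ (one ⇝ one ⇝ one) :=
  lam (lam (lam (addQ (hat v2 (succ v0)) (hat v1 (succ v0)))))
def addR (x y : Tm Γ Ty.one) : Tm Γ Ty.one := addRT ⬝ x ⬝ y

def negRT : Tm Γ (one ⇝ one) := lam (lam (negQ (hat v1 v0)))
def negR (x : Tm Γ Ty.one) : Tm Γ Ty.one := negRT ⬝ x

def subR (x y : Tm Γ Ty.one) : Tm Γ Ty.one := addR x (negR y)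

def absRT : Tm Γ (one ⇝ one) := lam (lam (absQ (hat v1 v0)))
def absR (x : Tm Γ Ty.one) : Tm Γ Ty.one := absRT ⬝ x

/-- Multiplication: `(x y) n = x̂ (n + k) ŷ (n + k)` with `k = x 0 + y 0 + 2`, so that `2ᵏ` is larger
than the sum of the bounds `|x 0| + 1` and `|y 0| + 1` of the two sequences (a code is at least
the absolute value of the rational that it codes). -/
def mulRT : Tm Γ (one ⇝ one ⇝ one) :=
  lam (lam (lam (mulQ
    (hat v2 (add v0 (add (add (v2 ⬝ zero) (v1 ⬝ zero)) n2)))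
    (hat v1 (add v0 (add (add (v2 ⬝ zero) (v1 ⬝ zero)) n2))))))
def mulR (x y : Tm Γ Ty.one) : Tm Γ Ty.one := mulRT ⬝ x ⬝ y

/-- The sum of the reals `f 0, …, f n`. -/
def sumRT : Tm Γ ((nat ⇝ one) ⇝ nat ⇝ one) :=
  lam (lam (rc v0 (v1 ⬝ zero) (lam (lam (addR v1 (v3 ⬝ succ v0))))))
def sumR (f : Tm Γ (nat ⇝ Ty.one)) (n : Tm Γ nat) : Tm Γ Ty.one := sumRT ⬝ f ⬝ n

def ltR (x y : Tm Γ Ty.one) : Fml Γ :=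
  .ex nat (leQ (invPowQ v0) (subQ (hat y.wk (succ v0)) (hat x.wk (succ v0))))

def leR (x y : Tm Γ Ty.one) : Fml Γ := (ltR y x).neg

def eqR (x y : Tm Γ Ty.one) : Fml Γ :=
  .all nat (ltQ (absQ (subQ (hat x.wk (succ v0)) (hat y.wk (succ v0)))) (invPowQ v0))

end Arithmetic

/-! # Events and functions -/

section Events
variable {Γ : Ctx}

/-- The formula `x ∈ A`, i.e. `∈ x A =₀ 0`. -/
def mem (x : Tm Γ pt) (A : Tm Γ ev) : Fml Γ := .eq (.const .mem ⬝ x ⬝ A) zero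

def union (A B : Tm Γ ev) : Tm Γ ev := .const .union ⬝ A ⬝ B

def compl (A : Tm Γ ev) : Tm Γ ev := .const .compl ⬝ A

def empty : Tm Γ ev := .const .empty

def inter (A B : Tm Γ ev) : Tm Γ ev := compl (union (compl A) (compl B))

def prob (A : Tm Γ ev) : Tm Γ Ty.one := .const .prob ⬝ A

/-- `bigUnionT A n m` is the union of `A n, …, A m`; it is the empty set if `m < n`. The outer
recursor makes the distinction between `n ∸ m = 0` and `n ∸ m > 0`. -/
def bigUnionT : Tm Γ ((nat ⇝ ev) ⇝ nat ⇝ nat ⇝ ev) :=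
  lam (lam (lam
    (rc (monus v1 v0)
      (rc (monus v0 v1) (v2 ⬝ v1) (lam (lam (union v1 (v4 ⬝ succ (add v3 v0))))))
      (lam (lam empty)))))
def bigUnion (n m : Tm Γ nat) (A : Tm Γ (nat ⇝ ev)) : Tm Γ ev := bigUnionT ⬝ A ⬝ n ⬝ m

/-- The intersection of `A n, …, A m`. -/
def bigInter (n m : Tm Γ nat) (A : Tm Γ (nat ⇝ ev)) : Tm Γ ev :=
  compl (bigUnion n m (lam (compl (A.wk ⬝ v0))))

/-- The characteristic function of `A` with value `1` on `A`, real-valued. -/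
def chi (A : Tm Γ ev) : Tm Γ fn := lam (natR (.const .mem ⬝ v0 ⬝ compl A.wk))

/-- The formula `r ∈ [a, b]`. -/
def memIcc (r a b : Tm Γ Ty.one) : Fml Γ := .eq (.const .interval ⬝ a ⬝ b ⬝ r) zero

/-- The formula `x ∈ f⁻¹ A`. -/
def memInv (x : Tm Γ pt) (f : Tm Γ fn) (A : Tm Γ (Ty.one ⇝ nat)) : Fml Γ :=
  .eq (.const .inv ⬝ f ⬝ A ⬝ x) zero

/-- The formula `x ∈ f⁻¹ [a, b]`. -/
def memInvIcc (x : Tm Γ pt) (f : Tm Γ fn) (a b : Tm Γ Ty.one) : Fml Γ :=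
  memInv x f (.const .interval ⬝ a ⬝ b)

/-- The formula `f ∈ I`. -/
def inClass (f : Tm Γ fn) : Fml Γ := .eq (.const .intClass ⬝ f) zero

def supNorm (f : Tm Γ fn) : Tm Γ Ty.one := .const .supNorm ⬝ f

def integral (f : Tm Γ fn) : Tm Γ Ty.one := .const .integral ⬝ f

/-- The natural number `b_f = [‖f‖_∞](0) + 1`. -/
def bound (f : Tm Γ fn) : Tm Γ nat := succ (supNorm f ⬝ zero)

def seqX (n : Tm Γ nat) : Tm Γ fn := .const .seqX ⬝ n

/-- The event `P(a, b, c)`. -/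
def setP (a b c : Tm Γ nat) : Tm Γ ev := .const .setP ⬝ a ⬝ b ⬝ c

end Events

/-- Equality in all types: primitive at type `0`, given by the constant `eq` at type `Ω`,
by having the same elements at type `S`, and pointwise at function types. -/
def eqT : (τ : Ty) → {Γ : Ctx} → Tm Γ τ → Tm Γ τ → Fml Γ
  | .nat, _, s, t => .eq s t
  | .pt, _, s, t => .eq (.const .eqPt ⬝ s ⬝ t) zero
  | .ev, _, s, t => .all pt (mem v0 s.wk ⇔' mem v0 t.wk)
  | .arr σ τ, _, s, t => .all σ (eqT τ (s.wk ⬝ v0) (t.wk ⬝ v0))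

/-! # Derivations -/

/-- A theory: a set of axioms, possibly with free variables, in every context. -/
abbrev Theory : Type := (Γ : Ctx) → Set (Fml Γ)

/-- Many-sorted classical first-order logic (natural deduction) with the axioms of `T` and the
quantifier-free rule of extensionality. The premise of that rule has to be derived without open
assumptions. -/
inductive Derives (T : Theory) : {Γ : Ctx} → List (Fml Γ) → Fml Γ → Prop
  | ax {Γ : Ctx} {H : List (Fml Γ)} {A : Fml Γ} : A ∈ T Γ → Derives T H A
  | hyp {Γ : Ctx} {H : List (Fml Γ)} {A : Fml Γ} : A ∈ H → Derives T H A
  | impI {Γ : Ctx} {H : List (Fml Γ)} {A B : Fml Γ} : Derives T (A :: H) B → Derives T H (A ⟹ B)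
  | impE {Γ : Ctx} {H : List (Fml Γ)} {A B : Fml Γ} :
      Derives T H (A ⟹ B) → Derives T H A → Derives T H B
  | andI {Γ : Ctx} {H : List (Fml Γ)} {A B : Fml Γ} :
      Derives T H A → Derives T H B → Derives T H (A ⋏ B)
  | andE₁ {Γ : Ctx} {H : List (Fml Γ)} {A B : Fml Γ} : Derives T H (A ⋏ B) → Derives T H A
  | andE₂ {Γ : Ctx} {H : List (Fml Γ)} {A B : Fml Γ} : Derives T H (A ⋏ B) → Derives T H B
  | orI₁ {Γ : Ctx} {H : List (Fml Γ)} {A B : Fml Γ} : Derives T H A → Derives T H (A ⋎ B)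
  | orI₂ {Γ : Ctx} {H : List (Fml Γ)} {A B : Fml Γ} : Derives T H B → Derives T H (A ⋎ B)
  | orE {Γ : Ctx} {H : List (Fml Γ)} {A B C : Fml Γ} :
      Derives T H (A ⋎ B) → Derives T (A :: H) C → Derives T (B :: H) C → Derives T H C
  | byContra {Γ : Ctx} {H : List (Fml Γ)} {A : Fml Γ} :
      Derives T (A.neg :: H) .bot → Derives T H A
  | allI {Γ : Ctx} {H : List (Fml Γ)} {σ : Ty} {A : Fml (σ :: Γ)} :
      Derives T (H.map Fml.wk) A → Derives T H (.all σ A)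
  | allE {Γ : Ctx} {H : List (Fml Γ)} {σ : Ty} {A : Fml (σ :: Γ)} (t : Tm Γ σ) :
      Derives T H (.all σ A) → Derives T H (A.inst t)
  | exI {Γ : Ctx} {H : List (Fml Γ)} {σ : Ty} {A : Fml (σ :: Γ)} (t : Tm Γ σ) :
      Derives T H (A.inst t) → Derives T H (.ex σ A)
  | exE {Γ : Ctx} {H : List (Fml Γ)} {σ : Ty} {A : Fml (σ :: Γ)} {B : Fml Γ} :
      Derives T H (.ex σ A) → Derives T (A :: H.map Fml.wk) B.wk → Derives T H B
  | qfER {Γ : Ctx} {H : List (Fml Γ)} {A : Fml Γ} {ρ τ : Ty} {s t : Tm Γ ρ} (r : Tm (ρ :: Γ) τ) :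
      A.QF → Derives T [] (A ⟹ eqT ρ s t) →
      Derives T H (A ⟹ eqT τ (r.subst (Sub.cons s (Sub.id Γ))) (r.subst (Sub.cons t (Sub.id Γ))))

/-- Provability in the theory `T` of a sentence. -/
def Provable (T : Theory) (A : Fml []) : Prop := Derives T [] A

/-- Derivability is monotone in the set of axioms. -/
theorem Derives.mono {T T' : Theory} (h : ∀ Γ, T Γ ⊆ T' Γ) {Γ : Ctx} {H : List (Fml Γ)}
    {A : Fml Γ} (d : Derives T H A) : Derives T' H A := by
  induction d with
  | ax hA => exact .ax (h _ hA)
  | hyp hA => exact .hyp hA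
  | impI _ ih => exact .impI ih
  | impE _ _ ih₁ ih₂ => exact .impE ih₁ ih₂
  | andI _ _ ih₁ ih₂ => exact .andI ih₁ ih₂
  | andE₁ _ ih => exact .andE₁ ih
  | andE₂ _ ih => exact .andE₂ ih
  | orI₁ _ ih => exact .orI₁ ih
  | orI₂ _ ih => exact .orI₂ ih
  | orE _ _ _ ih₁ ih₂ ih₃ => exact .orE ih₁ ih₂ ih₃
  | byContra _ ih => exact .byContra ih
  | allI _ ih => exact .allI ih
  | allE t _ ih => exact .allE t ih
  | exI t _ ih => exact .exI t ih
  | exE _ _ ih₁ ih₂ => exact .exE ih₁ ih₂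
  | qfER r hA _ ih => exact .qfER r hA ih

/-! # Weakly extensional Peano arithmetic in all finite types, with choice -/

/-- The term `Rᵢ x y z` for simultaneous recursion over the tuple of types `ρs`. -/
def recT {Γ : Ctx} (ρs : List Ty) {τ : Ty} (i : Var ρs τ) (x : Tm Γ nat) (y : Sub ρs Γ)
    (z : Sub (ρs.map (stepTy ρs)) Γ) : Tm Γ τ :=
  Tm.apps (ρs.map (stepTy ρs))
    (Tm.apps ρs ((Tm.const (.recur ρs i) :
      Tm Γ (nat ⇝ arrs ρs (arrs (ρs.map (stepTy ρs)) τ))) ⬝ x) y) z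

/-- The non-logical axioms of `WE-PA^ω`. -/
inductive PeanoAx : (Γ : Ctx) → Fml Γ → Prop
  | refl {Γ : Ctx} (s : Tm Γ nat) : PeanoAx Γ (.eq s s)
  | symm {Γ : Ctx} (s t : Tm Γ nat) : PeanoAx Γ (.eq s t ⟹ .eq t s)
  | trans {Γ : Ctx} (s t u : Tm Γ nat) : PeanoAx Γ (.eq s t ⋏ .eq t u ⟹ .eq s u)
  | succ_ne_zero {Γ : Ctx} (s : Tm Γ nat) : PeanoAx Γ (Fml.neg (.eq (succ s) zero))
  | succ_inj {Γ : Ctx} (s t : Tm Γ nat) : PeanoAx Γ (.eq (succ s) (succ t) ⟹ .eq s t)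
  | induction {Γ : Ctx} (A : Fml (nat :: Γ)) :
      PeanoAx Γ (A.inst zero ⋏
        .all nat (A ⟹ A.subst (Sub.cons (succ v0) (Sub.shift Γ nat))) ⟹ .all nat A)
  | proj {Γ : Ctx} {ρ τ : Ty} (x : Tm Γ ρ) (y : Tm Γ τ) :
      PeanoAx Γ (eqT ρ (.const (.proj ρ τ) ⬝ x ⬝ y) x)
  | comb {Γ : Ctx} {δ ρ τ : Ty} (x : Tm Γ (δ ⇝ ρ ⇝ τ)) (y : Tm Γ (δ ⇝ ρ)) (z : Tm Γ δ) :
      PeanoAx Γ (eqT τ (.const (.comb δ ρ τ) ⬝ x ⬝ y ⬝ z) (x ⬝ z ⬝ (y ⬝ z)))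
  | rec_zero {Γ : Ctx} (ρs : List Ty) {τ : Ty} (i : Var ρs τ) (y : Sub ρs Γ)
      (z : Sub (ρs.map (stepTy ρs)) Γ) : PeanoAx Γ (eqT τ (recT ρs i zero y z) (y _ i))
  | rec_succ {Γ : Ctx} (ρs : List Ty) {τ : Ty} (i : Var ρs τ) (x : Tm Γ nat) (y : Sub ρs Γ)
      (z : Sub (ρs.map (stepTy ρs)) Γ) :
      PeanoAx Γ (eqT τ (recT ρs i (succ x) y z)
        (Tm.apps (τ := nat ⇝ τ) ρs (z _ (i.map (stepTy ρs))) (fun _ k => recT ρs k x y z) ⬝ x))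

/-- The substitution of `Y x` for the tuple `y`, from formulas about `(x, y)` to formulas about
`(Y, x)`. -/
def acSub (Γ : Ctx) (xs ys : List Ty) :
    Sub (ys ++ (xs ++ Γ)) (xs ++ (ys.map (arrs xs) ++ Γ)) :=
  Sub.append ys
    (fun _ k => Tm.apps xs (.var (Var.inr xs (Var.inl (k.map (arrs xs)))))
      (fun _ i => .var (Var.inl i)))
    (Sub.append xs (fun _ i => .var (Var.inl i)) (fun _ v => .var (Var.inr xs (Var.inr _ v))))

/-- Quantifier-free choice `QF-AC`: from `∀x ∃y A(x, y)` to `∃Y ∀x A(x, Y x)`, for tuples of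
variables of arbitrary types and `A` quantifier-free. -/
inductive QFAC : (Γ : Ctx) → Fml Γ → Prop
  | mk {Γ : Ctx} (xs ys : List Ty) (A : Fml (ys ++ (xs ++ Γ))) (hA : A.QF) :
      QFAC Γ (Fml.alls xs (Fml.exs ys A) ⟹
        Fml.exs (ys.map (arrs xs)) (Fml.alls xs (A.subst (acSub Γ xs ys))))

/-- The substitution of `f x` for the tuple `y` and of `f (S x)` for the tuple `z`, from formulas
about `(x, y, z)` to formulas about `(f, x)`. -/
def dcSub (Γ : Ctx) (ρs : List Ty) :
    Sub (ρs ++ (ρs ++ (nat :: Γ))) (nat :: (ρs.map (Ty.arr nat) ++ Γ)) :=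
  Sub.append ρs
    (fun _ i => .var (.succ (Var.inl (i.map (Ty.arr nat)))) ⬝ succ v0)
    (Sub.append ρs
      (fun _ i => .var (.succ (Var.inl (i.map (Ty.arr nat)))) ⬝ v0)
      (Sub.cons v0 (fun _ v => .var (.succ (Var.inr _ v)))))

/-- Dependent choice `DC`: from `∀x ∀y ∃z A(x, y, z)` to `∃f ∀x A(x, f x, f (S x))`, for tuples
`y`, `z`, `f` and an arbitrary formula `A`. -/
inductive DC : (Γ : Ctx) → Fml Γ → Prop
  | mk {Γ : Ctx} (ρs : List Ty) (A : Fml (ρs ++ (ρs ++ (nat :: Γ)))) :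
      DC Γ (.all nat (Fml.alls ρs (Fml.exs ρs A)) ⟹
        Fml.exs (ρs.map (Ty.arr nat)) (.all nat (A.subst (dcSub Γ ρs))))

/-- The system `𝒜^ω = WE-PA^ω + QF-AC + DC` over the types with `Ω` and `S`. -/
def analysis : Theory := fun Γ => {A | PeanoAx Γ A ∨ QFAC Γ A ∨ DC Γ A}

/-! # Algebras of sets -/

section Axioms
variable {Γ : Ctx}

def axEq1 : Fml Γ := .all pt <| .all pt <| le0 (.const .eqPt ⬝ v1 ⬝ v0) n1

def axEq2 : Fml Γ := .all pt <| .all pt <| .all pt <|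
  eqT pt v2 v2 ⋏ (eqT pt v2 v1 ⟹ eqT pt v1 v2) ⋏ (eqT pt v2 v1 ⋏ eqT pt v1 v0 ⟹ eqT pt v2 v0)

def axMem1 : Fml Γ := .all pt <| .all ev <| le0 (.const .mem ⬝ v1 ⬝ v0) n1

def axMem2 : Fml Γ := .all pt <| (mem v0 empty).neg

def axMem3 : Fml Γ := .all pt <| .all ev <| .all ev <|
  mem v2 (union v1 v0) ⇔' (mem v2 v1 ⋎ mem v2 v0)

def axMem4 : Fml Γ := .all pt <| .all ev <| mem v1 (compl v0) ⇔' (mem v1 v0).neg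

/-! # Probability contents -/

def axProb1 : Fml Γ := .all ev <| leR (natR zero) (prob v0) ⋏ leR (prob v0) (natR n1)

def axProb2 : Fml Γ := eqR (prob empty) (natR zero)

def axProb3 : Fml Γ := .all ev <| .all ev <|
  eqR (prob (union v1 v0)) (subR (addR (prob v1) (prob v0)) (prob (inter v1 v0)))

def axProb4 : Fml Γ := .all ev <| .all ev <| .ex pt <|
  ltR (prob v1) (prob v2) ⟹ mem v0 v2 ⋏ (mem v0 v1).neg

/-! # Intervals and inverse images -/

def axIcc1 : Fml Γ := .all one <| .all one <| .all one <|
  le0 (.const .interval ⬝ v2 ⬝ v1 ⬝ v0) n1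

def axIcc2 : Fml Γ := .all one <| .all one <| .all one <|
  memIcc v0 v2 v1 ⟹ leR v2 v0 ⋏ leR v0 v1

def axIcc3 : Fml Γ := .all one <| .all one <| .all one <|
  ltR v2 v0 ⋏ ltR v0 v1 ⟹ memIcc v0 v2 v1

def axIcc4 : Fml Γ := .all one <| .all one <|
  leR v1 v0 ⟹ memIcc v1 v1 v0 ⋏ memIcc v0 v1 v0

def axInv1 : Fml Γ := .all fn <| .all (one ⇝ nat) <| .all pt <|
  le0 (.const .inv ⬝ v2 ⬝ v1 ⬝ v0) n1

def axInv2 : Fml Γ := .all fn <| .all (one ⇝ nat) <| .all pt <|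
  memInv v0 v2 v1 ⇔' .eq (v1 ⬝ (v2 ⬝ v0)) zero

/-! # Integrals -/

def axI1 : Fml Γ := .all fn <| le0 (.const .intClass ⬝ v0) n1

def axI2 : Fml Γ := .all ev <| inClass (lam (natR (.const .mem ⬝ v0 ⬝ v1)))

def axI3 : Fml Γ := .all fn <| .all one <| .all one <| .ex ev <| .all pt <|
  inClass v4 ⟹ (memInvIcc v0 v4 v3 v2 ⇔' mem v0 v1)

def axI4 : Fml Γ := .all fn <| .all pt <|
  inClass v1 ⟹ leR (absR (v1 ⬝ v0)) (supNorm v1)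

def axI5 : Fml Γ := .all fn <| .all nat <| .ex pt <|
  inClass v2 ⟹ leR (subR (supNorm v2) (invPowR v1)) (absR (v2 ⬝ v0))

/-- The function `α f + β g`. -/
def linComb (α : Tm Γ Ty.one) (f : Tm Γ fn) (β : Tm Γ Ty.one) (g : Tm Γ fn) : Tm Γ fn :=
  lam (addR (mulR α.wk (f.wk ⬝ v0)) (mulR β.wk (g.wk ⬝ v0)))

def axI6 : Fml Γ := .all fn <| .all fn <| .all one <| .all one <|
  inClass v3 ⋏ inClass v2 ⟹ inClass (linComb v1 v3 v0 v2)

def axI7 : Fml Γ := .all fn <| inClass v0 ⟹ inClass (lam (absR (v1 ⬝ v0)))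

def axInt1 : Fml Γ := .all ev <| eqR (integral (chi v0)) (prob v0)

def axInt2 : Fml Γ := .all fn <| .all fn <| .all one <| .all one <|
  inClass v3 ⋏ inClass v2 ⟹
    eqR (integral (linComb v1 v3 v0 v2)) (addR (mulR v1 (integral v3)) (mulR v0 (integral v2)))

/-- The real number `∑ (-b_f + i / 2ᵏ) χ_{A i} x`, the sum being over
`i = 0, …, 2^(k+1) b_f - 1`. -/
def simpleSum (f : Tm Γ fn) (k : Tm Γ nat) (A : Tm Γ (nat ⇝ ev)) (x : Tm Γ pt) : Tm Γ Ty.one :=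
  sumR
    (lam (mulR (addR (negR (natR (bound f.wk))) (constR (dyadQ v0 k.wk)))
      (chi (A.wk ⬝ v0) ⬝ x.wk)))
    (monus (mul (pow (succ k)) (bound f)) n1)

def axInt3 : Fml Γ := .all fn <| .all nat <| .ex (nat ⇝ ev) <|
  inClass v2 ⟹
    leR (integral (lam (absR (subR (v3 ⬝ v0) (simpleSum v3 v2 v1 v0))))) (invPowR v1)

def axInt4 : Fml Γ := .all fn <| .all nat <| .ex pt <|
  inClass v2 ⋏ ltR (integral v2) (negR (invPowR v1)) ⟹ leR (v2 ⬝ v0) (negR (invPowR v1))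

/-! # The sequence of functions -/

def axX : Fml Γ := .all nat <| inClass (seqX v0)

def axP : Fml Γ := .all nat <| .all nat <| .all nat <| .all pt <|
  mem v0 (setP v3 v2 v1) ⇔'
    memInvIcc v0 (lam (absR (subR (seqX v2 ⬝ v0) (seqX v3 ⬝ v0)))) (natR zero) (invPowR v3)

end Axioms

/-- Axioms for algebras of sets. -/
def algebraAx : Theory := fun _ => {axEq1, axEq2, axMem1, axMem2, axMem3, axMem4}

/-- Axioms for probability contents. -/
def probAx : Theory := fun _ => {axProb1, axProb2, axProb3, axProb4}

/-- Axioms for closed intervals. -/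
def intervalAx : Theory := fun _ => {axIcc1, axIcc2, axIcc3, axIcc4}

/-- Axioms for inverse images. -/
def inverseAx : Theory := fun _ => {axInv1, axInv2}

/-- Axioms for the class `I`, the supremum norm and the integral. -/
def integralAx : Theory := fun _ =>
  {axI1, axI2, axI3, axI4, axI5, axI6, axI7, axInt1, axInt2, axInt3, axInt4}

/-- Axioms for the sequence `X` and the functional `P`. -/
def sequenceAx : Theory := fun _ => {axX, axP}

/-- The system `ℱ^ω[ℙ, Integral, X]`. -/
def systemFPIX : Theory := fun Γ =>
  analysis Γ ∪ algebraAx Γ ∪ probAx Γ ∪ intervalAx Γ ∪ inverseAx Γ ∪ integralAx Γ ∪ sequenceAx Γ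

/-! # Modes of convergence -/

/-- `X` converges almost uniformly with respect to finite unions:
`∀k, a ∃b ∀c ℙ(⋃_{i=b}^c ⋃_{j=b}^c P(a, i, j)^c) ≤ 2⁻ᵏ`. -/
def almostUniform : Fml [] :=
  .all nat <| .all nat <| .ex nat <| .all nat <|
    leR
      (prob (bigUnion v1 v0 (lam (bigUnion v2 v1 (lam (compl (setP v4 v1 v0)))))))
      (invPowR v3)

/-- `X` converges almost uniform metastable pointwisely:
`∀k, a, F ∃b ℙ(⋂_{m=0}^b ⋃_{i=m}^{F m} ⋃_{j=m}^{F m} P(a, i, j)^c) ≤ 2⁻ᵏ`. -/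
def almostUniformMetastable : Fml [] :=
  .all nat <| .all nat <| .all one <| .ex nat <|
    leR
      (prob (bigInter zero v0 (lam
        (bigUnion v0 (v2 ⬝ v0) (lam
          (bigUnion v1 (v3 ⬝ v1) (lam
            (compl (setP v5 v1 v0)))))))))
      (invPowR v3)

end PContent

/-! Mathematically, fix `a` and put `E m c = ⋃_{i=m}^c ⋃_{j=m}^c P(a,i,j)ᶜ`. This event grows with
`c` and shrinks with `m`. For fixed `m` and `l` some `d` satisfies `ℙ(E m c \ E m d) ≤ 2⁻ˡ` for all
`c`: otherwise the events could be enlarged again and again by disjoint pieces of content at least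
`2⁻ˡ`, and after `2ˡ + 1` steps the content would exceed `1` (`exists_forall_rle_diffM`). Choice
turns these `d` into a function `F`, with `l = k + 4 + m`. Metastability for this `F` and `k + 1`
gives a `b` such that `⋂_{m ≤ b} E m (F m)` has content at most `2⁻ᵏ⁻¹`. Since `E b c ⊆ E m c` for
`m ≤ b`, the part of `E b c` outside this intersection lies in the union of the `E m c \ E m (F m)`
with `m ≤ b`, whose contents sum to less than `2⁻ᵏ⁻¹`. Hence `ℙ(E b c) ≤ 2⁻ᵏ` for every `c`
(`exists_forall_rle_probM`).

The claim is about derivability, and the formal derivation is not written out. A completeness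
theorem (`derives_of_models`) reduces it to the argument above inside an arbitrary applicative model
of a fragment of the system: equality, successor, combinators, recursion in single types, full
induction, and dependent choice for numbers. The models come from Henkin theories, as terms modulo
Leibniz equality; the quantifier-free extensionality rule makes provable equations of every type
into identities there. The axioms on events and contents enter as extra assumptions and are
discharged at the end.

The numbers of a model may be nonstandard, so induction is available only for properties defined by
formulas with parameters (`induct'`), and `2⁻ᵏ` is a rational of the model. The numbers form an
ordered semiring that embeds cofinally into an ordered field (`exists_ordered_field`). The coded
rationals take values in that field, and a coded real is handled through the upper and lower bounds
`RLe` and `RGe` by elements of the field. -/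

namespace PContent

open Ty

/-! # Substitution calculus -/

/-- Composition of substitutions. -/
def Sub.comp {Γ Δ Θ : Ctx} (s : Sub Γ Δ) (r : Sub Δ Θ) : Sub Γ Θ := fun τ v => (s τ v).subst r

@[ext]
theorem Sub.ext {Γ Δ : Ctx} {s r : Sub Γ Δ} (h : ∀ τ v, s τ v = r τ v) : s = r :=
  funext fun τ => funext fun v => h τ v

theorem Sub.cons_ext {Γ Δ : Ctx} {σ : Ty} {s r : Sub (σ :: Γ) Δ} (h₀ : s _ .zero = r _ .zero)
    (h : ∀ τ v, s τ (.succ v) = r τ (.succ v)) : s = r := by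
  ext τ v
  cases v with
  | zero => exact h₀
  | succ v => exact h _ v

theorem Tm.subst_id {Γ : Ctx} {τ : Ty} (t : Tm Γ τ) : t.subst (Sub.id Γ) = t := by
  induction t with
  | var v => rfl
  | const c => rfl
  | app s t ihs iht => simp [Tm.subst, ihs, iht]

theorem Tm.subst_subst {Γ Δ Θ : Ctx} {τ : Ty} (t : Tm Γ τ) (s : Sub Γ Δ) (r : Sub Δ Θ) :
    (t.subst s).subst r = t.subst (s.comp r) := by
  induction t with
  | var v => rfl
  | const c => rfl
  | app s t ihs iht => simp [Tm.subst, ihs, iht]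

theorem Sub.shift_comp_cons {Γ Δ : Ctx} {σ : Ty} (t : Tm Δ σ) (s : Sub Γ Δ) :
    (Sub.shift Γ σ).comp (Sub.cons t s) = s := rfl

theorem Sub.cons_comp {Γ Δ Θ : Ctx} {σ : Ty} (t : Tm Δ σ) (s : Sub Γ Δ) (r : Sub Δ Θ) :
    (Sub.cons t s).comp r = Sub.cons (t.subst r) (s.comp r) :=
  Sub.cons_ext rfl fun _ _ => rfl

theorem Sub.id_comp {Γ Δ : Ctx} (s : Sub Γ Δ) : (Sub.id Γ).comp s = s := rfl

theorem Sub.comp_id {Γ Δ : Ctx} (s : Sub Γ Δ) : s.comp (Sub.id Δ) = s := by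
  ext τ v
  exact (s τ v).subst_id

theorem Sub.comp_assoc {Γ Δ Θ Ξ : Ctx} (s : Sub Γ Δ) (r : Sub Δ Θ) (q : Sub Θ Ξ) :
    (s.comp r).comp q = s.comp (r.comp q) := by
  ext τ v
  exact (s τ v).subst_subst r q

theorem Sub.shift_comp_lift {Γ Δ : Ctx} (σ : Ty) (s : Sub Γ Δ) :
    (Sub.shift Γ σ).comp (s.lift σ) = s.comp (Sub.shift Δ σ) := rfl

theorem Sub.lift_id (Γ : Ctx) (σ : Ty) : (Sub.id Γ).lift σ = Sub.id (σ :: Γ) :=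
  Sub.cons_ext rfl fun _ _ => rfl

theorem Tm.wk_subst_lift {Γ Δ : Ctx} {σ τ : Ty} (t : Tm Γ τ) (s : Sub Γ Δ) :
    (t.wk (σ := σ)).subst (s.lift σ) = (t.subst s).wk := by
  simp only [Tm.wk, Tm.subst_subst, Sub.shift_comp_lift]

theorem Tm.wk_subst_cons {Γ Δ : Ctx} {σ τ : Ty} (t : Tm Γ τ) (u : Tm Δ σ) (s : Sub Γ Δ) :
    (t.wk (σ := σ)).subst (Sub.cons u s) = t.subst s := by
  simp only [Tm.wk, Tm.subst_subst, Sub.shift_comp_cons]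

theorem Sub.lift_comp {Γ Δ Θ : Ctx} (σ : Ty) (s : Sub Γ Δ) (r : Sub Δ Θ) :
    (s.lift σ).comp (r.lift σ) = (s.comp r).lift σ :=
  Sub.cons_ext rfl fun _ v => Tm.wk_subst_lift (s _ v) r

theorem Sub.lift_comp_cons {Γ Δ Θ : Ctx} {σ : Ty} (s : Sub Γ Δ) (t : Tm Θ σ) (r : Sub Δ Θ) :
    (s.lift σ).comp (Sub.cons t r) = Sub.cons t (s.comp r) :=
  Sub.cons_ext rfl fun _ v => Tm.wk_subst_cons (s _ v) t r

namespace Fml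

theorem subst_id {Γ : Ctx} (A : Fml Γ) : A.subst (Sub.id Γ) = A := by
  induction A with
  | eq s t => simp [subst, Tm.subst_id]
  | bot => rfl
  | imp A B ihA ihB => simp [subst, ihA, ihB]
  | and A B ihA ihB => simp [subst, ihA, ihB]
  | or A B ihA ihB => simp [subst, ihA, ihB]
  | all σ A ih => simp [subst, Sub.lift_id, ih]
  | ex σ A ih => simp [subst, Sub.lift_id, ih]

theorem subst_subst {Γ Δ Θ : Ctx} (A : Fml Γ) (s : Sub Γ Δ) (r : Sub Δ Θ) :
    (A.subst s).subst r = A.subst (s.comp r) := by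
  induction A generalizing Δ Θ with
  | eq t u => simp [subst, Tm.subst_subst]
  | bot => rfl
  | imp A B ihA ihB => simp [subst, ihA, ihB]
  | and A B ihA ihB => simp [subst, ihA, ihB]
  | or A B ihA ihB => simp [subst, ihA, ihB]
  | all σ A ih => simp [subst, Sub.lift_comp, ih]
  | ex σ A ih => simp [subst, Sub.lift_comp, ih]

theorem wk_subst_lift {Γ Δ : Ctx} {σ : Ty} (A : Fml Γ) (s : Sub Γ Δ) :
    (A.wk (σ := σ)).subst (s.lift σ) = (A.subst s).wk := by
  simp only [wk, subst_subst, Sub.shift_comp_lift]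

theorem wk_subst_cons {Γ Δ : Ctx} {σ : Ty} (A : Fml Γ) (u : Tm Δ σ) (s : Sub Γ Δ) :
    (A.wk (σ := σ)).subst (Sub.cons u s) = A.subst s := by
  simp only [wk, subst_subst, Sub.shift_comp_cons]

theorem subst_lift_subst_cons {Γ Δ Θ : Ctx} {σ : Ty} (A : Fml (σ :: Γ)) (s : Sub Γ Δ) (t : Tm Θ σ)
    (r : Sub Δ Θ) : (A.subst (s.lift σ)).subst (Sub.cons t r) = A.subst (Sub.cons t (s.comp r)) := by
  simp only [subst_subst, Sub.lift_comp_cons]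

theorem inst_subst {Γ Δ : Ctx} {σ : Ty} (A : Fml (σ :: Γ)) (t : Tm Γ σ) (s : Sub Γ Δ) :
    (A.inst t).subst s = (A.subst (s.lift σ)).inst (t.subst s) := by
  simp only [inst, subst_subst, Sub.lift_comp_cons, Sub.cons_comp, Sub.id_comp, Sub.comp_id]

theorem QF.subst {Γ Δ : Ctx} {A : Fml Γ} (hA : A.QF) (s : Sub Γ Δ) : (A.subst s).QF := by
  induction A generalizing Δ with
  | eq s t => trivial
  | bot => trivial
  | imp A B ihA ihB => exact ⟨ihA hA.1 s, ihB hA.2 s⟩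
  | and A B ihA ihB => exact ⟨ihA hA.1 s, ihB hA.2 s⟩
  | or A B ihA ihB => exact ⟨ihA hA.1 s, ihB hA.2 s⟩
  | all σ A ih => exact hA.elim
  | ex σ A ih => exact hA.elim

end Fml

theorem eqT_subst (τ : Ty) {Γ Δ : Ctx} (t u : Tm Γ τ) (s : Sub Γ Δ) :
    (eqT τ t u).subst s = eqT τ (t.subst s) (u.subst s) := by
  induction τ generalizing Γ Δ with
  | nat => rfl
  | pt => rfl
  | ev =>
    simp only [eqT, Fml.subst, Fml.iff, mem, Tm.subst, Tm.wk_subst_lift]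
    rfl
  | arr σ τ _ ih =>
    simp only [eqT, Fml.subst, ih, Tm.subst, Tm.wk_subst_lift]
    rfl

theorem Tm.subst_cons_subst {Γ Δ : Ctx} {ρ τ : Ty} (r : Tm (ρ :: Γ) τ) (t : Tm Γ ρ)
    (s : Sub Γ Δ) : (r.subst (Sub.cons t (Sub.id Γ))).subst s =
      (r.subst (s.lift ρ)).subst (Sub.cons (t.subst s) (Sub.id Δ)) := by
  simp only [Tm.subst_subst, Sub.lift_comp_cons, Sub.cons_comp, Sub.id_comp, Sub.comp_id]

/-! # Structural rules -/

namespace Derives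

variable {T : Theory} {Γ Δ : Ctx} {H H' : List (Fml Γ)} {A B C : Fml Γ}

theorem weaken (d : Derives T H A) (h : H ⊆ H') : Derives T H' A := by
  induction d with
  | ax hA => exact .ax hA
  | hyp hA => exact .hyp (h hA)
  | impI _ ih => exact .impI (ih (List.cons_subset_cons _ h))
  | impE _ _ ih₁ ih₂ => exact .impE (ih₁ h) (ih₂ h)
  | andI _ _ ih₁ ih₂ => exact .andI (ih₁ h) (ih₂ h)
  | andE₁ _ ih => exact .andE₁ (ih h)
  | andE₂ _ ih => exact .andE₂ (ih h)
  | orI₁ _ ih => exact .orI₁ (ih h)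
  | orI₂ _ ih => exact .orI₂ (ih h)
  | orE _ _ _ ih₁ ih₂ ih₃ =>
    exact .orE (ih₁ h) (ih₂ (List.cons_subset_cons _ h)) (ih₃ (List.cons_subset_cons _ h))
  | byContra _ ih => exact .byContra (ih (List.cons_subset_cons _ h))
  | allI _ ih => exact .allI (ih (List.map_subset _ h))
  | allE t _ ih => exact .allE t (ih h)
  | exI t _ ih => exact .exI t (ih h)
  | exE _ _ ih₁ ih₂ => exact .exE (ih₁ h) (ih₂ (List.cons_subset_cons _ (List.map_subset _ h)))
  -- The premise of the extensionality rule has no open assumptions, so it survives unchanged.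
  | qfER r hA d _ => exact .qfER r hA d

/-- Contexts carry the eigenvariable conditions, so substitution passes through every rule. This
moves derivations from one Henkin stage to later ones, where a variable acts as a new constant. -/
theorem subst (hT : ∀ {Γ Δ : Ctx} (s : Sub Γ Δ) {A : Fml Γ}, A ∈ T Γ → A.subst s ∈ T Δ)
    (d : Derives T H A) (s : Sub Γ Δ) : Derives T (H.map (Fml.subst s)) (A.subst s) := by
  induction d generalizing Δ with
  | ax hA => exact .ax (hT s hA)
  | hyp hA => exact .hyp (List.mem_map_of_mem hA)
  | impI _ ih => exact .impI (ih s)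
  | impE _ _ ih₁ ih₂ => exact .impE (ih₁ s) (ih₂ s)
  | andI _ _ ih₁ ih₂ => exact .andI (ih₁ s) (ih₂ s)
  | andE₁ _ ih => exact .andE₁ (ih s)
  | andE₂ _ ih => exact .andE₂ (ih s)
  | orI₁ _ ih => exact .orI₁ (ih s)
  | orI₂ _ ih => exact .orI₂ (ih s)
  | orE _ _ _ ih₁ ih₂ ih₃ => exact .orE (ih₁ s) (ih₂ s) (ih₃ s)
  | byContra _ ih => exact .byContra (ih s)
  | @allI Γ H σ A _ ih =>
    refine .allI ?_
    have := ih (s.lift σ)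
    rw [List.map_map] at this ⊢
    simpa only [Function.comp_def, Fml.wk_subst_lift] using this
  | allE t _ ih =>
    rw [Fml.inst_subst]
    exact .allE _ (ih s)
  | exI t _ ih =>
    have := ih s
    rw [Fml.inst_subst] at this
    exact .exI _ this
  | @exE Γ H σ A B _ _ ih₁ ih₂ =>
    refine .exE (ih₁ s) ?_
    have := ih₂ (s.lift σ)
    rw [List.map_cons, List.map_map] at this
    rw [List.map_map]
    simpa only [Function.comp_def, Fml.wk_subst_lift] using this
  | qfER r hA _ ih =>
    have := ih s
    simp only [Fml.subst, eqT_subst, List.map_nil] at this ⊢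
    rw [Tm.subst_cons_subst, Tm.subst_cons_subst]
    exact .qfER _ (hA.subst s) this

theorem exFalso (d : Derives T H .bot) : Derives T H A :=
  .byContra (d.weaken (List.subset_cons_self _ _))

end Derives

/-! # Countability of the syntax -/

/-- The Henkin construction enumerates all formulas with parameters. Each syntactic class is the
union over `n` of its members of size below `n`, and these layers are countable by induction on `n`.
-/
theorem countable_of_size {α : Type*} (size : α → ℕ) (h : ∀ n, {a | size a < n}.Countable) :
    Countable α := by
  rw [← Set.countable_univ_iff]
  exact (Set.countable_iUnion h).mono fun a _ => Set.mem_iUnion.2 ⟨size a + 1, Nat.lt_succ_self _⟩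

def Ty.size : Ty → ℕ
  | .arr σ τ => σ.size + τ.size + 1
  | _ => 0

instance : Countable Ty := by
  refine countable_of_size Ty.size fun n => ?_
  induction n with
  | zero => simp
  | succ n ih =>
    refine ((Set.toFinite {Ty.nat, Ty.pt, Ty.ev}).countable.union
      (Set.Countable.image2 ih ih Ty.arr)).mono ?_
    rintro (_ | _ | _ | ⟨σ, τ⟩) h
    · simp
    · simp
    · simp
    · simp only [Set.mem_ofPred_eq, Ty.size] at h
      exact Or.inr ⟨σ, by simp only [Set.mem_ofPred_eq]; omega, τ, by
        simp only [Set.mem_ofPred_eq]; omega, rfl⟩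

def Var.toNat : {Γ : Ctx} → {τ : Ty} → Var Γ τ → ℕ
  | _, _, .zero => 0
  | _, _, .succ v => v.toNat + 1

theorem Var.toNat_injective {Γ : Ctx} {τ : Ty} (v w : Var Γ τ) (h : v.toNat = w.toNat) :
    v = w := by
  induction v with
  | zero =>
    cases w with
    | zero => rfl
    | succ w => simp [Var.toNat] at h
  | succ v ih =>
    cases w with
    | zero => simp [Var.toNat] at h
    | succ w => rw [ih w (by simpa [Var.toNat] using h)]

instance (Γ : Ctx) (τ : Ty) : Countable (Var Γ τ) :=
  ⟨⟨Var.toNat, fun v w => Var.toNat_injective v w⟩⟩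

instance : Countable (Σ τ, Const τ) := by
  -- Four bits index the sixteen constants without type parameters.
  let a : Bool × Bool × Bool × Bool → Σ τ, Const τ
    | (false, false, false, false) => ⟨_, .zero⟩
    | (false, false, false, true) => ⟨_, .succ⟩
    | (false, false, true, false) => ⟨_, .eqPt⟩
    | (false, false, true, true) => ⟨_, .mem⟩
    | (false, true, false, false) => ⟨_, .union⟩
    | (false, true, false, true) => ⟨_, .compl⟩
    | (false, true, true, false) => ⟨_, .empty⟩
    | (false, true, true, true) => ⟨_, .point⟩
    | (true, false, false, false) => ⟨_, .prob⟩
    | (true, false, false, true) => ⟨_, .interval⟩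
    | (true, false, true, false) => ⟨_, .inv⟩
    | (true, false, true, true) => ⟨_, .intClass⟩
    | (true, true, false, false) => ⟨_, .supNorm⟩
    | (true, true, false, true) => ⟨_, .integral⟩
    | (true, true, true, false) => ⟨_, .seqX⟩
    | (true, true, true, true) => ⟨_, .setP⟩
  let b : Ty × Ty → Σ τ, Const τ := fun p => ⟨_, .proj p.1 p.2⟩
  let c : Ty × Ty × Ty → Σ τ, Const τ := fun p => ⟨_, .comb p.1 p.2.1 p.2.2⟩
  let d : (Σ (ρs : List Ty) (τ : Ty), Var ρs τ) → Σ τ, Const τ := fun p => ⟨_, .recur p.1 p.2.2⟩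
  rw [← Set.countable_univ_iff]
  refine (((Set.countable_range a).union (Set.countable_range b)).union
    ((Set.countable_range c).union (Set.countable_range d))).mono ?_
  rintro ⟨_, k⟩ -
  cases k with
  | proj ρ τ => exact Or.inl (Or.inr ⟨(ρ, τ), rfl⟩)
  | comb δ ρ τ => exact Or.inr (Or.inl ⟨(δ, ρ, τ), rfl⟩)
  | recur ρs i => exact Or.inr (Or.inr ⟨⟨ρs, _, i⟩, rfl⟩)
  | zero => exact Or.inl (Or.inl ⟨(false, false, false, false), rfl⟩)
  | succ => exact Or.inl (Or.inl ⟨(false, false, false, true), rfl⟩)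
  | eqPt => exact Or.inl (Or.inl ⟨(false, false, true, false), rfl⟩)
  | mem => exact Or.inl (Or.inl ⟨(false, false, true, true), rfl⟩)
  | union => exact Or.inl (Or.inl ⟨(false, true, false, false), rfl⟩)
  | compl => exact Or.inl (Or.inl ⟨(false, true, false, true), rfl⟩)
  | empty => exact Or.inl (Or.inl ⟨(false, true, true, false), rfl⟩)
  | point => exact Or.inl (Or.inl ⟨(false, true, true, true), rfl⟩)
  | prob => exact Or.inl (Or.inl ⟨(true, false, false, false), rfl⟩)
  | interval => exact Or.inl (Or.inl ⟨(true, false, false, true), rfl⟩)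
  | inv => exact Or.inl (Or.inl ⟨(true, false, true, false), rfl⟩)
  | intClass => exact Or.inl (Or.inl ⟨(true, false, true, true), rfl⟩)
  | supNorm => exact Or.inl (Or.inl ⟨(true, true, false, false), rfl⟩)
  | integral => exact Or.inl (Or.inl ⟨(true, true, false, true), rfl⟩)
  | seqX => exact Or.inl (Or.inl ⟨(true, true, true, false), rfl⟩)
  | setP => exact Or.inl (Or.inl ⟨(true, true, true, true), rfl⟩)

instance (τ : Ty) : Countable (Const τ) :=
  Function.Injective.countable (f := fun c => (⟨τ, c⟩ : Σ τ, Const τ)) fun c d h => by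
    simpa using h

def Tm.size {Γ : Ctx} : {τ : Ty} → Tm Γ τ → ℕ
  | _, .app s t => s.size + t.size + 1
  | _, _ => 0

instance (Γ : Ctx) (τ : Ty) : Countable (Tm Γ τ) := by
  refine countable_of_size Tm.size fun n => ?_
  induction n generalizing τ with
  | zero => simp
  | succ n ih =>
    refine ((Set.countable_range Tm.var).union ((Set.countable_range Tm.const).union
      (Set.countable_iUnion fun σ => Set.Countable.image2 (ih (σ ⇝ τ)) (ih σ) Tm.app))).mono ?_
    rintro (v | c | ⟨s, t⟩) h
    · exact Or.inl ⟨v, rfl⟩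
    · exact Or.inr (Or.inl ⟨c, rfl⟩)
    · simp only [Set.mem_ofPred_eq, Tm.size] at h
      exact Or.inr (Or.inr (Set.mem_iUnion.2 ⟨_, s, by simp only [Set.mem_ofPred_eq]; omega, t, by
        simp only [Set.mem_ofPred_eq]; omega, rfl⟩))

def Fml.size : {Γ : Ctx} → Fml Γ → ℕ
  | _, .imp A B => A.size + B.size + 1
  | _, .and A B => A.size + B.size + 1
  | _, .or A B => A.size + B.size + 1
  | _, .all _ A => A.size + 1
  | _, .ex _ A => A.size + 1
  | _, _ => 0

instance (Γ : Ctx) : Countable (Fml Γ) := by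
  refine countable_of_size Fml.size fun n => ?_
  induction n generalizing Γ with
  | zero => simp
  | succ n ih =>
    refine (((((Set.countable_range fun p : Tm Γ nat × Tm Γ nat => Fml.eq p.1 p.2).union
      (Set.countable_singleton Fml.bot)).union
      ((ih Γ).image2 (ih Γ) Fml.imp)).union (((ih Γ).image2 (ih Γ) Fml.and).union
      ((ih Γ).image2 (ih Γ) Fml.or))).union
      ((Set.countable_iUnion fun σ => (ih (σ :: Γ)).image (Fml.all σ)).union
      (Set.countable_iUnion fun σ => (ih (σ :: Γ)).image (Fml.ex σ)))).mono ?_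
    intro A hA
    cases A <;> simp only [Set.mem_ofPred_eq, Fml.size] at hA
    case eq s t => exact Or.inl (Or.inl (Or.inl (Or.inl ⟨(s, t), rfl⟩)))
    case bot => exact Or.inl (Or.inl (Or.inl (Or.inr rfl)))
    case imp A B =>
      exact Or.inl (Or.inl (Or.inr ⟨A, Set.mem_ofPred.2 (by omega), B,
        Set.mem_ofPred.2 (by omega), rfl⟩))
    case and A B =>
      exact Or.inl (Or.inr (Or.inl ⟨A, Set.mem_ofPred.2 (by omega), B,
        Set.mem_ofPred.2 (by omega), rfl⟩))
    case or A B =>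
      exact Or.inl (Or.inr (Or.inr ⟨A, Set.mem_ofPred.2 (by omega), B,
        Set.mem_ofPred.2 (by omega), rfl⟩))
    case all σ A =>
      exact Or.inr (Or.inl (Set.mem_iUnion.2 ⟨σ, A, Set.mem_ofPred.2 (by omega), rfl⟩))
    case ex σ A =>
      exact Or.inr (Or.inr (Set.mem_iUnion.2 ⟨σ, A, Set.mem_ofPred.2 (by omega), rfl⟩))

/-! # Models -/

/-- Applicative structures for the language. -/
structure Model where
  carrier : Ty → Type
  app : {σ τ : Ty} → carrier (σ ⇝ τ) → carrier σ → carrier τ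
  con : {τ : Ty} → Const τ → carrier τ

namespace Model

variable (M : Model)

/-- Assignments of elements of a model to the variables of a context. -/
abbrev Env (Γ : Ctx) : Type := (τ : Ty) → Var Γ τ → M.carrier τ

variable {M}

/-- The assignment in the empty context. -/
def Env.nil : M.Env [] := fun _ v => nomatch v

def Env.cons {Γ : Ctx} {σ : Ty} (x : M.carrier σ) (e : M.Env Γ) : M.Env (σ :: Γ)
  | _, .zero => x
  | _, .succ v => e _ v

def eval {Γ : Ctx} (e : M.Env Γ) : {τ : Ty} → Tm Γ τ → M.carrier τ
  | _, .var v => e _ v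
  | _, .const c => M.con c
  | _, .app s t => M.app (eval e s) (eval e t)

def sat : {Γ : Ctx} → M.Env Γ → Fml Γ → Prop
  | _, e, .eq s t => eval e s = eval e t
  | _, _, .bot => False
  | _, e, .imp A B => sat e A → sat e B
  | _, e, .and A B => sat e A ∧ sat e B
  | _, e, .or A B => sat e A ∨ sat e B
  | _, e, .all σ A => ∀ x : M.carrier σ, sat (Env.cons x e) A
  | _, e, .ex σ A => ∃ x : M.carrier σ, sat (Env.cons x e) A

theorem Env.cons_ext {Γ : Ctx} {σ : Ty} {e e' : M.Env (σ :: Γ)} (h₀ : e _ .zero = e' _ .zero)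
    (h : ∀ τ v, e τ (.succ v) = e' τ (.succ v)) : e = e' := by
  funext τ v
  cases v with
  | zero => exact h₀
  | succ v => exact h _ v

theorem eval_subst {Γ Δ : Ctx} (e : M.Env Δ) (s : Sub Γ Δ) {τ : Ty} (t : Tm Γ τ) :
    eval e (t.subst s) = eval (fun _ v => eval e (s _ v)) t := by
  induction t with
  | var v => rfl
  | const c => rfl
  | app t u iht ihu => simp only [Tm.subst, eval, iht, ihu]

theorem eval_wk {Γ : Ctx} {σ τ : Ty} (e : M.Env Γ) (x : M.carrier σ) (t : Tm Γ τ) :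
    eval (Env.cons x e) t.wk = eval e t := eval_subst _ _ _

theorem sat_subst {Γ Δ : Ctx} (e : M.Env Δ) (s : Sub Γ Δ) (A : Fml Γ) :
    sat e (A.subst s) ↔ sat (fun _ v => eval e (s _ v)) A := by
  induction A generalizing Δ with
  | eq t u => simp only [Fml.subst, sat, eval_subst]
  | bot => rfl
  | imp A B ihA ihB => simp only [Fml.subst, sat, ihA, ihB]
  | and A B ihA ihB => simp only [Fml.subst, sat, ihA, ihB]
  | or A B ihA ihB => simp only [Fml.subst, sat, ihA, ihB]
  | all σ A ih =>
    simp only [Fml.subst, sat, ih]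
    refine forall_congr' fun x => ?_
    rw [Env.cons_ext (e := fun _ v => eval (Env.cons x e) (s.lift σ _ v))
      (e' := Env.cons x fun _ v => eval e (s _ v)) rfl fun τ v => eval_wk e x (s τ v)]
  | ex σ A ih =>
    simp only [Fml.subst, sat, ih]
    refine exists_congr fun x => ?_
    rw [Env.cons_ext (e := fun _ v => eval (Env.cons x e) (s.lift σ _ v))
      (e' := Env.cons x fun _ v => eval e (s _ v)) rfl fun τ v => eval_wk e x (s τ v)]

end Model

/-! # Henkin theories -/

/-- The context of the first `n` members of a sequence of types. -/
@[reducible] def stage (σ : ℕ → Ty) : ℕ → Ctx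
  | 0 => []
  | n + 1 => σ n :: stage σ n

section Henkin

variable {σ : ℕ → Ty}

/-- Weakening from an earlier stage to a later one. -/
def ren {n m : ℕ} (h : n ≤ m) : Sub (stage σ n) (stage σ m) :=
  Nat.leRec (motive := fun m _ => Sub (stage σ n) (stage σ m)) (Sub.id _)
    (fun m _ s => s.comp (Sub.shift (stage σ m) (σ m))) h

theorem ren_self (n : ℕ) : ren (σ := σ) (le_refl n) = Sub.id _ := by
  rw [ren, Nat.leRec_self]

theorem ren_succ {n m : ℕ} (h : n ≤ m) :
    ren (σ := σ) (Nat.le_succ_of_le h) = (ren h).comp (Sub.shift (stage σ m) (σ m)) := by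
  rw [ren, Nat.leRec_succ]
  rfl

theorem ren_comp_ren {n m l : ℕ} (h : n ≤ m) (h' : m ≤ l) :
    (ren (σ := σ) h).comp (ren h') = ren (h.trans h') := by
  induction l, h' using Nat.le_induction with
  | base => rw [ren_self, Sub.comp_id]
  | succ l hl ih => rw [ren_succ hl, ← Sub.comp_assoc, ih, ← ren_succ]

/-- A Henkin complete theory of sentences with parameters from the stages. -/
structure Henkin (σ : ℕ → Ty) (T : Theory) where
  tr : (n : ℕ) → Fml (stage σ n) → Prop
  tr_of_derives : ∀ {n : ℕ} {A : Fml (stage σ n)}, Derives T [] A → tr n A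
  mp : ∀ {n : ℕ} {A B : Fml (stage σ n)}, tr n (A ⟹ B) → tr n A → tr n B
  not_bot : ∀ n, ¬ tr n .bot
  up : ∀ {n m : ℕ} (h : n ≤ m) (A : Fml (stage σ n)), tr m (A.subst (ren h)) ↔ tr n A
  witness : ∀ {n : ℕ} {τ : Ty} {A : Fml (τ :: stage σ n)}, tr n (.ex τ A) →
    ∃ (m : ℕ) (h : n ≤ m) (t : Tm (stage σ m) τ), tr m (A.subst (Sub.cons t (ren h)))
  decide : ∀ (n : ℕ) (A : Fml (stage σ n)), tr n A ∨ tr n A.neg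

/-- Theories closed under substitution. -/
def Theory.Closed (T : Theory) : Prop :=
  ∀ {Γ Δ : Ctx} (s : Sub Γ Δ) {A : Fml Γ}, A ∈ T Γ → A.subst s ∈ T Δ

/-- A closed term of every type. -/
def Tm.default {Γ : Ctx} : (τ : Ty) → Tm Γ τ
  | .nat => zero
  | .pt => .const .point
  | .ev => empty
  | .arr σ τ => .const (.proj τ σ) ⬝ Tm.default τ

/-- Every sort has a closed term, so a fresh variable cannot turn consistent assumptions into
inconsistent ones. -/
theorem Derives.bot_of_wk {T : Theory} {Γ : Ctx} {τ : Ty} {H : List (Fml Γ)}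
    (d : Derives T (H.map (Fml.wk (σ := τ))) .bot) : Derives T H .bot :=
  .allE (A := .bot) (Tm.default τ) (.allI d)

theorem Derives.neg_of_bot {T : Theory} {Γ : Ctx} {H : List (Fml Γ)} {A : Fml Γ}
    (d : Derives T (A :: H) .bot) : Derives T H A.neg := .impI d

/-- One step settles one existential formula: the new variable of the next stage becomes its
witness, unless the formula is already refuted. The conclusion is void when the scheduled formula
does not yet live at this stage or asks for a variable of another type. -/
theorem exists_henkin_step {T : Theory} (hT : T.Closed) {n : ℕ} {H : List (Fml (stage σ n))}
    (hH : ¬ Derives T H .bot) {m : ℕ} {τ : Ty} (A : Fml (τ :: stage σ m)) :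
    ∃ H' : List (Fml (stage σ (n + 1))), ¬ Derives T H' .bot ∧ H.map Fml.wk ⊆ H' ∧
      ∀ (h : m ≤ n), σ n = τ →
        (∃ t, Derives T H' (A.subst (Sub.cons t (ren (Nat.le_succ_of_le h))))) ∨
          Derives T H' ((Fml.ex τ A).neg.subst (ren (Nat.le_succ_of_le h))) := by
  have hwk : ¬ Derives T (H.map (Fml.wk (σ := σ n))) .bot := fun d => hH d.bot_of_wk
  by_cases h : m ≤ n ∧ σ n = τ
  swap
  · exact ⟨_, hwk, List.Subset.refl _, fun h₁ h₂ => (h ⟨h₁, h₂⟩).elim⟩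
  obtain ⟨h, rfl⟩ := h
  let B : Fml (σ n :: stage σ n) := A.subst ((ren h).lift (σ n))
  by_cases hB : Derives T (.ex _ B :: H) .bot
  · refine ⟨_, hwk, List.Subset.refl _, fun _ _ => Or.inr ?_⟩
    have := hB.neg_of_bot.subst hT (Sub.shift (stage σ n) (σ n))
    rw [ren_succ h, ← Fml.subst_subst]
    exact this
  -- As `∃x B` is consistent with the assumptions, existential elimination shows that `B` for the
  -- fresh variable is consistent with them too.
  · refine ⟨B :: H.map Fml.wk, fun d => hB ?_, List.subset_cons_self _ _,
      fun _ _ => Or.inl ⟨v0, ?_⟩⟩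
    · refine .exE (.hyp (List.mem_cons_self ..)) (d.weaken ?_)
      exact List.cons_subset_cons _ (List.map_subset _ (List.subset_cons_self _ _))
    · refine .hyp ?_
      rw [ren_succ h]
      exact List.mem_cons_self ..

/-- Iterates the step along an enumeration of all existential formulas. The hypothesis on `σ` says
that each of them comes up at some stage that is late enough and whose new variable has the right
type. -/
theorem exists_henkin_chain {T : Theory} (hT : T.Closed)
    (hσ : ∀ (n : ℕ) (τ : Ty) (A : Fml (τ :: stage σ n)) (task : ℕ → Σ (n : ℕ) (τ : Ty),
      Fml (τ :: stage σ n)), task.Surjective → ∃ k, n ≤ k ∧ σ k = τ ∧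
        task (Nat.unpair (Nat.unpair k).2).1 = ⟨n, τ, A⟩)
    {H₀ : List (Fml [])} (h₀ : ¬ Derives T H₀ .bot) :
    ∃ H : (n : ℕ) → List (Fml (stage σ n)), H 0 = H₀ ∧ (∀ n, ¬ Derives T (H n) .bot) ∧
      (∀ n, (H n).map Fml.wk ⊆ H (n + 1)) ∧
      ∀ (n : ℕ) (τ : Ty) (A : Fml (τ :: stage σ n)), ∃ (m : ℕ) (h : n ≤ m),
        (∃ t, Derives T (H m) (A.subst (Sub.cons t (ren h)))) ∨
          Derives T (H m) ((Fml.ex τ A).neg.subst (ren h)) := by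
  have : Nonempty (Σ (n : ℕ) (τ : Ty), Fml (τ :: stage σ n)) := ⟨⟨0, nat, .bot⟩⟩
  obtain ⟨task, htask⟩ := exists_surjective_nat (Σ (n : ℕ) (τ : Ty), Fml (τ :: stage σ n))
  choose next hc hs hd using fun (n : ℕ) (H : {H : List (Fml (stage σ n)) // ¬ Derives T H .bot}) =>
    exists_henkin_step hT H.2 (task (Nat.unpair (Nat.unpair n).2).1).2.2
  let H : (n : ℕ) → {H : List (Fml (stage σ n)) // ¬ Derives T H .bot} := fun n =>
    Nat.rec (motive := fun n => {H : List (Fml (stage σ n)) // ¬ Derives T H .bot}) ⟨H₀, h₀⟩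
      (fun n H => ⟨next n H, hc n H⟩) n
  refine ⟨fun n => (H n).1, rfl, fun n => (H n).2, fun n => hs n (H n), fun n τ A => ?_⟩
  obtain ⟨k, hk, hτ, ht⟩ := hσ n τ A task htask
  have := hd k (H k)
  rw [ht] at this
  exact ⟨k + 1, Nat.le_succ_of_le hk, this hk hτ⟩

theorem exists_henkin {T : Theory} (hT : T.Closed) {H₀ : List (Fml [])}
    (h₀ : ¬ Derives T H₀ .bot) :
    ∃ (σ : ℕ → Ty) (𝔥 : Henkin σ T), ∀ A ∈ H₀, 𝔥.tr 0 A := by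
  have : Nonempty Ty := ⟨nat⟩
  obtain ⟨ty, hty⟩ := exists_surjective_nat Ty
  let σ : ℕ → Ty := fun n => ty (Nat.unpair n).1
  obtain ⟨H, rfl, hc, hs, hd⟩ := exists_henkin_chain (σ := σ) hT (fun n τ A task htask => by
    obtain ⟨i, rfl⟩ := hty τ
    obtain ⟨c, hc⟩ := htask ⟨n, _, A⟩
    -- `i` codes the type of the new variable and `c` the formula; `n` is padding that makes the
    -- index at least `n`.
    refine ⟨Nat.pair i (Nat.pair c n), ?_, ?_, ?_⟩
    · exact (Nat.right_le_pair c n).trans (Nat.right_le_pair i _)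
    · simp [σ]
    · simp [hc]) h₀
  have mono : ∀ {n m : ℕ} (h : n ≤ m) {A : Fml (stage σ n)}, Derives T (H n) A →
      Derives T (H m) (A.subst (ren h)) := by
    intro n m h A d
    induction m, h using Nat.le_induction with
    | base => rwa [ren_self, Fml.subst_id]
    | succ m hm ih =>
      rw [ren_succ hm, ← Fml.subst_subst]
      exact (ih.subst hT (Sub.shift (stage σ m) (σ m))).weaken (hs m)
  have mono' : ∀ {n m l : ℕ} (h : n ≤ m) (h' : m ≤ l) {A : Fml (stage σ n)},
      Derives T (H m) (A.subst (ren h)) → Derives T (H l) (A.subst (ren (h.trans h'))) := by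
    intro n m l h h' A d
    rw [← ren_comp_ren h h', ← Fml.subst_subst]
    exact mono h' d
  have up : ∀ {n m : ℕ} (h : n ≤ m) (A : Fml (stage σ n)),
      (∃ (l : ℕ) (h' : m ≤ l), Derives T (H l) ((A.subst (ren h)).subst (ren h'))) ↔
        ∃ (l : ℕ) (h' : n ≤ l), Derives T (H l) (A.subst (ren h')) := by
    intro n m h A
    simp only [Fml.subst_subst, ren_comp_ren]
    constructor
    · rintro ⟨l, h', d⟩
      exact ⟨l, h.trans h', d⟩
    · rintro ⟨l, h', d⟩
      exact ⟨max l m, le_max_right _ _, mono' h' (le_max_left _ _) d⟩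
  -- Truth is derivability from the assumptions of some later stage.
  refine ⟨σ, ⟨fun n A => ∃ (m : ℕ) (h : n ≤ m), Derives T (H m) (A.subst (ren h)),
    ?_, ?_, ?_, up, ?_, ?_⟩, ?_⟩
  · intro n A d
    refine ⟨n, le_refl _, ?_⟩
    rw [ren_self, Fml.subst_id]
    exact d.weaken (List.nil_subset _)
  · rintro n A B ⟨m, h, d⟩ ⟨m', h', d'⟩
    exact ⟨max m m', h.trans (le_max_left _ _),
      .impE (mono' h (le_max_left _ _) d) (mono' h' (le_max_right m m') d')⟩
  · rintro n ⟨m, h, d⟩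
    exact hc m d
  · rintro n τ A ⟨m, h, d⟩
    obtain ⟨l, h', ⟨t, d'⟩ | d'⟩ := hd n τ A
    · refine ⟨l, h', t, l, le_refl _, ?_⟩
      rwa [ren_self, Fml.subst_id]
    · exact (hc _ (.impE (mono' h' (le_max_right m l) d') (mono' h (le_max_left m l) d))).elim
  · intro n A
    -- Completeness comes from the witness property for a vacuous quantifier: `∃x A` with `x` not in
    -- `A` is either witnessed, so that `A` is true, or refuted.
    obtain ⟨l, h, ⟨t, d⟩ | d⟩ := hd n nat A.wk
    · rw [Fml.wk_subst_cons] at d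
      exact Or.inl ⟨l, h, d⟩
    · refine Or.inr ⟨l, h, .impI (.impE (d.weaken (List.subset_cons_self _ _)) ?_)⟩
      refine .exI zero ?_
      rw [Fml.wk_subst_lift, Fml.inst, Fml.wk_subst_cons, Fml.subst_id]
      exact .hyp (List.mem_cons_self ..)
  · intro A hA
    exact ⟨0, le_refl _, by rw [ren_self, Fml.subst_id]; exact .hyp hA⟩

end Henkin

/-- The equality axioms for type `0`. -/
structure Theory.HasEq (T : Theory) : Prop where
  refl : ∀ {Γ : Ctx} (s : Tm Γ nat), .eq s s ∈ T Γ
  symm : ∀ {Γ : Ctx} (s t : Tm Γ nat), (.eq s t ⟹ .eq t s) ∈ T Γ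
  trans : ∀ {Γ : Ctx} (s t u : Tm Γ nat), (.eq s t ⋏ .eq t u ⟹ .eq s u) ∈ T Γ

namespace Henkin

variable {σ : ℕ → Ty} {T : Theory} (𝔥 : Henkin σ T)

section Propositional

variable {n : ℕ} {A B C : Fml (stage σ n)}

theorem mp₂ (d : Derives T [B, A] C) (hA : 𝔥.tr n A) (hB : 𝔥.tr n B) : 𝔥.tr n C :=
  𝔥.mp (𝔥.mp (𝔥.tr_of_derives (.impI (.impI d))) hA) hB

theorem mp₁ (d : Derives T [A] C) (hA : 𝔥.tr n A) : 𝔥.tr n C :=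
  𝔥.mp (𝔥.tr_of_derives (.impI d)) hA

theorem tr_neg : 𝔥.tr n A.neg ↔ ¬ 𝔥.tr n A :=
  ⟨fun h h' => 𝔥.not_bot n (𝔥.mp h h'), fun h => (𝔥.decide n A).resolve_left h⟩

theorem tr_imp : 𝔥.tr n (A ⟹ B) ↔ (𝔥.tr n A → 𝔥.tr n B) := by
  refine ⟨𝔥.mp, fun h => ?_⟩
  rcases 𝔥.decide n A with hA | hA
  · exact 𝔥.mp₁ (.impI (.hyp (by simp))) (h hA)
  · exact 𝔥.mp₁ (.impI (.exFalso (.impE (A := A) (.hyp (by simp [Fml.neg])) (.hyp (by simp))))) hA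

theorem tr_and : 𝔥.tr n (A ⋏ B) ↔ 𝔥.tr n A ∧ 𝔥.tr n B :=
  ⟨fun h => ⟨𝔥.mp₁ (.andE₁ (B := B) (.hyp (by simp))) h, 𝔥.mp₁ (.andE₂ (A := A) (.hyp (by simp))) h⟩,
    fun h => 𝔥.mp₂ (.andI (.hyp (by simp)) (.hyp (by simp))) h.1 h.2⟩

theorem tr_or : 𝔥.tr n (A ⋎ B) ↔ 𝔥.tr n A ∨ 𝔥.tr n B := by
  constructor
  · intro h
    by_contra! h'
    have hA := 𝔥.tr_neg.2 h'.1
    have hB := 𝔥.tr_neg.2 h'.2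
    refine 𝔥.not_bot n (𝔥.mp₂ ?_ (𝔥.tr_and.2 ⟨hA, hB⟩) h)
    refine .orE (A := A) (B := B) (.hyp (by simp)) ?_ ?_
    · exact .impE (A := A) (.andE₁ (B := B.neg) (.hyp (by simp [Fml.neg]))) (.hyp (by simp))
    · exact .impE (A := B) (.andE₂ (A := A.neg) (.hyp (by simp [Fml.neg]))) (.hyp (by simp))
  · rintro (h | h)
    · exact 𝔥.mp₁ (.orI₁ (.hyp (by simp))) h
    · exact 𝔥.mp₁ (.orI₂ (.hyp (by simp))) h

theorem tr_ex {τ : Ty} {A : Fml (τ :: stage σ n)} : 𝔥.tr n (.ex τ A) ↔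
    ∃ (m : ℕ) (h : n ≤ m) (t : Tm (stage σ m) τ), 𝔥.tr m (A.subst (Sub.cons t (ren h))) := by
  refine ⟨𝔥.witness, fun ⟨m, h, t, ht⟩ => (𝔥.up h _).1 (𝔥.mp₁ ?_ ht)⟩
  refine .exI t (.hyp ?_)
  rw [Fml.inst, Fml.subst_lift_subst_cons, Sub.comp_id]
  simp

theorem tr_all {τ : Ty} {A : Fml (τ :: stage σ n)} : 𝔥.tr n (.all τ A) ↔
    ∀ (m : ℕ) (h : n ≤ m) (t : Tm (stage σ m) τ), 𝔥.tr m (A.subst (Sub.cons t (ren h))) := by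
  constructor
  · intro hA m h t
    refine 𝔥.mp₁ ?_ ((𝔥.up h _).2 hA)
    have := Derives.allE (T := T) (H := [(Fml.all τ A).subst (ren h)])
      (A := A.subst ((ren h).lift τ)) t (.hyp (by simp [Fml.subst]))
    rwa [Fml.inst, Fml.subst_lift_subst_cons, Sub.comp_id] at this
  · intro h
    by_contra hA
    have hE : 𝔥.tr n (.ex τ A.neg) := by
      refine 𝔥.mp₁ ?_ (𝔥.tr_neg.2 hA)
      refine .byContra (.impE (A := .all τ A) (.hyp (by simp [Fml.neg])) (.allI (.byContra ?_)))
      refine .impE (A := (Fml.ex τ A.neg).wk) (.hyp (by simp [Fml.neg, Fml.wk, Fml.subst])) ?_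
      refine .exI v0 (.hyp ?_)
      have : (A.neg.subst ((Sub.shift (stage σ n) τ).lift τ)).inst v0 = A.neg := by
        rw [Fml.inst, Fml.subst_lift_subst_cons, Sub.comp_id]
        refine Eq.trans ?_ A.neg.subst_id
        exact congrArg (Fml.subst · A.neg) (Sub.cons_ext rfl fun _ _ => rfl)
      rw [this]
      simp
    obtain ⟨m, h', t, ht⟩ := 𝔥.witness hE
    exact 𝔥.tr_neg.1 ht (h m h' t)

end Propositional

/-! ### The term model of a Henkin theory -/

section TermModel

variable (hE : T.HasEq)

theorem tr_refl (hE : T.HasEq) {n : ℕ} (s : Tm (stage σ n) nat) : 𝔥.tr n (.eq s s) :=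
  𝔥.tr_of_derives (.ax (hE.refl s))

theorem tr_symm (hE : T.HasEq) {n : ℕ} {s t : Tm (stage σ n) nat} (h : 𝔥.tr n (.eq s t)) :
    𝔥.tr n (.eq t s) :=
  𝔥.mp (𝔥.tr_of_derives (.ax (hE.symm s t))) h

theorem tr_trans (hE : T.HasEq) {n : ℕ} {s t u : Tm (stage σ n) nat} (h : 𝔥.tr n (.eq s t))
    (h' : 𝔥.tr n (.eq t u)) : 𝔥.tr n (.eq s u) :=
  𝔥.mp (𝔥.tr_of_derives (.ax (hE.trans s t u))) (𝔥.tr_and.2 ⟨h, h'⟩)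

/-- Terms with parameters. -/
abbrev PTm (σ : ℕ → Ty) (τ : Ty) : Type := Σ n, Tm (stage σ n) τ

/-- Leibniz equality of terms with parameters. -/
def Leibniz {τ : Ty} (s t : PTm σ τ) : Prop :=
  ∀ (m : ℕ) (h : s.1 ≤ m) (h' : t.1 ≤ m) (r : Tm (τ :: stage σ m) nat),
    𝔥.tr m (.eq (r.subst (Sub.cons (s.2.subst (ren h)) (Sub.id _)))
      (r.subst (Sub.cons (t.2.subst (ren h')) (Sub.id _))))

variable {𝔥}

/-- Truth does not depend on the stage, so a test term can be moved to a later stage first.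
Transitivity needs this, since the middle term may live later than the outer ones. -/
theorem Leibniz.of_le {τ : Ty} {s t : PTm σ τ} (l : ℕ)
    (H : ∀ (m : ℕ) (h : s.1 ≤ m) (h' : t.1 ≤ m) (_ : l ≤ m) (r : Tm (τ :: stage σ m) nat),
      𝔥.tr m (.eq (r.subst (Sub.cons (s.2.subst (ren h)) (Sub.id _)))
        (r.subst (Sub.cons (t.2.subst (ren h')) (Sub.id _))))) : 𝔥.Leibniz s t := by
  intro m h h' r
  rw [← 𝔥.up (le_max_left m l)]
  have := H (max m l) (h.trans (le_max_left m l)) (h'.trans (le_max_left m l)) (le_max_right m l)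
    (r.subst ((ren (le_max_left m l)).lift τ))
  simpa only [Fml.subst, Tm.subst_subst, Sub.lift_comp_cons, Sub.cons_comp, Sub.id_comp,
    Sub.comp_id, ren_comp_ren] using this

theorem leibniz_equivalence (hE : T.HasEq) (τ : Ty) :
    Equivalence (𝔥.Leibniz (τ := τ)) where
  refl _ _ _ _ _ := 𝔥.tr_refl hE _
  symm H m h h' r := 𝔥.tr_symm hE (H m h' h r)
  trans {_ t _} H H' := Leibniz.of_le t.1 fun m h h' hl r =>
    𝔥.tr_trans hE (H m h hl r) (H' m hl h' r)

/-- Replace the function first, with test term `r[y t]`, then the argument, with test term `r[s'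
y]`. -/
theorem Leibniz.app (hE : T.HasEq) {ρ τ : Ty} {s s' : PTm σ (ρ ⇝ τ)} {t t' : PTm σ ρ}
    (hs : 𝔥.Leibniz s s') (ht : 𝔥.Leibniz t t') :
    𝔥.Leibniz ⟨max s.1 t.1, s.2.subst (ren (le_max_left _ _)) ⬝ t.2.subst (ren (le_max_right _ _))⟩
      ⟨max s'.1 t'.1, s'.2.subst (ren (le_max_left _ _)) ⬝ t'.2.subst (ren (le_max_right _ _))⟩ := by
  intro m h h' r
  have hs₁ := (le_max_left s.1 t.1).trans h
  have ht₁ := (le_max_right s.1 t.1).trans h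
  have hs₂ := (le_max_left s'.1 t'.1).trans h'
  have ht₂ := (le_max_right s'.1 t'.1).trans h'
  have e₁ := hs m hs₁ hs₂
    (r.subst (Sub.cons (v0 ⬝ (t.2.subst (ren ht₁)).wk) (Sub.shift _ (ρ ⇝ τ))))
  have e₂ := ht m ht₁ ht₂
    (r.subst (Sub.cons ((s'.2.subst (ren hs₂)).wk ⬝ v0) (Sub.shift _ ρ)))
  simp only [Tm.subst_subst, Sub.cons_comp, Tm.subst, Sub.shift_comp_cons, Tm.wk_subst_cons,
    Sub.comp_id, ren_comp_ren] at e₁ e₂ ⊢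
  exact 𝔥.tr_trans hE e₁ e₂

variable (𝔥)

def setoid (hE : T.HasEq) (τ : Ty) : Setoid (PTm σ τ) := ⟨𝔥.Leibniz, leibniz_equivalence hE τ⟩

/-- The term model. -/
def termModel (hE : T.HasEq) : Model where
  carrier τ := Quotient (𝔥.setoid hE τ)
  app {_ _} := Quotient.map₂ (fun s t =>
      ⟨max s.1 t.1, s.2.subst (ren (le_max_left _ _)) ⬝ t.2.subst (ren (le_max_right _ _))⟩)
    fun _ _ hs _ _ ht => Leibniz.app hE hs ht
  con c := Quotient.mk _ ⟨0, .const c⟩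

def toModel {n : ℕ} {τ : Ty} (t : Tm (stage σ n) τ) : (𝔥.termModel hE).carrier τ :=
  Quotient.mk (𝔥.setoid hE τ) ⟨n, t⟩

theorem toModel_eq_iff {n m : ℕ} {τ : Ty} {s : Tm (stage σ n) τ} {t : Tm (stage σ m) τ} :
    𝔥.toModel hE s = 𝔥.toModel hE t ↔ 𝔥.Leibniz ⟨n, s⟩ ⟨m, t⟩ :=
  ⟨fun h => Quotient.exact h, fun h => Quotient.sound h⟩

theorem toModel_ren {n m : ℕ} (h : n ≤ m) {τ : Ty} (t : Tm (stage σ n) τ) :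
    𝔥.toModel hE (t.subst (ren h)) = 𝔥.toModel hE t := by
  refine (𝔥.toModel_eq_iff hE).2 fun l h₁ h₂ r => ?_
  simp only [Tm.subst_subst, ren_comp_ren]
  exact 𝔥.tr_refl hE _

theorem app_toModel {n : ℕ} {ρ τ : Ty} (s : Tm (stage σ n) (ρ ⇝ τ)) (t : Tm (stage σ n) ρ) :
    (𝔥.termModel hE).app (𝔥.toModel hE s) (𝔥.toModel hE t) = 𝔥.toModel hE (s ⬝ t) :=
  𝔥.toModel_ren hE (le_max_left n n) (s ⬝ t)

theorem eval_toModel {Γ : Ctx} {n : ℕ} (s : Sub Γ (stage σ n)) {τ : Ty} (t : Tm Γ τ) :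
    Model.eval (M := 𝔥.termModel hE) (fun _ v => 𝔥.toModel hE (s _ v)) t =
      𝔥.toModel hE (t.subst s) := by
  induction t with
  | var v => rfl
  | const c => exact (𝔥.toModel_ren hE (Nat.zero_le n) (.const c)).symm
  | app t u iht ihu => rw [Model.eval, iht, ihu, app_toModel, Tm.subst]

/-- Equations that are provable from a true quantifier-free formula hold in the term model. -/
theorem toModel_eq_of_derives {n : ℕ} {τ : Ty} {s t : Tm (stage σ n) τ} (hT : T.Closed)
    {A : Fml (stage σ n)} (hA : A.QF) (h : 𝔥.tr n A) (d : Derives T [] (A ⟹ eqT τ s t)) :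
    𝔥.toModel hE s = 𝔥.toModel hE t := by
  refine (𝔥.toModel_eq_iff hE).2 fun m h₁ h₂ r => ?_
  have := d.subst hT (ren h₁)
  rw [Fml.subst, eqT_subst] at this
  exact 𝔥.mp (𝔥.tr_of_derives (.qfER r (hA.subst _) this)) ((𝔥.up h₁ _).2 h)

theorem toModel_eq_nat (hT : T.Closed) {n : ℕ} {s t : Tm (stage σ n) nat} :
    𝔥.toModel hE s = 𝔥.toModel hE t ↔ 𝔥.tr n (.eq s t) := by
  constructor
  · intro h
    have := (𝔥.toModel_eq_iff hE).1 h n (le_refl n) (le_refl n) v0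
    simpa only [Tm.subst, Sub.cons, ren_self, Tm.subst_id] using this
  · intro h
    -- An equation of type `0` is quantifier-free, so the extensionality rule applies to the
    -- tautology `s = t → s = t` and turns the merely true equation into a Leibniz equality.
    exact 𝔥.toModel_eq_of_derives hE hT (A := .eq s t) trivial h (.impI (.hyp (by simp [eqT])))

theorem cons_toModel {Γ : Ctx} {n m : ℕ} (h : n ≤ m) (s : Sub Γ (stage σ n)) {τ : Ty}
    (t : Tm (stage σ m) τ) :
    (Model.Env.cons (𝔥.toModel hE t) fun _ v => 𝔥.toModel hE (s _ v)) =
      fun ρ v => 𝔥.toModel hE (Sub.cons t (s.comp (ren h)) ρ v) :=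
  Model.Env.cons_ext rfl fun _ v => (𝔥.toModel_ren hE h (s _ v)).symm

/-- The truth lemma. In the quantifier cases an element of the model is represented by a term of
some stage, and everything moves to a common later stage. -/
theorem sat_toModel (hT : T.Closed) {Γ : Ctx} (A : Fml Γ) {n : ℕ} (s : Sub Γ (stage σ n)) :
    Model.sat (M := 𝔥.termModel hE) (fun _ v => 𝔥.toModel hE (s _ v)) A ↔ 𝔥.tr n (A.subst s) := by
  induction A generalizing n with
  | eq t u => rw [Model.sat, eval_toModel, eval_toModel, 𝔥.toModel_eq_nat hE hT, Fml.subst]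
  | bot => exact ⟨False.elim, 𝔥.not_bot n⟩
  | imp A B ihA ihB => rw [Model.sat, ihA, ihB, Fml.subst, tr_imp]
  | and A B ihA ihB => rw [Model.sat, ihA, ihB, Fml.subst, tr_and]
  | or A B ihA ihB => rw [Model.sat, ihA, ihB, Fml.subst, tr_or]
  | all τ A ih =>
    rw [Model.sat, Fml.subst, tr_all]
    constructor
    · intro H m h t
      have := H (𝔥.toModel hE t)
      rwa [𝔥.cons_toModel hE h s t, ih, ← Fml.subst_lift_subst_cons] at this
    · intro H x
      induction x using Quotient.inductionOn with | _ t
      obtain ⟨m, t⟩ := t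
      have := H (max n m) (le_max_left n m) (t.subst (ren (le_max_right n m)))
      rw [Fml.subst_lift_subst_cons, ← ih, ← cons_toModel, toModel_ren] at this
      exact this
  | ex τ A ih =>
    rw [Model.sat, Fml.subst, tr_ex]
    constructor
    · rintro ⟨x, hx⟩
      induction x using Quotient.inductionOn with | _ t
      obtain ⟨m, t⟩ := t
      refine ⟨max n m, le_max_left n m, t.subst (ren (le_max_right n m)), ?_⟩
      rw [Fml.subst_lift_subst_cons, ← ih, ← cons_toModel, toModel_ren]
      exact hx
    · rintro ⟨m, h, t, ht⟩
      refine ⟨𝔥.toModel hE t, ?_⟩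
      rwa [𝔥.cons_toModel hE h s t, ih, ← Fml.subst_lift_subst_cons]

/-- A context is finite, so one stage contains representatives of all the values of an assignment.
-/
theorem exists_sub {Γ : Ctx} (e : (𝔥.termModel hE).Env Γ) :
    ∃ (n : ℕ) (s : Sub Γ (stage σ n)), e = fun _ v => 𝔥.toModel hE (s _ v) := by
  induction Γ with
  | nil => exact ⟨0, Sub.id _, funext fun _ => funext fun v => nomatch v⟩
  | cons τ Γ ih =>
    obtain ⟨n, s, hs⟩ := ih fun _ v => e _ (.succ v)
    obtain ⟨⟨m, t⟩, ht⟩ := Quotient.exists_rep (e _ .zero)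
    refine ⟨max n m, Sub.cons (t.subst (ren (le_max_right n m))) (s.comp (ren (le_max_left n m))), ?_⟩
    rw [← cons_toModel, toModel_ren]
    exact Model.Env.cons_ext ht.symm fun τ v => congrFun (congrFun hs τ) v

end TermModel

end Henkin

/-! ### Completeness -/

/-- The models of a theory in which provable equations hold as identities. -/
structure Model.Models (M : Model) (T : Theory) : Prop where
  sat : ∀ {Γ : Ctx} {A : Fml Γ}, A ∈ T Γ → ∀ e : M.Env Γ, Model.sat e A
  eval_eq : ∀ {Γ : Ctx} {τ : Ty} {s t : Tm Γ τ}, Derives T [] (eqT τ s t) →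
    ∀ e : M.Env Γ, Model.eval e s = Model.eval e t

/-- Completeness: what holds in all models of `T` and `H` is derivable. -/
theorem derives_of_models {T : Theory} (hT : T.Closed) (hE : T.HasEq) {H : List (Fml [])}
    {A : Fml []}
    (h : ∀ M : Model, M.Models T → (∀ B ∈ H, M.sat .nil B) → M.sat .nil A) :
    Derives T H A := by
  refine .byContra ?_
  by_contra hc
  obtain ⟨σ, 𝔥, h𝔥⟩ := exists_henkin hT hc
  have key : ∀ B : Fml [], Model.sat (M := 𝔥.termModel hE) .nil B ↔ 𝔥.tr 0 B := by
    intro B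
    have := 𝔥.sat_toModel hE hT B (n := 0) (Sub.id _)
    rw [Fml.subst_id] at this
    rw [← this]
    rw [show (Model.Env.nil : (𝔥.termModel hE).Env []) = _ from
      funext fun _ => funext fun v => nomatch v]
  have hA := h𝔥 _ (List.mem_cons_self ..)
  refine 𝔥.tr_neg.1 hA ((key A).1 (h _ ⟨?_, ?_⟩ fun B hB => (key B).2 (h𝔥 B (by simp [hB]))))
  · intro Γ B hB e
    obtain ⟨n, s, rfl⟩ := 𝔥.exists_sub hE e
    exact (𝔥.sat_toModel hE hT B s).2 (𝔥.tr_of_derives (.ax (hT s hB)))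
  · intro Γ τ s t d e
    obtain ⟨n, r, rfl⟩ := 𝔥.exists_sub hE e
    rw [Henkin.eval_toModel, Henkin.eval_toModel]
    have := d.subst hT r
    rw [eqT_subst] at this
    -- The extensionality rule requires a quantifier-free premise; `0 = 0` serves as a trivial one.
    exact 𝔥.toModel_eq_of_derives hE hT (A := .eq zero zero) trivial (𝔥.tr_refl hE _)
      (.impI (this.weaken (List.nil_subset _)))

/-! # The base theory -/

/-- Recursion in single types, induction, and dependent choice for numbers. -/
inductive BaseAx : (Γ : Ctx) → Fml Γ → Prop
  | refl {Γ : Ctx} (s : Tm Γ nat) : BaseAx Γ (.eq s s)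
  | symm {Γ : Ctx} (s t : Tm Γ nat) : BaseAx Γ (.eq s t ⟹ .eq t s)
  | trans {Γ : Ctx} (s t u : Tm Γ nat) : BaseAx Γ (.eq s t ⋏ .eq t u ⟹ .eq s u)
  | succ_ne_zero {Γ : Ctx} (s : Tm Γ nat) : BaseAx Γ (Fml.neg (.eq (succ s) zero))
  | succ_inj {Γ : Ctx} (s t : Tm Γ nat) : BaseAx Γ (.eq (succ s) (succ t) ⟹ .eq s t)
  | induction {Γ : Ctx} (A : Fml (nat :: Γ)) :
      BaseAx Γ (A.inst zero ⋏
        .all nat (A ⟹ A.subst (Sub.cons (succ v0) (Sub.shift Γ nat))) ⟹ .all nat A)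
  | proj {Γ : Ctx} {ρ τ : Ty} (x : Tm Γ ρ) (y : Tm Γ τ) :
      BaseAx Γ (eqT ρ (.const (.proj ρ τ) ⬝ x ⬝ y) x)
  | comb {Γ : Ctx} {δ ρ τ : Ty} (x : Tm Γ (δ ⇝ ρ ⇝ τ)) (y : Tm Γ (δ ⇝ ρ)) (z : Tm Γ δ) :
      BaseAx Γ (eqT τ (.const (.comb δ ρ τ) ⬝ x ⬝ y ⬝ z) (x ⬝ z ⬝ (y ⬝ z)))
  | rec_zero {Γ : Ctx} {ρ : Ty} (y : Tm Γ ρ) (z : Tm Γ (ρ ⇝ nat ⇝ ρ)) :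
      BaseAx Γ (eqT ρ (rc zero y z) y)
  | rec_succ {Γ : Ctx} {ρ : Ty} (x : Tm Γ nat) (y : Tm Γ ρ) (z : Tm Γ (ρ ⇝ nat ⇝ ρ)) :
      BaseAx Γ (eqT ρ (rc (succ x) y z) (z ⬝ rc x y z ⬝ x))
  | dc {Γ : Ctx} (A : Fml (nat :: nat :: nat :: Γ)) :
      BaseAx Γ (.all nat (.all nat (.ex nat A)) ⟹
        .ex (nat ⇝ nat) (.all nat (A.subst (dcSub Γ [nat]))))

def baseTheory : Theory := fun Γ => {A | BaseAx Γ A}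

/-- Recursion in one type and choice for numbers are the cases of one-element tuples; there the
general tuple schemas unfold to the forms stated in `BaseAx`. -/
theorem baseTheory_subset_systemFPIX {Γ : Ctx} {A : Fml Γ} (h : A ∈ baseTheory Γ) :
    A ∈ systemFPIX Γ := by
  suffices h : A ∈ analysis Γ from
    Or.inl (Or.inl (Or.inl (Or.inl (Or.inl (Or.inl h)))))
  have one {Γ : Ctx} {ρ : Ty} (t : Tm Γ ρ) : Sub [ρ] Γ := Sub.cons t fun _ v => nomatch v
  cases (h : BaseAx Γ A) with
  | refl s => exact Or.inl (.refl s)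
  | symm s t => exact Or.inl (.symm s t)
  | trans s t u => exact Or.inl (.trans s t u)
  | succ_ne_zero s => exact Or.inl (.succ_ne_zero s)
  | succ_inj s t => exact Or.inl (.succ_inj s t)
  | induction A => exact Or.inl (.induction A)
  | proj x y => exact Or.inl (.proj x y)
  | comb x y z => exact Or.inl (.comb x y z)
  | @rec_zero ρ y z =>
    exact Or.inl (.rec_zero [ρ] .zero (Sub.cons y fun _ v => nomatch v)
      (Sub.cons z fun _ v => nomatch v))
  | @rec_succ ρ x y z =>
    exact Or.inl (.rec_succ [ρ] .zero x (Sub.cons y fun _ v => nomatch v)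
      (Sub.cons z fun _ v => nomatch v))
  | dc A => exact Or.inr (Or.inr (.mk [nat] A))

theorem baseTheory_hasEq : baseTheory.HasEq := ⟨.refl, .symm, .trans⟩

theorem baseTheory_closed : baseTheory.Closed := by
  intro Γ Δ s A h
  cases (h : BaseAx Γ A) with
  | refl t => exact .refl _
  | symm t u => exact .symm _ _
  | trans t u v => exact .trans _ _ _
  | succ_ne_zero t => exact .succ_ne_zero _
  | succ_inj t u => exact .succ_inj _ _
  | induction A =>
    have := BaseAx.induction (A.subst (s.lift nat))
    have e : (Sub.cons (succ v0) (Sub.shift Γ nat)).comp (s.lift nat) =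
        (s.lift nat).comp (Sub.cons (succ v0) (Sub.shift Δ nat)) :=
      Sub.cons_ext rfl fun τ v => (Tm.wk_subst_cons (s τ v) _ _).symm
    simp only [Fml.subst_subst] at this
    simp only [Fml.subst, Fml.inst_subst, Fml.subst_subst, e]
    exact this
  | proj x y => rw [eqT_subst]; exact .proj _ _
  | comb x y z => rw [eqT_subst]; exact .comb _ _ _
  | rec_zero y z => rw [eqT_subst]; exact .rec_zero _ _
  | rec_succ x y z => rw [eqT_subst]; exact .rec_succ _ _ _
  | dc A =>
    have := BaseAx.dc (A.subst (((s.lift nat).lift nat).lift nat))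
    -- Substituting for the parameters commutes with putting `f x` and `f (S x)` for the two
    -- numbers; for a parameter both sides are a double weakening.
    have e : (dcSub Γ [nat]).comp ((s.lift (nat ⇝ nat)).lift nat) =
        (((s.lift nat).lift nat).lift nat).comp (dcSub Δ [nat]) := by
      refine Sub.cons_ext rfl (fun τ v => ?_)
      cases v with
      | zero => rfl
      | succ v =>
        cases v with
        | zero => rfl
        | succ v =>
          change (s τ v).wk.wk = (s τ v).wk.wk.wk.subst (dcSub Δ [nat])
          simp only [Tm.wk, Tm.subst_subst]
          rfl
    rw [Fml.subst_subst] at this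
    simp only [Fml.subst, Fml.subst_subst, e]
    exact this

/-- Models of the base theory. -/
abbrev Model.Base (M : Model) : Prop := M.Models baseTheory

namespace Model

variable {M : Model}

@[simp] theorem eval_var {Γ : Ctx} (e : M.Env Γ) {τ : Ty} (v : Var Γ τ) :
    eval e (.var v) = e _ v := rfl

@[simp] theorem eval_const {Γ : Ctx} (e : M.Env Γ) {τ : Ty} (c : Const τ) :
    eval e (.const c) = M.con c := rfl

@[simp] theorem eval_app {Γ : Ctx} (e : M.Env Γ) {σ τ : Ty} (s : Tm Γ (σ ⇝ τ)) (t : Tm Γ σ) :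
    eval e (s ⬝ t) = M.app (eval e s) (eval e t) := rfl

@[simp] theorem Env.cons_zero {Γ : Ctx} {σ : Ty} (x : M.carrier σ) (e : M.Env Γ) :
    Env.cons x e σ .zero = x := rfl

@[simp] theorem Env.cons_succ {Γ : Ctx} {σ τ : Ty} (x : M.carrier σ) (e : M.Env Γ)
    (v : Var Γ τ) : Env.cons x e τ (.succ v) = e τ v := rfl

theorem eval_drop {Γ : Ctx} {σ : Ty} (x : M.carrier σ) (e : M.Env Γ) :
    {τ : Ty} → (t : Tm (σ :: Γ) τ) → {u : Tm Γ τ} → t.drop = some u →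
      eval (Env.cons x e) t = eval e u
  | _, .var .zero, _, h => by simp [Tm.drop] at h
  | _, .var (.succ v), _, h => by
    simp only [Tm.drop, Option.some.injEq] at h
    rw [← h]
    rfl
  | _, .const c, _, h => by
    simp only [Tm.drop, Option.some.injEq] at h
    rw [← h]
    rfl
  | _, .app s t, _, h => by
    rw [Tm.drop] at h
    split at h
    · rename_i s' t' hs ht
      simp only [Option.some.injEq] at h
      rw [← h, eval_app, eval_app, eval_drop x e s hs, eval_drop x e t ht]
    · cases h

namespace Models

variable (hM : M.Base)
include hM

theorem proj_eq {ρ τ : Ty} (x : M.carrier ρ) (y : M.carrier τ) :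
    M.app (M.app (M.con (.proj ρ τ)) x) y = x :=
  hM.eval_eq (.ax (.proj (Γ := [ρ, τ]) v0 v1)) (Env.cons x (Env.cons y .nil))

theorem comb_eq {δ ρ τ : Ty} (x : M.carrier (δ ⇝ ρ ⇝ τ)) (y : M.carrier (δ ⇝ ρ))
    (z : M.carrier δ) :
    M.app (M.app (M.app (M.con (.comb δ ρ τ)) x) y) z = M.app (M.app x z) (M.app y z) :=
  hM.eval_eq (.ax (.comb (Γ := [δ ⇝ ρ ⇝ τ, δ ⇝ ρ, δ]) v0 v1 v2))
    (Env.cons x (Env.cons y (Env.cons z .nil)))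

/-- The combinator equations are provable, hence identities of the model at every type, and so is
β-conversion. -/
theorem app_lam {Γ : Ctx} {σ : Ty} (x : M.carrier σ) (e : M.Env Γ) :
    {τ : Ty} → (t : Tm (σ :: Γ) τ) → M.app (eval e (lam t)) x = eval (Env.cons x e) t
  | _, .var .zero => by
    simp only [lam, eval_app, eval_const, hM.comb_eq, hM.proj_eq, eval_var, Env.cons_zero]
  | _, .var (.succ v) => hM.proj_eq _ _
  | _, .const c => hM.proj_eq _ _
  | _, .app s t => by
    rw [lam]
    split
    · rename_i u hu
      rw [eval_drop x e _ hu, eval_app, eval_const, hM.proj_eq]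
    · rw [eval_app, eval_app, eval_const, hM.comb_eq, app_lam x e s, app_lam x e t, eval_app]

end Models

end Model

/-! # Abstraction and substitution -/

theorem Tm.drop_wk {Γ : Ctx} {σ τ : Ty} (t : Tm Γ τ) : (t.wk (σ := σ)).drop = some t := by
  induction t with
  | var v => rfl
  | const c => rfl
  | app s t ihs iht =>
    change (Tm.app s.wk t.wk).drop = _
    rw [Tm.drop, ihs, iht]

theorem Tm.drop_subst {Γ Δ : Ctx} {σ : Ty} (s : Sub Γ Δ) : {τ : Ty} → (t : Tm (σ :: Γ) τ) →
    (t.subst (s.lift σ)).drop = t.drop.map (Tm.subst s)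
  | _, .var .zero => rfl
  | _, .var (.succ v) => Tm.drop_wk (s _ v)
  | _, .const c => rfl
  | _, .app t u => by
    rw [Tm.subst, Tm.drop, Tm.drop, drop_subst s t, drop_subst s u]
    cases t.drop <;> cases u.drop <;> rfl

theorem lam_of_drop {Γ : Ctx} {σ τ : Ty} {t : Tm (σ :: Γ) τ} {u : Tm Γ τ} (h : t.drop = some u) :
    lam t = .const (.proj τ σ) ⬝ u := by
  cases t with
  | var v =>
    cases v with
    | zero => simp [Tm.drop] at h
    | succ v =>
      simp only [Tm.drop, Option.some.injEq] at h
      rw [← h, lam]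
  | const c =>
    simp only [Tm.drop, Option.some.injEq] at h
    rw [← h, lam]
  | app t v => rw [lam, h]

/-- This is what the use of `Tm.drop` in `lam` is for. A variable replaced by a compound term that
omits the abstracted variable is still abstracted by a single `Π`, and not by a tree of `Σ`s. -/
theorem lam_subst {Γ Δ : Ctx} {σ : Ty} (s : Sub Γ Δ) : {τ : Ty} → (t : Tm (σ :: Γ) τ) →
    (lam t).subst s = lam (t.subst (s.lift σ))
  | _, .var .zero => rfl
  | _, .var (.succ v) => (lam_of_drop (Tm.drop_wk (s _ v))).symm
  | _, .const c => rfl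
  | _, .app t u => by
    have hd := Tm.drop_subst s (t ⬝ u)
    cases h : (t ⬝ u).drop with
    | some w =>
      rw [h] at hd
      rw [lam_of_drop h, lam_of_drop hd]
      rfl
    | none =>
      rw [h] at hd
      rw [Tm.subst] at hd ⊢
      have hd' : (Tm.app (t.subst (s.lift σ)) (u.subst (s.lift σ))).drop = none := hd
      rw [lam, lam, h, hd']
      change _ ⬝ (lam t).subst s ⬝ (lam u).subst s = _
      rw [lam_subst s t, lam_subst s u]
      rfl

/-! ### Invariance of the arithmetical terms under substitution -/

section Closed

variable {Γ Δ : Ctx} (s : Sub Γ Δ)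

@[simp] theorem subst_app {σ τ : Ty} (t : Tm Γ (σ ⇝ τ)) (u : Tm Γ σ) :
    (t ⬝ u).subst s = t.subst s ⬝ u.subst s := rfl

@[simp] theorem subst_const {τ : Ty} (c : Const τ) : (Tm.const c : Tm Γ τ).subst s = .const c := rfl

@[simp] theorem subst_var {τ : Ty} (v : Var Γ τ) : (Tm.var v).subst s = s _ v := rfl

@[simp] theorem Sub.lift_zero (σ : Ty) : s.lift σ σ .zero = v0 := rfl

@[simp] theorem Sub.lift_succ (σ : Ty) {τ : Ty} (v : Var Γ τ) :
    s.lift σ τ (.succ v) = (s τ v).wk := rfl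

@[simp] theorem wk_var {σ τ : Ty} (v : Var Γ τ) : (Tm.var v).wk = Tm.var (.succ v : Var (σ :: Γ) τ) :=
  rfl

attribute [simp] lam_subst

@[simp] theorem subst_zero : (zero : Tm Γ nat).subst s = zero := rfl
@[simp] theorem subst_succ (t : Tm Γ nat) : (succ t).subst s = succ (t.subst s) := rfl
@[simp] theorem subst_n1 : (n1 : Tm Γ nat).subst s = n1 := rfl
@[simp] theorem subst_n2 : (n2 : Tm Γ nat).subst s = n2 := rfl
@[simp] theorem subst_rc {ρ : Ty} (x : Tm Γ nat) (y : Tm Γ ρ) (z : Tm Γ (ρ ⇝ nat ⇝ ρ)) :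
    (rc x y z).subst s = rc (x.subst s) (y.subst s) (z.subst s) := rfl
@[simp] theorem subst_predT : (predT : Tm Γ _).subst s = predT := by simp -implicitDefEqProofs [predT]
@[simp] theorem subst_pred (t : Tm Γ nat) : (pred t).subst s = pred (t.subst s) := by simp -implicitDefEqProofs [pred]
@[simp] theorem subst_addT : (addT : Tm Γ _).subst s = addT := by simp -implicitDefEqProofs [addT]
@[simp] theorem subst_add (t u : Tm Γ nat) : (add t u).subst s = add (t.subst s) (u.subst s) := by
  simp -implicitDefEqProofs [add]
@[simp] theorem subst_monusT : (monusT : Tm Γ _).subst s = monusT := by simp -implicitDefEqProofs [monusT]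
@[simp] theorem subst_monus (t u : Tm Γ nat) :
    (monus t u).subst s = monus (t.subst s) (u.subst s) := by simp -implicitDefEqProofs [monus]
@[simp] theorem subst_mulT : (mulT : Tm Γ _).subst s = mulT := by simp -implicitDefEqProofs [mulT]
@[simp] theorem subst_mul (t u : Tm Γ nat) : (mul t u).subst s = mul (t.subst s) (u.subst s) := by
  simp -implicitDefEqProofs [mul]
@[simp] theorem subst_powT : (powT : Tm Γ _).subst s = powT := by simp -implicitDefEqProofs [powT]
@[simp] theorem subst_pow (t : Tm Γ nat) : (pow t).subst s = pow (t.subst s) := by simp -implicitDefEqProofs [pow]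
@[simp] theorem subst_sgT : (sgT : Tm Γ _).subst s = sgT := by simp -implicitDefEqProofs [sgT]
@[simp] theorem subst_sg (t : Tm Γ nat) : (sg t).subst s = sg (t.subst s) := by simp -implicitDefEqProofs [sg]
@[simp] theorem subst_parT : (parT : Tm Γ _).subst s = parT := by simp -implicitDefEqProofs [parT]
@[simp] theorem subst_par (t : Tm Γ nat) : (par t).subst s = par (t.subst s) := by simp -implicitDefEqProofs [par]
@[simp] theorem subst_halfT : (halfT : Tm Γ _).subst s = halfT := by simp -implicitDefEqProofs [halfT]
@[simp] theorem subst_half (t : Tm Γ nat) : (half t).subst s = half (t.subst s) := by simp -implicitDefEqProofs [half]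
@[simp] theorem subst_dist (t u : Tm Γ nat) :
    (dist t u).subst s = dist (t.subst s) (u.subst s) := by simp -implicitDefEqProofs [dist]
@[simp] theorem subst_leastT : (leastT : Tm Γ _).subst s = leastT := by simp -implicitDefEqProofs [leastT]
@[simp] theorem subst_least (f : Tm Γ Ty.one) (n : Tm Γ nat) :
    (least f n).subst s = least (f.subst s) (n.subst s) := by simp -implicitDefEqProofs [least]
@[simp] theorem subst_bminT : (bminT : Tm Γ _).subst s = bminT := by simp -implicitDefEqProofs [bminT]
@[simp] theorem subst_bmin (f : Tm Γ Ty.one) (n : Tm Γ nat) :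
    (bmin f n).subst s = bmin (f.subst s) (n.subst s) := by simp -implicitDefEqProofs [bmin]
@[simp] theorem subst_pairPolyT : (pairPolyT : Tm Γ _).subst s = pairPolyT := by simp -implicitDefEqProofs [pairPolyT]
@[simp] theorem subst_pairPoly (t u : Tm Γ nat) :
    (pairPoly t u).subst s = pairPoly (t.subst s) (u.subst s) := by simp -implicitDefEqProofs [pairPoly]
@[simp] theorem subst_jT : (jT : Tm Γ _).subst s = jT := by simp -implicitDefEqProofs [jT]
@[simp] theorem subst_j (t u : Tm Γ nat) : (j t u).subst s = j (t.subst s) (u.subst s) := by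
  simp -implicitDefEqProofs [j]
@[simp] theorem subst_j1T : (j1T : Tm Γ _).subst s = j1T := by simp -implicitDefEqProofs [j1T]
@[simp] theorem subst_j1 (t : Tm Γ nat) : (j1 t).subst s = j1 (t.subst s) := by simp -implicitDefEqProofs [j1]
@[simp] theorem subst_j2T : (j2T : Tm Γ _).subst s = j2T := by simp -implicitDefEqProofs [j2T]
@[simp] theorem subst_j2 (t : Tm Γ nat) : (j2 t).subst s = j2 (t.subst s) := by simp -implicitDefEqProofs [j2]
@[simp] theorem subst_posT : (posT : Tm Γ _).subst s = posT := by simp -implicitDefEqProofs [posT]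
@[simp] theorem subst_pos (t : Tm Γ nat) : (pos t).subst s = pos (t.subst s) := by simp -implicitDefEqProofs [pos]
@[simp] theorem subst_ngvT : (ngvT : Tm Γ _).subst s = ngvT := by simp -implicitDefEqProofs [ngvT]
@[simp] theorem subst_ngv (t : Tm Γ nat) : (ngv t).subst s = ngv (t.subst s) := by simp -implicitDefEqProofs [ngv]
@[simp] theorem subst_den (t : Tm Γ nat) : (den t).subst s = den (t.subst s) := by simp -implicitDefEqProofs [den]
@[simp] theorem subst_mkQT : (mkQT : Tm Γ _).subst s = mkQT := by simp -implicitDefEqProofs [mkQT]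
@[simp] theorem subst_mkQ (p q d : Tm Γ nat) :
    (mkQ p q d).subst s = mkQ (p.subst s) (q.subst s) (d.subst s) := by simp -implicitDefEqProofs [mkQ]
@[simp] theorem subst_addQT : (addQT : Tm Γ _).subst s = addQT := by simp -implicitDefEqProofs [addQT]
@[simp] theorem subst_addQ (t u : Tm Γ nat) :
    (addQ t u).subst s = addQ (t.subst s) (u.subst s) := by simp -implicitDefEqProofs [addQ]
@[simp] theorem subst_negQT : (negQT : Tm Γ _).subst s = negQT := by simp -implicitDefEqProofs [negQT]
@[simp] theorem subst_negQ (t : Tm Γ nat) : (negQ t).subst s = negQ (t.subst s) := by simp -implicitDefEqProofs [negQ]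
@[simp] theorem subst_subQ (t u : Tm Γ nat) :
    (subQ t u).subst s = subQ (t.subst s) (u.subst s) := by simp -implicitDefEqProofs [subQ]
@[simp] theorem subst_absQT : (absQT : Tm Γ _).subst s = absQT := by simp -implicitDefEqProofs [absQT]
@[simp] theorem subst_absQ (t : Tm Γ nat) : (absQ t).subst s = absQ (t.subst s) := by simp -implicitDefEqProofs [absQ]
@[simp] theorem subst_cmpQT : (cmpQT : Tm Γ _).subst s = cmpQT := by simp -implicitDefEqProofs [cmpQT]
@[simp] theorem subst_cmpQ (t u : Tm Γ nat) :
    (cmpQ t u).subst s = cmpQ (t.subst s) (u.subst s) := by simp -implicitDefEqProofs [cmpQ]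
@[simp] theorem subst_dyadQ (t u : Tm Γ nat) :
    (dyadQ t u).subst s = dyadQ (t.subst s) (u.subst s) := by simp -implicitDefEqProofs [dyadQ]
@[simp] theorem subst_invPowQ (t : Tm Γ nat) : (invPowQ t).subst s = invPowQ (t.subst s) := by
  simp -implicitDefEqProofs [invPowQ]
@[simp] theorem subst_hatT : (hatT : Tm Γ _).subst s = hatT := by simp -implicitDefEqProofs [hatT]

end Closed

namespace Model

variable {M : Model}

/-- A term family invariant under substitution has one value in all contexts. So the arithmetical
terms define operations on the model that do not mention an assignment. -/
theorem eval_closed {τ : Ty} {t : (Γ : Ctx) → Tm Γ τ}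
    (h : ∀ {Γ Δ : Ctx} (s : Sub Γ Δ), (t Γ).subst s = t Δ) {Γ : Ctx} (e : M.Env Γ) :
    eval e (t Γ) = eval .nil (t []) := by
  have h₀ := congrArg (eval e) (h (Γ := []) (Δ := Γ) fun _ v => nomatch v)
  rw [eval_subst] at h₀
  rw [← h₀]
  exact congrArg (fun e => eval e (t [])) (funext fun _ => funext fun v => nomatch v)

end Model

namespace Model

variable {M : Model}

/-! # Arithmetic in a model -/

instance : Zero (M.carrier nat) := ⟨M.con .zero⟩
instance : One (M.carrier nat) := ⟨M.app (M.con .succ) 0⟩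
instance : Add (M.carrier nat) := ⟨fun a b => M.app (M.app (eval .nil addT) a) b⟩
instance : _root_.Sub (M.carrier nat) := ⟨fun a b => M.app (M.app (eval .nil monusT) a) b⟩
instance : Mul (M.carrier nat) := ⟨fun a b => M.app (M.app (eval .nil mulT) a) b⟩

def suc (a : M.carrier nat) : M.carrier nat := M.app (M.con .succ) a
def prd (a : M.carrier nat) : M.carrier nat := M.app (eval .nil predT) a
def pow2 (a : M.carrier nat) : M.carrier nat := M.app (eval .nil powT) a

def recM {ρ : Ty} (n : M.carrier nat) (y : M.carrier ρ) (z : M.carrier (ρ ⇝ nat ⇝ ρ)) :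
    M.carrier ρ :=
  M.app (τ := ρ) (M.app (τ := (ρ ⇝ nat ⇝ ρ) ⇝ ρ)
    (M.app (τ := ρ ⇝ (ρ ⇝ nat ⇝ ρ) ⇝ ρ) (M.con (.recur [ρ] .zero)) n) y) z

section Eval

variable {Γ : Ctx} (e : M.Env Γ)

@[simp] theorem eval_zero : eval e zero = 0 := rfl
@[simp] theorem eval_n1 : eval e n1 = 1 := rfl
@[simp] theorem eval_succ (t : Tm Γ nat) : eval e (succ t) = suc (eval e t) := rfl
@[simp] theorem eval_rc {ρ : Ty} (x : Tm Γ nat) (y : Tm Γ ρ) (z : Tm Γ (ρ ⇝ nat ⇝ ρ)) :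
    eval e (rc x y z) = recM (eval e x) (eval e y) (eval e z) := rfl
@[simp] theorem eval_pred (t : Tm Γ nat) : eval e (pred t) = prd (eval e t) := by
  rw [pred, eval_app, eval_closed subst_predT]; rfl
@[simp] theorem eval_add (t u : Tm Γ nat) : eval e (add t u) = eval e t + eval e u := by
  rw [add, eval_app, eval_app, eval_closed subst_addT]; rfl
@[simp] theorem eval_monus (t u : Tm Γ nat) : eval e (monus t u) = eval e t - eval e u := by
  rw [monus, eval_app, eval_app, eval_closed subst_monusT]; rfl
@[simp] theorem eval_mul (t u : Tm Γ nat) : eval e (mul t u) = eval e t * eval e u := by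
  rw [mul, eval_app, eval_app, eval_closed subst_mulT]; rfl
@[simp] theorem eval_pow (t : Tm Γ nat) : eval e (pow t) = pow2 (eval e t) := by
  rw [pow, eval_app, eval_closed subst_powT]; rfl

end Eval

attribute [simp] eval_wk sat

variable [hM : Fact M.Base]

@[simp] theorem app_lam {Γ : Ctx} {σ τ : Ty} (e : M.Env Γ) (t : Tm (σ :: Γ) τ)
    (x : M.carrier σ) : M.app (eval e (lam t)) x = eval (Env.cons x e) t := hM.1.app_lam x e t

theorem induct {Γ : Ctx} (A : Fml (nat :: Γ)) (e : M.Env Γ) (h₀ : sat (Env.cons 0 e) A)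
    (hs : ∀ n, sat (Env.cons n e) A → sat (Env.cons (suc n) e) A) (n : M.carrier nat) :
    sat (Env.cons n e) A := by
  refine hM.1.sat (.induction A) e ⟨?_, fun n hn => ?_⟩ n
  · rw [Fml.inst, sat_subst]
    rwa [Env.cons_ext (e := fun _ v => eval e (Sub.cons zero (Sub.id Γ) _ v))
      (e' := Env.cons 0 e) rfl fun _ _ => rfl]
  · rw [sat_subst]
    rw [Env.cons_ext
      (e := fun _ v => eval (Env.cons n e) (Sub.cons (succ v0) (Sub.shift Γ nat) _ v))
      (e' := Env.cons (suc n) e) rfl fun _ _ => rfl]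
    exact hs n hn

theorem suc_ne_zero (a : M.carrier nat) : suc a ≠ 0 :=
  hM.1.sat (.succ_ne_zero (Γ := [nat]) v0) (Env.cons a .nil)

theorem suc_inj {a b : M.carrier nat} (h : suc a = suc b) : a = b :=
  hM.1.sat (.succ_inj (Γ := [nat, nat]) v0 v1) (Env.cons a (Env.cons b .nil)) h

@[simp] theorem recM_zero {ρ : Ty} (y : M.carrier ρ) (z : M.carrier (ρ ⇝ nat ⇝ ρ)) :
    recM 0 y z = y :=
  hM.1.eval_eq (.ax (.rec_zero (Γ := [ρ, ρ ⇝ nat ⇝ ρ]) v0 v1)) (Env.cons y (Env.cons z .nil))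

@[simp] theorem recM_suc {ρ : Ty} (x : M.carrier nat) (y : M.carrier ρ)
    (z : M.carrier (ρ ⇝ nat ⇝ ρ)) : recM (suc x) y z = M.app (M.app z (recM x y z)) x :=
  hM.1.eval_eq (.ax (.rec_succ (Γ := [nat, ρ, ρ ⇝ nat ⇝ ρ]) v0 v1 v2))
    (Env.cons x (Env.cons y (Env.cons z .nil)))

/-- An instance of induction for a property that is defined by a formula with parameters. -/
@[elab_as_elim]
theorem induct' {p : M.carrier nat → Prop} (n : M.carrier nat) {Γ : Ctx} (A : Fml (nat :: Γ))
    (e : M.Env Γ) (hp : ∀ n, sat (Env.cons n e) A ↔ p n) (h₀ : p 0)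
    (hs : ∀ n, p n → p (suc n)) : p n :=
  (hp n).1 (induct A e ((hp 0).2 h₀) (fun n hn => (hp _).2 (hs n ((hp n).1 hn))) n)

section Defs

variable (a b : M.carrier nat)

theorem add_def : a + b = eval (Env.cons b (Env.cons a .nil)) (rc v0 v1 (lam (lam (succ v1)))) := by
  change M.app (M.app (eval .nil addT) a) b = _
  rw [addT, app_lam, app_lam]

@[simp] theorem add_zero' : a + 0 = a := by simp -implicitDefEqProofs [add_def]
@[simp] theorem add_suc : a + suc b = suc (a + b) := by
  simp -implicitDefEqProofs [add_def]
  rfl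
@[simp] theorem prd_zero : prd (0 : M.carrier nat) = 0 := by
  simp -implicitDefEqProofs [prd, predT]
@[simp] theorem prd_suc : prd (suc a) = a := by simp -implicitDefEqProofs [prd, predT]

theorem sub_def :
    a - b = eval (Env.cons b (Env.cons a .nil)) (rc v0 v1 (lam (lam (pred v1)))) := by
  change M.app (M.app (eval .nil monusT) a) b = _
  rw [monusT, app_lam, app_lam]

@[simp] theorem sub_zero' : a - 0 = a := by simp -implicitDefEqProofs [sub_def]
@[simp] theorem sub_suc : a - suc b = prd (a - b) := by
  simp -implicitDefEqProofs [sub_def]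
  rfl

theorem mul_def :
    a * b = eval (Env.cons b (Env.cons a .nil)) (rc v0 zero (lam (lam (add v1 v3)))) := by
  change M.app (M.app (eval .nil mulT) a) b = _
  rw [mulT, app_lam, app_lam]

@[simp] theorem mul_zero' : a * 0 = 0 := by simp -implicitDefEqProofs [mul_def]
@[simp] theorem mul_suc : a * suc b = a * b + a := by
  simp -implicitDefEqProofs [mul_def]
  rfl
@[simp] theorem pow2_zero : pow2 (0 : M.carrier nat) = 1 := by
  simp -implicitDefEqProofs [pow2, powT]
@[simp] theorem pow2_suc : pow2 (suc a) = pow2 a + pow2 a := by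
  simp -implicitDefEqProofs [pow2, powT]
  rfl

end Defs

/-! # The ordered semiring of numbers of a model -/

theorem zero_or_suc (a : M.carrier nat) : a = 0 ∨ ∃ b, a = suc b := by
  refine induct' a (.eq v0 zero ⋎ .ex nat (.eq v1 (succ v0))) .nil (fun n => ?_) (Or.inl rfl)
    (fun n _ => Or.inr ⟨n, rfl⟩)
  simp

theorem suc_eq_add_one (a : M.carrier nat) : suc a = a + 1 := by
  change _ = a + suc 0
  simp

theorem zero_add' (a : M.carrier nat) : 0 + a = a :=
  induct' a (.eq (add zero v0) v0) .nil (fun n => by simp) (by simp)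
    (fun n h => by simp [h])

theorem suc_add (a b : M.carrier nat) : suc a + b = suc (a + b) :=
  induct' b (.eq (add (succ v1) v0) (succ (add v1 v0))) (Env.cons a .nil) (fun n => by simp)
    (by simp) (fun n h => by simp [h])

theorem add_comm' (a b : M.carrier nat) : a + b = b + a :=
  induct' b (.eq (add v1 v0) (add v0 v1)) (Env.cons a .nil) (fun n => by simp)
    (by simp [zero_add']) (fun n h => by simp [h, suc_add])

theorem add_assoc' (a b c : M.carrier nat) : a + b + c = a + (b + c) :=
  induct' c (.eq (add (add v1 v2) v0) (add v1 (add v2 v0))) (Env.cons a (Env.cons b .nil))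
    (fun n => by simp) (by simp) (fun n h => by simp [h])

instance : AddCommMonoid (M.carrier nat) where
  add_assoc := add_assoc'
  zero_add := zero_add'
  add_zero := add_zero'
  add_comm := add_comm'
  nsmul := nsmulRec

theorem zero_mul' (a : M.carrier nat) : 0 * a = 0 :=
  induct' a (.eq (mul zero v0) zero) .nil (fun n => by simp) (by simp)
    (fun n h => by simp [h])

theorem suc_mul (a b : M.carrier nat) : suc a * b = a * b + b :=
  induct' b (.eq (mul (succ v1) v0) (add (mul v1 v0) v0)) (Env.cons a .nil) (fun n => by simp)
    (by simp) (fun n h => by simp [h, add_right_comm])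

theorem mul_comm' (a b : M.carrier nat) : a * b = b * a :=
  induct' b (.eq (mul v1 v0) (mul v0 v1)) (Env.cons a .nil) (fun n => by simp)
    (by simp [zero_mul']) (fun n h => by simp [h, suc_mul])

theorem mul_add' (a b c : M.carrier nat) : a * (b + c) = a * b + a * c :=
  induct' c (.eq (mul v1 (add v2 v0)) (add (mul v1 v2) (mul v1 v0))) (Env.cons a (Env.cons b .nil))
    (fun n => by simp) (by simp) (fun n h => by simp [h, add_assoc])

theorem mul_assoc' (a b c : M.carrier nat) : a * b * c = a * (b * c) :=
  induct' c (.eq (mul (mul v1 v2) v0) (mul v1 (mul v2 v0))) (Env.cons a (Env.cons b .nil))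
    (fun n => by simp) (by simp) (fun n h => by simp [h, mul_add'])

theorem mul_one' (a : M.carrier nat) : a * 1 = a := by
  change a * suc 0 = a
  simp

instance : CommSemiring (M.carrier nat) where
  zero_mul := zero_mul'
  mul_zero := mul_zero'
  mul_comm := mul_comm'
  left_distrib := mul_add'
  right_distrib a b c := by rw [mul_comm', mul_add', mul_comm' c a, mul_comm' c b]
  mul_assoc := mul_assoc'
  mul_one := mul_one'
  one_mul a := by rw [mul_comm', mul_one']

theorem add_right_cancel' {a b c : M.carrier nat} (h : a + c = b + c) : a = b :=
  induct' c (.eq (add v1 v0) (add v2 v0) ⟹ .eq v1 v2) (Env.cons a (Env.cons b .nil))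
    (p := fun c => a + c = b + c → a = b) (fun n => by simp) (by simp)
    (fun n h h' => h (suc_inj (by simpa using h'))) h

theorem eq_zero_of_add {a b : M.carrier nat} (h : a + b = 0) : a = 0 := by
  rcases zero_or_suc a with rfl | ⟨c, rfl⟩
  · rfl
  · rw [suc_add] at h
    exact (suc_ne_zero _ h).elim

/-- The order is defined through addition, which makes it canonical; that `monus` decides it is
shown afterwards, in the `OrderedSub` instance. -/
instance : PartialOrder (M.carrier nat) where
  le a b := ∃ c, b = a + c
  le_refl a := ⟨0, (add_zero a).symm⟩
  le_trans := by
    rintro a _ _ ⟨c, rfl⟩ ⟨d, rfl⟩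
    exact ⟨c + d, add_assoc _ _ _⟩
  le_antisymm := by
    rintro a _ ⟨c, rfl⟩ ⟨d, h⟩
    have : c + d = 0 := add_right_cancel' (c := a) (by rw [zero_add, add_comm, ← add_assoc, ← h])
    rw [eq_zero_of_add this, add_zero]

theorem le_iff {a b : M.carrier nat} : a ≤ b ↔ ∃ c, b = a + c := Iff.rfl

theorem le_total' (a b : M.carrier nat) : a ≤ b ∨ b ≤ a := by
  refine induct' a (.ex nat (.eq v2 (add v1 v0)) ⋎ .ex nat (.eq v1 (add v2 v0))) (Env.cons b .nil)
    (fun n => by simp [le_iff]) (Or.inl ⟨b, (zero_add b).symm⟩) ?_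
  rintro n (⟨c, rfl⟩ | ⟨c, rfl⟩)
  · rcases zero_or_suc c with rfl | ⟨c, rfl⟩
    · exact Or.inr ⟨1, by rw [suc_eq_add_one, add_zero]⟩
    · exact Or.inl ⟨c, by rw [add_suc, suc_add]⟩
  · exact Or.inr ⟨suc c, by rw [add_suc]⟩

open Classical in
noncomputable instance : LinearOrder (M.carrier nat) where
  le_total := le_total'
  toDecidableLE := inferInstance

instance : CanonicallyOrderedAdd (M.carrier nat) where
  exists_add_of_le h := h
  le_add_self _ b := ⟨b, add_comm _ _⟩
  le_self_add _ b := ⟨b, rfl⟩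

theorem lt_iff {a b : M.carrier nat} : a < b ↔ ∃ c, b = a + suc c := by
  constructor
  · intro h
    obtain ⟨c, rfl⟩ := h.le
    rcases zero_or_suc c with rfl | ⟨c, rfl⟩
    · simp at h
    · exact ⟨c, rfl⟩
  · rintro ⟨c, rfl⟩
    refine lt_of_le_of_ne ⟨_, rfl⟩ fun h => suc_ne_zero c (add_right_cancel' (c := a) ?_)
    rw [zero_add, add_comm, ← h]

instance : IsStrictOrderedRing (M.carrier nat) where
  add_le_add_left := by
    rintro a _ ⟨c, rfl⟩ d
    exact ⟨c, add_right_comm _ _ _⟩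
  le_of_add_le_add_left := by
    rintro a b c ⟨d, h⟩
    exact ⟨d, add_right_cancel' (c := a) (by rw [add_comm, h, add_assoc, add_comm])⟩
  zero_le_one := ⟨1, (zero_add _).symm⟩
  exists_pair_ne := ⟨suc 0, 0, suc_ne_zero 0⟩
  mul_lt_mul_of_pos_left := by
    intro c hc a b hab
    obtain ⟨d, rfl⟩ := lt_iff.1 hab
    obtain ⟨c, rfl⟩ := lt_iff.1 hc
    refine lt_iff.2 ⟨suc c * d + c, ?_⟩
    simp [mul_add, zero_add, add_assoc]
  mul_lt_mul_of_pos_right := by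
    intro c hc a b hab
    obtain ⟨d, rfl⟩ := lt_iff.1 hab
    obtain ⟨c, rfl⟩ := lt_iff.1 hc
    refine lt_iff.2 ⟨suc c * d + c, ?_⟩
    simp [mul_comm _ (suc c), mul_add, zero_add, add_assoc]

theorem suc_sub_suc (a b : M.carrier nat) : suc a - suc b = a - b :=
  induct' b (.eq (monus (succ v1) (succ v0)) (monus v1 v0)) (Env.cons a .nil) (fun n => by simp)
    (by simp) (fun n h => by rw [sub_suc, h, sub_suc])

theorem add_sub_cancel_right' (a b : M.carrier nat) : a + b - b = a :=
  induct' b (.eq (monus (add v1 v0) v0) v1) (Env.cons a .nil) (fun n => by simp)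
    (by simp) (fun n h => by rw [add_suc, suc_sub_suc, h])

theorem sub_add_self (a b : M.carrier nat) : b - (a + b) = 0 :=
  induct' b (.eq (monus v0 (add v1 v0)) zero) (Env.cons a .nil) (fun n => by simp)
    (by
      refine induct' a (.eq (monus zero (add v0 zero)) zero) .nil (fun n => by simp) (by simp)
        (fun n h => ?_)
      rw [add_zero'] at h ⊢
      rw [sub_suc, h, prd_zero])
    (fun n h => by rw [add_suc, suc_sub_suc, h])

instance : OrderedSub (M.carrier nat) where
  tsub_le_iff_right a b c := by
    rcases le_total a b with ⟨d, rfl⟩ | ⟨d, rfl⟩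
    · rw [add_comm a d, sub_add_self, add_left_comm]
      exact ⟨fun _ => ⟨d + c, by ac_rfl⟩, fun _ => ⟨c, (zero_add c).symm⟩⟩
    · rw [add_comm b d, add_sub_cancel_right', add_le_add_iff_right]

theorem lt_suc_iff {a b : M.carrier nat} : a < suc b ↔ a ≤ b := by
  rw [lt_iff, le_iff]
  exact exists_congr fun c => ⟨fun h => suc_inj (by rw [h, add_suc]), fun h => by rw [h, add_suc]⟩

@[simp] theorem sat_le0 {Γ : Ctx} (e : M.Env Γ) (s t : Tm Γ nat) :
    sat e (le0 s t) ↔ eval e s ≤ eval e t := by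
  rw [le0, sat, eval_monus, eval_zero, tsub_eq_zero_iff_le]

end Model

/-! # The ordered field of fractions of an ordered semiring of natural numbers -/

section Differences

variable (N : Type) [CommSemiring N] [IsCancelAdd N]

/-- Formal differences `re - im`, up to equality of differences. -/
def differenceCon : RingCon (QuadraticAlgebra N 1 0) where
  r x y := x.re + y.im = y.re + x.im
  iseqv :=
    { refl := fun _ => rfl
      symm := fun h => h.symm
      trans := fun {x y z} h h' => by
        refine add_right_cancel (b := y.im + y.re) ?_
        calc x.re + z.im + (y.im + y.re) = x.re + y.im + (y.re + z.im) := by ring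
          _ = y.re + x.im + (z.re + y.im) := by rw [h, h']
          _ = _ := by ring }
  add' {w x y z} h h' := by
    change w.re + y.re + (x.im + z.im) = x.re + z.re + (w.im + y.im)
    rw [add_add_add_comm, h, h', add_add_add_comm]
  mul' {w x y z} h h' := by
    -- By commutativity it is enough to change one factor at a time; the two changes are then
    -- composed by cancellation.
    have key : ∀ {a b c : QuadraticAlgebra N 1 0}, a.re + b.im = b.re + a.im →
        (a * c).re + (b * c).im = (b * c).re + (a * c).im := by
      intro a b c h
      simp only [QuadraticAlgebra.re_mul, QuadraticAlgebra.im_mul, one_mul, zero_mul, add_zero]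
      calc a.re * c.re + a.im * c.im + (b.re * c.im + b.im * c.re)
          = (a.re + b.im) * c.re + (b.re + a.im) * c.im := by ring
        _ = (b.re + a.im) * c.re + (a.re + b.im) * c.im := by rw [h]
        _ = _ := by ring
    have h₁ := key (c := y) h
    have h₂ := key (c := x) h'
    rw [mul_comm y, mul_comm z] at h₂
    refine add_right_cancel (b := (x * y).im + (x * y).re) ?_
    calc (w * y).re + (x * z).im + ((x * y).im + (x * y).re)
        = (w * y).re + (x * y).im + ((x * y).re + (x * z).im) := by ring
      _ = (x * y).re + (w * y).im + ((x * z).re + (x * y).im) := by rw [h₁, h₂]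
      _ = _ := by ring

/-- In `QuadraticAlgebra N 1 0` the generator squares to `1`, and the congruence sends it to `-1`.
So the product of pairs is the product of differences, and the semiring laws are inherited. -/
abbrev Differences : Type := (differenceCon N).Quotient

instance : Neg (Differences N) where
  neg := Quotient.map (sa := (differenceCon N).toSetoid) (sb := (differenceCon N).toSetoid)
    (fun x => ⟨x.im, x.re⟩) fun x y (h : x.re + y.im = y.re + x.im) => by
      change x.im + y.re = y.im + x.re
      rw [add_comm, ← h, add_comm]

instance : CommRing (Differences N) where
  __ := (inferInstance : CommSemiring (Differences N))
  zsmul := zsmulRec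
  neg_add_cancel := by
    rintro ⟨x⟩
    refine (RingCon.eq _).2 ?_
    change x.im + x.re + 0 = 0 + (x.re + x.im)
    rw [add_zero, zero_add, add_comm]

def differenceHom : N →+* Differences N :=
  (RingCon.mk' (differenceCon N)).comp
    { toFun := fun n => (⟨n, 0⟩ : QuadraticAlgebra N 1 0)
      map_one' := rfl
      map_zero' := rfl
      map_mul' := fun a b => by ext <;> simp
      map_add' := fun a b => by ext <;> simp }

theorem differenceHom_injective : Function.Injective (differenceHom N) := fun a b h => by
  have : a + 0 = b + 0 := (RingCon.eq _).1 h
  simpa using this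

theorem exists_eq_sub (z : Differences N) : ∃ a b, z = differenceHom N a - differenceHom N b := by
  obtain ⟨⟨a, b⟩⟩ := z
  refine ⟨a, b, ?_⟩
  refine eq_sub_of_add_eq ((RingCon.eq _).2 ?_)
  change a + b + 0 = a + (b + 0)
  simp

end Differences

section Fractions

variable (N : Type) [CommSemiring N] [LinearOrder N] [IsStrictOrderedRing N]
  [CanonicallyOrderedAdd N]

/-- Of two numbers the larger is the smaller plus something, so every formal difference is a number
up to sign. This yields the absence of zero divisors and the total order on fractions. -/
theorem exists_eq_or_eq_neg (z : Differences N) :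
    ∃ a, z = differenceHom N a ∨ z = -differenceHom N a := by
  obtain ⟨a, b, rfl⟩ := exists_eq_sub N z
  rcases le_total a b with h | h
  · obtain ⟨c, rfl⟩ := exists_add_of_le h
    exact ⟨c, Or.inr (by rw [map_add]; ring)⟩
  · obtain ⟨c, rfl⟩ := exists_add_of_le h
    exact ⟨c, Or.inl (by rw [map_add]; ring)⟩

instance : NoZeroDivisors (Differences N) where
  eq_zero_or_eq_zero_of_mul_eq_zero {x y} h := by
    obtain ⟨a, ha⟩ := exists_eq_or_eq_neg N x
    obtain ⟨b, hb⟩ := exists_eq_or_eq_neg N y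
    have hab : differenceHom N (a * b) = 0 := by
      rw [map_mul]
      rcases ha with rfl | rfl <;> rcases hb with rfl | rfl <;> simpa using h
    rcases mul_eq_zero.1 ((map_eq_zero_iff _ (differenceHom_injective N)).1 hab) with rfl | rfl
    · left
      simpa using ha
    · right
      simpa using hb

instance : Nontrivial (Differences N) := (differenceHom_injective N).nontrivial

instance : IsDomain (Differences N) := NoZeroDivisors.to_isDomain _

/-- The field of fractions of the differences, ordered by the cone of quotients `p / q` of numbers.
Cofinality of `N` uses `h₁`: as `q ≥ 1`, the quotient `p / q` is at most `p`. -/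
theorem exists_ordered_field (h₁ : ∀ q : N, q ≠ 0 → 1 ≤ q) : ∃ (K : Type) (_ : Field K) (_ : LinearOrder K)
    (_ : IsStrictOrderedRing K) (ι : N →+* K), StrictMono ι ∧ ∀ x, ∃ n, x ≤ ι n := by
  classical
  let K := FractionRing (Differences N)
  let ι : N →+* K := (algebraMap (Differences N) K).comp (differenceHom N)
  have hι : Function.Injective ι :=
    (IsFractionRing.injective (Differences N) K).comp (differenceHom_injective N)
  have hι₀ : ∀ {n}, n ≠ 0 → ι n ≠ 0 := fun h => (map_ne_zero_iff ι hι).2 h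
  let C : RingCone K :=
    { carrier := {x | ∃ p q, q ≠ 0 ∧ x = ι p / ι q}
      mul_mem' := by
        rintro _ _ ⟨p, q, hq, rfl⟩ ⟨p', q', hq', rfl⟩
        exact ⟨p * p', q * q', mul_ne_zero hq hq', by rw [map_mul, map_mul, div_mul_div_comm]⟩
      one_mem' := ⟨1, 1, one_ne_zero, by simp⟩
      add_mem' := by
        rintro _ _ ⟨p, q, hq, rfl⟩ ⟨p', q', hq', rfl⟩
        exact ⟨p * q' + q * p', q * q', mul_ne_zero hq hq', by
          simp only [map_mul, map_add, div_add_div _ _ (hι₀ hq) (hι₀ hq')]⟩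
      zero_mem' := ⟨0, 1, one_ne_zero, by simp⟩
      eq_zero_of_mem_of_neg_mem' := by
        rintro _ ⟨p, q, hq, rfl⟩ ⟨p', q', hq', h⟩
        have h₁ : ι (p * q' + p' * q) = 0 := by
          rw [← neg_div, div_eq_div_iff (hι₀ hq) (hι₀ hq')] at h
          rw [map_add, map_mul, map_mul]
          linear_combination -h
        have h₂ := (map_eq_zero_iff ι hι).1 h₁
        rw [add_eq_zero, mul_eq_zero] at h₂
        rw [h₂.1.resolve_right hq', map_zero, zero_div] }
  have hC : ∀ {x}, x ∈ C ↔ ∃ p q, q ≠ 0 ∧ x = ι p / ι q := Iff.rfl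
  have : HasMemOrNegMem C := ⟨fun x => by
    obtain ⟨a, b, hb, rfl⟩ := IsFractionRing.div_surjective (A := Differences N) x
    obtain ⟨p, hp⟩ := exists_eq_or_eq_neg N a
    obtain ⟨q, hq⟩ := exists_eq_or_eq_neg N b
    have hq₀ : q ≠ 0 := by
      rintro rfl
      refine nonZeroDivisors.ne_zero hb ?_
      simpa using hq
    rcases hp with rfl | rfl <;> rcases hq with rfl | rfl
    · exact Or.inl ⟨p, q, hq₀, rfl⟩
    · exact Or.inr ⟨p, q, hq₀, by rw [map_neg, div_neg, neg_neg]; rfl⟩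
    · exact Or.inr ⟨p, q, hq₀, by rw [map_neg, neg_div, neg_neg]; rfl⟩
    · exact Or.inl ⟨p, q, hq₀, by rw [map_neg, map_neg, neg_div_neg_eq]; rfl⟩⟩
  let _ : LinearOrder K := .mkOfAddGroupCone C
  have : IsOrderedRing K := .mkOfCone C
  have : IsStrictOrderedRing K := inferInstance
  have hle : ∀ {x y : K}, x ≤ y ↔ y - x ∈ C := Iff.rfl
  have hmono : StrictMono ι := by
    refine Monotone.strictMono_of_injective (fun a b h => ?_) hι
    obtain ⟨c, rfl⟩ := exists_add_of_le h
    exact hle.2 ⟨c, 1, one_ne_zero, by simp⟩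
  refine ⟨K, inferInstance, inferInstance, inferInstance, ι, hmono, fun x => ?_⟩
  rcases le_total x 0 with h | h
  · exact ⟨0, by rwa [map_zero]⟩
  · rw [hle, sub_zero] at h
    obtain ⟨p, q, hq, rfl⟩ := h
    refine ⟨p, div_le_self ?_ ?_⟩
    · rw [← map_zero ι]
      exact hmono.monotone zero_le
    · rw [← map_one ι]
      exact hmono.monotone (h₁ q hq)

end Fractions

namespace Model

variable {M : Model}

def parM (a : M.carrier nat) : M.carrier nat := M.app (eval .nil parT) a
def halfM (a : M.carrier nat) : M.carrier nat := M.app (eval .nil halfT) a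
def leastM (f : M.carrier one) (n : M.carrier nat) : M.carrier nat :=
  M.app (M.app (eval .nil leastT) f) n

section Eval

variable {Γ : Ctx} (e : M.Env Γ)

@[simp] theorem eval_par (t : Tm Γ nat) : eval e (par t) = parM (eval e t) := by
  rw [par, eval_app, eval_closed subst_parT]; rfl
@[simp] theorem eval_half (t : Tm Γ nat) : eval e (half t) = halfM (eval e t) := by
  rw [half, eval_app, eval_closed subst_halfT]; rfl
@[simp] theorem eval_least (f : Tm Γ one) (t : Tm Γ nat) :
    eval e (least f t) = leastM (eval e f) (eval e t) := by
  rw [least, eval_app, eval_app, eval_closed subst_leastT]; rfl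

end Eval

variable [hM : Fact M.Base]

theorem suc_le_iff {a b : M.carrier nat} : suc a ≤ b ↔ a < b := by
  rw [← lt_suc_iff, suc_eq_add_one, suc_eq_add_one, add_lt_add_iff_right]

theorem one_le_of_ne_zero {a : M.carrier nat} (h : a ≠ 0) : 1 ≤ a := by
  rcases zero_or_suc a with rfl | ⟨b, rfl⟩
  · exact (h rfl).elim
  · exact ⟨b, by rw [suc_eq_add_one, add_comm]⟩

@[simp] theorem eval_n2 {Γ : Ctx} (e : M.Env Γ) : eval e n2 = 2 := by
  rw [n2, eval_succ, eval_n1, suc_eq_add_one, one_add_one_eq_two]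

/-! # Parity -/

@[simp] theorem parM_zero : parM (0 : M.carrier nat) = 0 := by
  simp -implicitDefEqProofs [parM, parT]

@[simp] theorem parM_suc (a : M.carrier nat) : parM (suc a) = 1 - parM a := by
  simp -implicitDefEqProofs [parM, parT]
  rfl

@[simp] theorem halfM_zero : halfM (0 : M.carrier nat) = 0 := by
  simp -implicitDefEqProofs [halfM, halfT]

@[simp] theorem halfM_suc (a : M.carrier nat) : halfM (suc a) = halfM a + parM a := by
  simp -implicitDefEqProofs [halfM, halfT]
  rfl

theorem two_mul_suc (a : M.carrier nat) : 2 * suc a = suc (suc (2 * a)) := by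
  simp only [suc_eq_add_one]
  ring

theorem parM_two_mul (a : M.carrier nat) : parM (2 * a) = 0 :=
  induct' a (.eq (par (mul n2 v0)) zero) .nil (fun n => by simp) (by simp)
    (fun n h => by rw [two_mul_suc, parM_suc, parM_suc, h, tsub_zero, tsub_self])

theorem halfM_two_mul (a : M.carrier nat) : halfM (2 * a) = a :=
  induct' a (.eq (half (mul n2 v0)) v0) .nil (fun n => by simp) (by simp)
    (fun n h => by rw [two_mul_suc, halfM_suc, halfM_suc, parM_suc, h, parM_two_mul, tsub_zero,
      add_zero, suc_eq_add_one])

theorem exists_eq_two_mul (a : M.carrier nat) : ∃ b, a = 2 * b ∨ a = suc (2 * b) := by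
  refine induct' a (.ex nat (.eq v1 (mul n2 v0) ⋎ .eq v1 (succ (mul n2 v0)))) .nil
    (fun n => by simp) ⟨0, by simp⟩ ?_
  rintro _ ⟨b, rfl | rfl⟩
  · exact ⟨b, Or.inr rfl⟩
  · exact ⟨suc b, Or.inl (two_mul_suc b).symm⟩

/-! # Bounded search -/

section Search

variable (f : M.carrier one) (n : M.carrier nat)

@[simp] theorem eval_sg {Γ : Ctx} (e : M.Env Γ) (t : Tm Γ nat) :
    eval e (sg t) = 1 - (1 - eval e t) := by
  simp -implicitDefEqProofs [sg, sgT]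

@[simp] theorem leastM_zero : leastM f 0 = 0 := by
  simp -implicitDefEqProofs [leastM, leastT]

-- The first factor is `1` if no zero was found below `n` and `0` otherwise; the second is `1` iff
-- `f n ≠ 0`. So the value grows by one exactly while the search goes on.
@[simp] theorem leastM_suc : leastM f (suc n) =
    leastM f n + (1 - (n - leastM f n)) * (1 - (1 - M.app f n)) := by
  simp -implicitDefEqProofs [leastM, leastT]
  rfl

theorem leastM_spec : leastM f n ≤ n ∧ (∀ k, k < leastM f n → M.app f k ≠ 0) ∧
    (leastM f n < n → M.app f (leastM f n) = 0) := by
  refine induct' n (le0 (least v1 v0) v0 ⋏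
    .all nat (le0 (succ v0) (least v2 v1) ⟹ Fml.neg (.eq (v2 ⬝ v0) zero)) ⋏
    (le0 (succ (least v1 v0)) v0 ⟹ .eq (v1 ⬝ least v1 v0) zero)) (Env.cons f .nil)
    (fun n => by simp [suc_le_iff, Fml.neg]) (by simp) ?_
  rintro n ⟨h₁, h₂, h₃⟩
  rcases h₁.lt_or_eq with h | h
  · have e : leastM f (suc n) = leastM f n := by
      rw [leastM_suc, tsub_eq_zero_of_le (one_le_of_ne_zero (tsub_pos_of_lt h).ne'), zero_mul,
        add_zero]
    rw [e]
    exact ⟨h₁.trans (lt_suc_iff.2 le_rfl).le, h₂, fun _ => h₃ h⟩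
  · by_cases hf : M.app f n = 0
    · have e : leastM f (suc n) = n := by
        rw [leastM_suc, h, hf]
        simp
      rw [e]
      exact ⟨(lt_suc_iff.2 le_rfl).le, fun k hk => h₂ k (h.symm ▸ hk), fun _ => hf⟩
    · have e : leastM f (suc n) = suc n := by
        rw [leastM_suc, h, tsub_eq_zero_of_le (one_le_of_ne_zero hf)]
        simp [suc_eq_add_one]
      rw [e]
      refine ⟨le_rfl, fun k hk => ?_, fun h => (lt_irrefl _ h).elim⟩
      rcases (lt_suc_iff.1 hk).lt_or_eq with hk | rfl
      · exact h₂ k (h.symm ▸ hk)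
      · exact hf

theorem leastM_le_iff {n k : M.carrier nat} (hk : k < n) :
    leastM f n ≤ k ↔ ∃ u ≤ k, M.app f u = 0 := by
  obtain ⟨_, h₂, h₃⟩ := leastM_spec f n
  exact ⟨fun h => ⟨_, h, h₃ (h.trans_lt hk)⟩, fun ⟨u, hu, h⟩ =>
    (not_lt.1 fun h' => h₂ u h' h).trans hu⟩

theorem eval_bmin {Γ : Ctx} (e : M.Env Γ) (f : Tm Γ one) (t : Tm Γ nat) : eval e (bmin f t) =
    leastM (eval e f) (suc (eval e t)) *
      (1 - (leastM (eval e f) (suc (eval e t)) - eval e t)) := by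
  simp -implicitDefEqProofs [bmin, bminT]

/-- If there is a zero `u ≤ n`, the search stops at some index at most `n` and the default value `0`
of `bmin` does not come into play. -/
theorem app_eval_bmin {Γ : Ctx} (e : M.Env Γ) (f : Tm Γ one) (t : Tm Γ nat) {u : M.carrier nat}
    (hu : u ≤ eval e t) (h : M.app (eval e f) u = 0) :
    M.app (eval e f) (eval e (bmin f t)) = 0 := by
  have hl := (leastM_le_iff (eval e f) (lt_suc_iff.2 le_rfl)).2 ⟨u, hu, h⟩
  rw [eval_bmin, tsub_eq_zero_of_le hl, tsub_zero, mul_one]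
  exact (leastM_spec _ _).2.2 (lt_suc_iff.2 hl)

end Search

/-! # Pairing -/

def ppM (a b : M.carrier nat) : M.carrier nat := (a + b) * (a + b) + 3 * a + b

@[simp] theorem eval_pairPoly {Γ : Ctx} (e : M.Env Γ) (s t : Tm Γ nat) :
    eval e (pairPoly s t) = ppM (eval e s) (eval e t) := by
  simp -implicitDefEqProofs [pairPoly, pairPolyT, ppM, suc_eq_add_one, two_add_one_eq_three]

@[simp] theorem eval_dist {Γ : Ctx} (e : M.Env Γ) (s t : Tm Γ nat) :
    eval e (dist s t) = 0 ↔ eval e s = eval e t := by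
  simp -implicitDefEqProofs only [dist, eval_add, eval_monus]
  rw [add_eq_zero, tsub_eq_zero_iff_le, tsub_eq_zero_iff_le, ← le_antisymm_iff]

/-- With `s = a + b` the polynomial is `s (s + 1) + 2a`, and one of `s`, `s + 1` is even. -/
theorem exists_ppM_eq (a b : M.carrier nat) : ∃ u, 2 * u = ppM a b := by
  have : ∃ u, 2 * u = (a + b) * (a + b + 1) := by
    obtain ⟨c, h | h⟩ := exists_eq_two_mul (a + b)
    · exact ⟨c * (a + b + 1), by rw [h]; ring⟩
    · exact ⟨(a + b) * (c + 1), by rw [h, suc_eq_add_one]; ring⟩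
  obtain ⟨u, hu⟩ := this
  exact ⟨u + a, by rw [mul_add, hu, ppM]; ring⟩

theorem ppM_eq (a b : M.carrier nat) : ppM a b = (a + b) * (a + b) + (a + b) + 2 * a := by
  rw [ppM]
  ring

/-- On the diagonal `s = a + b` the polynomial is `s² + s + 2a` with `a ≤ s`, so all its values on a
later diagonal are larger; `h₁` displays the surplus. -/
theorem le_of_ppM_le {a b a' b' : M.carrier nat} (h : ppM a b = ppM a' b') :
    a + b ≤ a' + b' := by
  by_contra! h'
  obtain ⟨d, hd⟩ := lt_iff.1 h'
  have h₁ : ppM a b = ppM a' b' + (2 * b' + 2 + d * d + 3 * d + 2 * (a' + b') * d + 2 * a) := by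
    rw [ppM_eq, ppM_eq, hd, suc_eq_add_one]
    ring
  rw [h] at h₁
  have h₂ := add_eq_left.1 h₁.symm
  simp at h₂

theorem ppM_inj {a b a' b' : M.carrier nat} (h : ppM a b = ppM a' b') : a = a' ∧ b = b' := by
  have hs : a + b = a' + b' := le_antisymm (le_of_ppM_le h) (le_of_ppM_le h.symm)
  rw [ppM_eq, ppM_eq, hs, add_right_inj] at h
  have ha : a = a' := mul_left_cancel₀ two_ne_zero h
  subst ha
  exact ⟨rfl, add_left_cancel hs⟩

def jM (a b : M.carrier nat) : M.carrier nat := M.app (M.app (eval .nil jT) a) b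
def j1M (a : M.carrier nat) : M.carrier nat := M.app (eval .nil j1T) a
def j2M (a : M.carrier nat) : M.carrier nat := M.app (eval .nil j2T) a

omit hM in
@[simp] theorem eval_j {Γ : Ctx} (e : M.Env Γ) (s t : Tm Γ nat) :
    eval e (j s t) = jM (eval e s) (eval e t) := by
  rw [j, eval_app, eval_app, eval_closed subst_jT]; rfl
omit hM in
@[simp] theorem eval_j1 {Γ : Ctx} (e : M.Env Γ) (t : Tm Γ nat) :
    eval e (j1 t) = j1M (eval e t) := by
  rw [j1, eval_app, eval_closed subst_j1T]; rfl
omit hM in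
@[simp] theorem eval_j2 {Γ : Ctx} (e : M.Env Γ) (t : Tm Γ nat) :
    eval e (j2 t) = j2M (eval e t) := by
  rw [j2, eval_app, eval_closed subst_j2T]; rfl

theorem two_mul_jM (a b : M.carrier nat) : 2 * jM a b = ppM a b := by
  obtain ⟨u, hu⟩ := exists_ppM_eq a b
  rw [jM, jT, app_lam, app_lam]
  have h := app_eval_bmin (Env.cons b (Env.cons a .nil))
    (lam (dist (mul n2 v0) (pairPoly v2 v1))) (pairPoly v1 v0) (u := u)
    (by simp [← hu, two_mul]) (by simp [hu])
  simpa using h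

theorem fst_le_jM (a b : M.carrier nat) : a ≤ jM a b := by
  have h := two_mul_jM a b
  rw [ppM_eq] at h
  exact le_of_mul_le_mul_left (by rw [h]; exact le_add_self) two_pos

theorem snd_le_jM (a b : M.carrier nat) : b ≤ jM a b := by
  have h := two_mul_jM a b
  rw [ppM_eq] at h
  refine le_of_mul_le_mul_left (a := 2) ?_ two_pos
  rw [h, two_mul]
  refine le_trans ?_ le_self_add
  refine add_le_add ?_ le_add_self
  rcases eq_or_ne b 0 with rfl | hb
  · exact zero_le
  · calc b ≤ b * b := le_mul_of_one_le_left zero_le (one_le_of_ne_zero hb)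
      _ ≤ _ := mul_le_mul' le_add_self le_add_self

@[simp] theorem j1M_jM (a b : M.carrier nat) : j1M (jM a b) = a := by
  -- The inner search up to `z + 1` returns a value at most `z` iff some `m ≤ z` works, so the
  -- vanishing of the truncated difference expresses a bounded existential quantifier.
  have key : ∀ n, M.app (eval (Env.cons (jM a b) .nil)
      (lam (monus (least (lam (dist (mul n2 v2) (pairPoly v1 v0))) (succ v1)) v1))) n = 0 ↔
        ∃ m ≤ jM a b, ppM a b = ppM n m := by
    intro n
    simp -implicitDefEqProofs [-leastM_suc, tsub_eq_zero_iff_le,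
      leastM_le_iff _ (lt_suc_iff.2 (le_refl (jM a b))),
      two_mul_jM]
  rw [j1M, j1T, app_lam]
  have h := app_eval_bmin (Env.cons (jM a b) .nil)
    (lam (monus (least (lam (dist (mul n2 v2) (pairPoly v1 v0))) (succ v1)) v1)) v0 (u := a)
    (fst_le_jM a b) ((key a).2 ⟨b, snd_le_jM a b, rfl⟩)
  obtain ⟨m, -, hm⟩ := (key _).1 h
  exact (ppM_inj hm).1.symm

@[simp] theorem j2M_jM (a b : M.carrier nat) : j2M (jM a b) = b := by
  have key : ∀ n, M.app (eval (Env.cons (jM a b) .nil)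
      (lam (monus (least (lam (dist (mul n2 v2) (pairPoly v0 v1))) (succ v1)) v1))) n = 0 ↔
        ∃ m ≤ jM a b, ppM a b = ppM m n := by
    intro n
    simp -implicitDefEqProofs [-leastM_suc, tsub_eq_zero_iff_le,
      leastM_le_iff _ (lt_suc_iff.2 (le_refl (jM a b))),
      two_mul_jM]
  rw [j2M, j2T, app_lam]
  have h := app_eval_bmin (Env.cons (jM a b) .nil)
    (lam (monus (least (lam (dist (mul n2 v2) (pairPoly v0 v1))) (succ v1)) v1)) v0 (u := b)
    (snd_le_jM a b) ((key b).2 ⟨a, fst_le_jM a b, rfl⟩)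
  obtain ⟨m, -, hm⟩ := (key _).1 h
  exact (ppM_inj hm).2.symm

end Model

namespace Model

/-! # The rational numbers of a model -/

section Field

variable (M : Model) [hM : Fact M.Base]

/-- An ordered field of fractions of the numbers of the model. -/
def Rational : Type := (exists_ordered_field (M.carrier nat) fun _ => one_le_of_ne_zero).choose

noncomputable instance : Field M.Rational :=
  (exists_ordered_field (M.carrier nat) fun _ => one_le_of_ne_zero).choose_spec.choose

noncomputable instance : LinearOrder M.Rational :=
  (exists_ordered_field (M.carrier nat) fun _ => one_le_of_ne_zero).choose_spec.choose_spec.choose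

instance : IsStrictOrderedRing M.Rational :=
  (exists_ordered_field (M.carrier nat)
    fun _ => one_le_of_ne_zero).choose_spec.choose_spec.choose_spec.choose

instance : IsOrderedRing M.Rational := IsStrictOrderedRing.toIsOrderedRing
instance : IsOrderedAddMonoid M.Rational := IsOrderedRing.toIsOrderedAddMonoid
instance : ZeroLEOneClass M.Rational := IsOrderedRing.toZeroLEOneClass
instance : AddLeftMono M.Rational := IsOrderedAddMonoid.toAddLeftMono
instance : AddRightMono M.Rational := covariant_swap_add_of_covariant_add M.Rational _
instance : AddRightStrictMono M.Rational := inferInstance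

noncomputable def incl : M.carrier nat →+* M.Rational :=
  (exists_ordered_field (M.carrier nat)
    fun _ => one_le_of_ne_zero).choose_spec.choose_spec.choose_spec.choose_spec.choose

theorem incl_strictMono : StrictMono M.incl :=
  (exists_ordered_field (M.carrier nat)
    fun _ => one_le_of_ne_zero).choose_spec.choose_spec.choose_spec.choose_spec.choose_spec.1

theorem exists_le_incl (x : M.Rational) : ∃ n, x ≤ M.incl n :=
  (exists_ordered_field (M.carrier nat)
    fun _ => one_le_of_ne_zero).choose_spec.choose_spec.choose_spec.choose_spec.choose_spec.2 x

end Field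

variable {M : Model} [hM : Fact M.Base]

theorem incl_le_incl {a b : M.carrier nat} : M.incl a ≤ M.incl b ↔ a ≤ b :=
  M.incl_strictMono.le_iff_le

theorem incl_pos {a : M.carrier nat} (h : a ≠ 0) : 0 < M.incl a := by
  rw [← map_zero M.incl]
  exact M.incl_strictMono (pos_iff_ne_zero.2 h)

@[simp] theorem incl_suc (a : M.carrier nat) : M.incl (suc a) = M.incl a + 1 := by
  rw [suc_eq_add_one, map_add, map_one]

def posM (c : M.carrier nat) : M.carrier nat := (1 - parM (j1M c)) * halfM (j1M c)
def ngvM (c : M.carrier nat) : M.carrier nat := parM (j1M c) * suc (halfM (j1M c))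
def denM (c : M.carrier nat) : M.carrier nat := suc (j2M c)

/-- The rational number with code `c`. -/
noncomputable def val (c : M.carrier nat) : M.Rational :=
  (M.incl (posM c) - M.incl (ngvM c)) / M.incl (denM c)

theorem incl_denM_pos (c : M.carrier nat) : 0 < M.incl (denM c) := incl_pos (suc_ne_zero _)

section Codes

variable {Γ : Ctx} (e : M.Env Γ) (s t p q d : Tm Γ nat)

@[simp] theorem eval_pos : eval e (pos t) = posM (eval e t) := by
  simp -implicitDefEqProofs [pos, posT, posM]

@[simp] theorem eval_ngv : eval e (ngv t) = ngvM (eval e t) := by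
  simp -implicitDefEqProofs [ngv, ngvT, ngvM]

omit hM in
@[simp] theorem eval_den : eval e (den t) = denM (eval e t) := by
  simp -implicitDefEqProofs [den, denM]

theorem eval_mkQ : eval e (mkQ p q d) = jM (2 * (eval e p - eval e q) +
    (2 * (eval e q - eval e p) - 1)) (prd (eval e d)) := by
  simp -implicitDefEqProofs [mkQ, mkQT]

theorem val_mkQ (h : eval e d ≠ 0) : val (eval e (mkQ p q d)) =
    (M.incl (eval e p) - M.incl (eval e q)) / M.incl (eval e d) := by
  obtain ⟨b, hb⟩ := (zero_or_suc (eval e d)).resolve_left h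
  rw [eval_mkQ, val, posM, ngvM, denM, j1M_jM, j2M_jM, hb, prd_suc]
  congr 1
  -- By truncated subtraction only one summand of the coded numerator survives: `2(p - q)`, even, if
  -- `q ≤ p`, and `2(q - p) - 1`, odd, otherwise.
  rcases le_or_gt (eval e q) (eval e p) with h | h
  · obtain ⟨r, hr⟩ := exists_add_of_le h
    rw [hr, add_tsub_cancel_left, tsub_eq_zero_of_le le_self_add, mul_zero, zero_tsub, add_zero,
      parM_two_mul, halfM_two_mul, tsub_zero]
    simp
  · obtain ⟨r, hr⟩ := lt_iff.1 h
    rw [hr, add_tsub_cancel_left, tsub_eq_zero_of_le le_self_add, mul_zero, zero_add, two_mul_suc,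
      suc_eq_add_one (suc _), add_tsub_cancel_right, parM_suc, halfM_suc, parM_two_mul,
      halfM_two_mul]
    simp only [tsub_zero, tsub_self, zero_mul, one_mul, add_zero, map_zero, map_add, incl_suc]
    ring

@[simp] theorem val_addQ : val (eval e (addQ s t)) = val (eval e s) + val (eval e t) := by
  have h₁ := (incl_denM_pos (eval e s)).ne'
  have h₂ := (incl_denM_pos (eval e t)).ne'
  rw [addQ, addQT, eval_app, eval_app, app_lam, app_lam, val_mkQ]
  · simp only [eval_add, eval_mul, eval_pos, eval_ngv, eval_den, eval_var, Env.cons_zero,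
      Env.cons_succ, map_add, map_mul, val]
    field_simp
    ring
  · simp [denM, suc_ne_zero]

@[simp] theorem val_negQ : val (eval e (negQ t)) = -val (eval e t) := by
  rw [negQ, negQT, eval_app, app_lam, val_mkQ]
  · simp only [eval_pos, eval_ngv, eval_den, eval_var, Env.cons_zero, val]
    ring
  · simp [denM, suc_ne_zero]

@[simp] theorem val_subQ : val (eval e (subQ s t)) = val (eval e s) - val (eval e t) := by
  rw [subQ, val_addQ, val_negQ, sub_eq_add_neg]

/-- Positive and negative part never coexist, so their sum is the numerator of the absolute value.
-/
theorem posM_eq_zero_or (c : M.carrier nat) : posM c = 0 ∨ ngvM c = 0 := by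
  obtain ⟨b, h | h⟩ := exists_eq_two_mul (j1M c)
  · right
    rw [ngvM, h, parM_two_mul, zero_mul]
  · left
    rw [posM, h, parM_suc, parM_two_mul, tsub_zero, tsub_self, zero_mul]

@[simp] theorem val_absQ : val (eval e (absQ t)) = |val (eval e t)| := by
  have h₁ := (incl_denM_pos (eval e t))
  rw [absQ, absQT, eval_app, app_lam, val_mkQ]
  · simp only [eval_pos, eval_ngv, eval_den, eval_var, Env.cons_zero, val, eval_add, eval_zero,
      map_add, map_zero, sub_zero, abs_div, abs_of_pos h₁]
    congr 1
    have h : ∀ a : M.carrier nat, |M.incl a| = M.incl a := fun a => abs_of_nonneg <| by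
      rw [← map_zero M.incl, incl_le_incl]
      exact zero_le
    rcases posM_eq_zero_or (eval e t) with h' | h' <;> simp [h', h]
  · simp [denM, suc_ne_zero]

@[simp] theorem sat_leQ : sat e (leQ s t) ↔ val (eval e s) ≤ val (eval e t) := by
  have h₁ := (incl_denM_pos (eval e s))
  have h₂ := (incl_denM_pos (eval e t))
  have h : sat e (leQ s t) ↔ posM (eval e s) * denM (eval e t) + ngvM (eval e t) * denM (eval e s) ≤
      posM (eval e t) * denM (eval e s) + ngvM (eval e s) * denM (eval e t) := by
    rw [← tsub_eq_zero_iff_le]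
    simp -implicitDefEqProofs [leQ, cmpQ, cmpQT]
  rw [h, ← incl_le_incl, val, val, div_le_div_iff₀ h₁ h₂]
  simp only [map_add, map_mul]
  constructor <;> intro h <;> linarith

@[simp] theorem sat_ltQ : sat e (ltQ s t) ↔ val (eval e s) < val (eval e t) := by
  rw [ltQ, Fml.neg, sat, sat_leQ, sat, ← not_le]

theorem eval_cmpQ_eq_zero : eval e (cmpQ s t) = 0 ↔ val (eval e s) ≤ val (eval e t) :=
  sat_leQ e s t

end Codes

/-- The rational number `2⁻ⁿ`. -/
noncomputable def dl (n : M.carrier nat) : M.Rational := (M.incl (pow2 n))⁻¹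

theorem pow2_pos (n : M.carrier nat) : n < pow2 n := by
  refine induct' n (le0 (succ v0) (pow v0)) .nil (fun n => by simp [suc_le_iff])
    (by simp) fun n h => ?_
  rw [pow2_suc, suc_eq_add_one]
  exact add_lt_add_of_lt_of_le h (one_le_of_ne_zero (zero_le.trans_lt h).ne')

theorem dl_pos (n : M.carrier nat) : 0 < dl n :=
  inv_pos.2 (incl_pos (zero_le.trans_lt (pow2_pos n)).ne')

theorem dl_suc (n : M.carrier nat) : dl (suc n) = dl n / 2 := by
  rw [dl, dl, pow2_suc, map_add, ← two_mul, mul_inv, mul_comm, div_eq_mul_inv]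

@[simp] theorem val_dyadQ {Γ : Ctx} (e : M.Env Γ) (s t : Tm Γ nat) :
    val (eval e (dyadQ s t)) = M.incl (eval e s) * dl (eval e t) := by
  rw [dyadQ, val_mkQ]
  · simp [dl, div_eq_mul_inv]
  · simpa using (zero_le.trans_lt (pow2_pos _)).ne'

@[simp] theorem val_invPowQ {Γ : Ctx} (e : M.Env Γ) (t : Tm Γ nat) :
    val (eval e (invPowQ t)) = dl (eval e t) := by simp [invPowQ]

/-- The field need not be Archimedean over the standard numbers, but the numbers of the model are
cofinal in it and satisfy `n < 2ⁿ`. -/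
theorem exists_dl_lt {x : M.Rational} (hx : 0 < x) : ∃ n, dl n < x := by
  obtain ⟨n, hn⟩ := M.exists_le_incl x⁻¹
  refine ⟨n, inv_lt_of_inv_lt₀ hx (hn.trans_lt (M.incl_strictMono (pow2_pos n)))⟩

/-! # Fast converging sequences -/

def hatM (x : M.carrier one) (n : M.carrier nat) : M.carrier nat := M.app (M.app (eval .nil hatT) x) n

omit hM in
@[simp] theorem eval_hat {Γ : Ctx} (e : M.Env Γ) (x : Tm Γ one) (t : Tm Γ nat) :
    eval e (hat x t) = hatM (eval e x) (eval e t) := by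
  rw [hat, eval_app, eval_app, eval_closed subst_hatT]; rfl

/-- Raising the search bound by one keeps the result, or moves it from `n` to `n + 1` because `f n ≠
0`. For the functional `slowM` this means that `hat x` stays put or makes a fast step. -/
theorem leastM_suc_cases (f : M.carrier one) (n : M.carrier nat) :
    leastM f (suc n) = leastM f n ∨
      leastM f n = n ∧ leastM f (suc n) = suc n ∧ M.app f n ≠ 0 := by
  obtain ⟨h₁, h₂, h₃⟩ := leastM_spec f n
  obtain ⟨h₁', h₂', h₃'⟩ := leastM_spec f (suc n)
  rcases h₁'.lt_or_eq with h | h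
  · left
    have h₄ := h₃' h
    rcases (lt_suc_iff.1 h).lt_or_eq with h₅ | h₅
    · have h₆ := (leastM_le_iff f h₅).2 ⟨_, le_rfl, h₄⟩
      refine le_antisymm ?_ h₆
      exact not_lt.1 fun h₇ => h₂' _ h₇ (h₃ (h₆.trans_lt h₅))
    · rw [h₅] at h₄ ⊢
      refine le_antisymm ?_ h₁
      exact not_lt.1 fun h₇ => h₂' _ (h₅.symm ▸ h₇) (h₃ h₇)
  · right
    have h₅ : leastM f n = n := by
      refine le_antisymm h₁ (not_lt.1 fun h₇ => h₂' _ ?_ (h₃ h₇))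
      rw [h, lt_suc_iff]
      exact h₁
    exact ⟨h₅, h, h₂' n (by rw [h, lt_suc_iff])⟩

/-- The functional that detects the places where `x` does not converge fast. -/
def slowM (x : M.carrier one) : M.carrier one :=
  eval (Env.cons x .nil)
    (lam (cmpQ (invPowQ (succ v0)) (absQ (subQ (v1 ⬝ v0) (v1 ⬝ succ v0)))))

theorem app_slowM (x : M.carrier one) (n : M.carrier nat) : M.app (slowM x) n = 0 ↔
    dl (suc n) ≤ |val (M.app x n) - val (M.app x (suc n))| := by
  rw [slowM, app_lam, eval_cmpQ_eq_zero]
  simp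

theorem hatM_eq (x : M.carrier one) (n : M.carrier nat) :
    hatM x n = M.app x (leastM (slowM x) n) := by
  -- The search functional does not depend on the index, so it is the weakening of a term in `x`
  -- alone.
  have h : (lam (cmpQ (invPowQ (succ v0)) (absQ (subQ (v2 ⬝ v0) (v2 ⬝ succ v0)))) :
      Tm [nat, one] one) =
        (lam (cmpQ (invPowQ (succ v0)) (absQ (subQ (v1 ⬝ v0) (v1 ⬝ succ v0)))) : Tm [one] one).wk := by
    simp -implicitDefEqProofs [Tm.wk, Sub.shift]
  rw [hatM, hatT, app_lam, app_lam, eval_app, eval_least, h, eval_wk]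
  rfl

/-- The `n`-th rational approximation of the real number that is represented by `x`. -/
noncomputable def apx (x : M.carrier one) (n : M.carrier nat) : M.Rational := val (hatM x n)

theorem abs_apx_sub_apx_suc (x : M.carrier one) (n : M.carrier nat) :
    |apx x n - apx x (suc n)| < dl (suc n) := by
  rw [apx, apx, hatM_eq, hatM_eq]
  rcases leastM_suc_cases (slowM x) n with h | ⟨h₁, h₂, h₃⟩
  · rw [h, sub_self, abs_zero]
    exact dl_pos _
  · rw [h₁, h₂]
    rwa [Ne, app_slowM, not_le] at h₃

/-- The bound is the exact sum of the steps `2⁻ⁱ⁻¹`; the subtracted term is what makes the induction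
on `k` close. -/
theorem abs_apx_sub_apx_add (x : M.carrier one) (n k : M.carrier nat) :
    |apx x n - apx x (n + k)| ≤ dl n - dl (n + k) := by
  refine induct' k (leQ (absQ (subQ (hat v1 v2) (hat v1 (add v2 v0))))
    (subQ (invPowQ v2) (invPowQ (add v2 v0)))) (Env.cons x (Env.cons n .nil))
    (fun k => by simp [apx]) (by simp) fun k h => ?_
  have h' := abs_apx_sub_apx_suc x (n + k)
  have h'' := abs_sub_le (apx x n) (apx x (n + k)) (apx x (suc (n + k)))
  have := dl_suc (n + k)
  rw [add_suc]
  linarith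

/-- On a sequence that already converges fast the search in `hat` never stops early, so `hat`
changes nothing. The sum, the negation and the constants are of this kind, and their approximations
can be read off. -/
theorem apx_eq_of_fast {x : M.carrier one}
    (h : ∀ n, |val (M.app x n) - val (M.app x (suc n))| < dl (suc n)) (n : M.carrier nat) :
    apx x n = val (M.app x n) := by
  obtain ⟨h₁, -, h₃⟩ := leastM_spec (slowM x) n
  have : leastM (slowM x) n = n := by
    refine le_antisymm h₁ (not_lt.1 fun h' => (h (leastM (slowM x) n)).not_ge ?_)
    exact (app_slowM _ _).1 (h₃ h')
  rw [apx, hatM_eq, this]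

section Reals

variable {Γ : Ctx} (e : M.Env Γ) (s t : Tm Γ one)

@[simp] theorem apx_constR (q : Tm Γ nat) (n : M.carrier nat) :
    apx (eval e (constR q)) n = val (eval e q) := by
  have h : ∀ n, M.app (eval e (constR q)) n = eval e q := fun n => by
    simp -implicitDefEqProofs [constR, constRT]
  rw [apx_eq_of_fast, h]
  intro n
  rw [h, h, sub_self, abs_zero]
  exact dl_pos _

@[simp] theorem apx_addR (n : M.carrier nat) :
    apx (eval e (addR s t)) n = apx (eval e s) (suc n) + apx (eval e t) (suc n) := by
  have h : ∀ n, val (M.app (eval e (addR s t)) n) =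
      apx (eval e s) (suc n) + apx (eval e t) (suc n) := fun n => by
    rw [addR, addRT, eval_app, eval_app, app_lam, app_lam, app_lam]
    simp -implicitDefEqProofs [apx]
  rw [apx_eq_of_fast, h]
  intro n
  have h₁ := abs_apx_sub_apx_suc (eval e s) (suc n)
  have h₂ := abs_apx_sub_apx_suc (eval e t) (suc n)
  have h₃ := dl_suc (suc n)
  rw [h, h, add_sub_add_comm]
  refine (abs_add_le _ _).trans_lt ?_
  linarith

@[simp] theorem apx_negR (n : M.carrier nat) :
    apx (eval e (negR t)) n = -apx (eval e t) n := by
  have h : ∀ n, val (M.app (eval e (negR t)) n) = -apx (eval e t) n := fun n => by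
    rw [negR, negRT, eval_app, app_lam, app_lam]
    simp -implicitDefEqProofs [apx]
  rw [apx_eq_of_fast, h]
  intro n
  have h₂ := abs_apx_sub_apx_suc (eval e t) n
  rw [h, h, neg_sub_neg, abs_sub_comm]
  exact h₂

theorem sat_ltR : sat e (ltR s t) ↔
    ∃ n, dl n ≤ apx (eval e t) (suc n) - apx (eval e s) (suc n) := by
  simp -implicitDefEqProofs [ltR, apx]

theorem sat_leR : sat e (leR s t) ↔
    ∀ n, apx (eval e s) (suc n) - apx (eval e t) (suc n) < dl n := by
  rw [leR, Fml.neg, sat, sat_ltR, sat]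
  simp only [imp_false, not_exists, not_le]

theorem sat_eqR : sat e (eqR s t) ↔
    ∀ n, |apx (eval e s) (suc n) - apx (eval e t) (suc n)| < dl n := by
  simp -implicitDefEqProofs [eqR, apx]

end Reals

end Model

namespace Model

variable {M : Model}

/-! # Rational bounds of real numbers -/

section Bounds

variable [hM : Fact M.Base]

/-- The real number that is represented by `x` is at most `q`. -/
def RLe (x : M.carrier one) (q : M.Rational) : Prop := ∀ n, apx x n ≤ q + dl n

/-- The real number that is represented by `x` is at least `q`. -/
def RGe (x : M.carrier one) (q : M.Rational) : Prop := ∀ n, q ≤ apx x n + dl n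

theorem abs_apx_sub_apx (x : M.carrier one) (n m : M.carrier nat) :
    |apx x n - apx x m| ≤ dl n + dl m := by
  rcases le_total n m with ⟨k, rfl⟩ | ⟨k, rfl⟩
  · linarith [abs_apx_sub_apx_add x n k, dl_pos (n + k)]
  · rw [abs_sub_comm]
    linarith [abs_apx_sub_apx_add x m k, dl_pos (m + k)]

/-- The `2⁻ⁿ` of the model get below every positive element of the field, so an error `C 2⁻ⁿ` can be
dropped. -/
theorem le_of_forall_dl {a b C : M.Rational} (hC : 0 < C) (h : ∀ n, a ≤ b + C * dl n) : a ≤ b := by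
  by_contra! hab
  obtain ⟨n, hn⟩ := exists_dl_lt (div_pos (sub_pos.2 hab) hC)
  rw [lt_div_iff₀' hC] at hn
  linarith [h n]

/-- A bound with any constant `C` improves to the constant `1` of `RLe`, by comparing with ever
later approximations. So errors need no careful bookkeeping. -/
theorem RLe.of_apx_suc {x : M.carrier one} {q C : M.Rational} (hC : 0 < C)
    (h : ∀ n, apx x (suc n) ≤ q + C * dl n) : RLe x q := by
  intro n
  refine le_of_forall_dl (C := C + 1) (by linarith) fun m => ?_
  have h₁ := (abs_le.1 (abs_apx_sub_apx x n (suc m))).2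
  have h₂ := dl_suc m
  have h₃ := dl_pos m
  linarith [h m]

theorem RGe.of_apx_suc {x : M.carrier one} {q C : M.Rational} (hC : 0 < C)
    (h : ∀ n, q ≤ apx x (suc n) + C * dl n) : RGe x q := by
  intro n
  refine le_of_forall_dl (C := C + 1) (by linarith) fun m => ?_
  have h₁ := (abs_le.1 (abs_apx_sub_apx x n (suc m))).1
  have h₂ := dl_suc m
  have h₃ := dl_pos m
  linarith [h m]

/-- One approximation that exceeds `q` by more than its error `2⁻ⁿ` keeps the real number above `q`.
-/
theorem RGe.of_not_rle {x : M.carrier one} {q : M.Rational} (h : ¬ RLe x q) : RGe x q := by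
  rw [RLe] at h
  push Not at h
  obtain ⟨n, hn⟩ := h
  intro m
  linarith [(abs_le.1 (abs_apx_sub_apx x n m)).2]

theorem RGe.le {x : M.carrier one} {q r : M.Rational} (h : RGe x q) (h' : RLe x r) : q ≤ r :=
  le_of_forall_dl two_pos fun n => by linarith [h n, h' n]

theorem RLe.mono {x : M.carrier one} {q r : M.Rational} (h : RLe x q) (hqr : q ≤ r) : RLe x r :=
  fun n => by linarith [h n]

variable {Γ : Ctx} {e : M.Env Γ} {s t : Tm Γ one}

theorem sat_leR_constR {q : Tm Γ nat} :
    sat e (leR s (constR q)) ↔ RLe (eval e s) (val (eval e q)) := by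
  rw [sat_leR]
  simp only [apx_constR]
  constructor
  · exact fun h => RLe.of_apx_suc one_pos fun n => by linarith [h n]
  · intro h n
    linarith [h (suc n), dl_suc n, dl_pos n]

theorem sat_constR_leR {q : Tm Γ nat} :
    sat e (leR (constR q) s) ↔ RGe (eval e s) (val (eval e q)) := by
  rw [sat_leR]
  simp only [apx_constR]
  constructor
  · exact fun h => RGe.of_apx_suc one_pos fun n => by linarith [h n]
  · intro h n
    linarith [h (suc n), dl_suc n, dl_pos n]

theorem RLe.of_leR (h : sat e (leR s t)) {q : M.Rational} (ht : RLe (eval e t) q) :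
    RLe (eval e s) q := by
  rw [sat_leR] at h
  refine RLe.of_apx_suc two_pos fun n => ?_
  linarith [h n, ht (suc n), dl_suc n, dl_pos n]

theorem RGe.of_leR (h : sat e (leR s t)) {q : M.Rational} (hs : RGe (eval e s) q) :
    RGe (eval e t) q := by
  rw [sat_leR] at h
  refine RGe.of_apx_suc two_pos fun n => ?_
  linarith [h n, hs (suc n), dl_suc n, dl_pos n]

@[simp] theorem val_natCode (n : Tm Γ nat) : val (eval e (mkQ n zero n1)) = M.incl (eval e n) := by
  rw [val_mkQ]
  · simp
  · simp

end Bounds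

/-! # Events -/

/-- `x` is an element of the event `A`. -/
def In (x : M.carrier pt) (A : M.carrier ev) : Prop := M.app (M.app (M.con .mem) x) A = 0

def complM (A : M.carrier ev) : M.carrier ev := M.app (M.con .compl) A
def unionM (A B : M.carrier ev) : M.carrier ev := M.app (M.app (M.con .union) A) B
def interM (A B : M.carrier ev) : M.carrier ev := complM (unionM (complM A) (complM B))
def diffM (A B : M.carrier ev) : M.carrier ev := interM A (complM B)
def probM (A : M.carrier ev) : M.carrier one := M.app (M.con .prob) A

section Eval

variable {Γ : Ctx} (e : M.Env Γ) (x : Tm Γ pt) (A B : Tm Γ ev)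

@[simp] theorem sat_mem : sat e (mem x A) ↔ In (eval e x) (eval e A) := Iff.rfl
@[simp] theorem eval_compl : eval e (compl A) = complM (eval e A) := rfl
@[simp] theorem eval_union : eval e (union A B) = unionM (eval e A) (eval e B) := rfl
@[simp] theorem eval_prob : eval e (prob A) = probM (eval e A) := rfl

end Eval

/-- The axioms for algebras of sets and probability contents that are used. -/
def contentAxioms : List (Fml []) := [axMem2, axMem3, axMem4, axProb1, axProb2, axProb3, axProb4]

/-- Models of the axioms for probability contents. -/
class Content (M : Model) : Prop where
  sat : ∀ B ∈ contentAxioms, M.sat .nil B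

section Content

variable [hP : Content M]

theorem not_in_empty (x : M.carrier pt) : ¬ In x (eval .nil empty : M.carrier ev) :=
  hP.sat axMem2 (by simp [contentAxioms]) x

@[simp] theorem in_unionM {x : M.carrier pt} {A B : M.carrier ev} :
    In x (unionM A B) ↔ In x A ∨ In x B :=
  ⟨(hP.sat axMem3 (by simp [contentAxioms]) x A B).1,
    (hP.sat axMem3 (by simp [contentAxioms]) x A B).2⟩

@[simp] theorem in_complM {x : M.carrier pt} {A : M.carrier ev} : In x (complM A) ↔ ¬ In x A :=
  ⟨(hP.sat axMem4 (by simp [contentAxioms]) x A).1,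
    (hP.sat axMem4 (by simp [contentAxioms]) x A).2⟩

@[simp] theorem in_interM {x : M.carrier pt} {A B : M.carrier ev} :
    In x (interM A B) ↔ In x A ∧ In x B := by
  simp only [interM, in_complM, in_unionM]
  tauto

@[simp] theorem in_diffM {x : M.carrier pt} {A B : M.carrier ev} :
    In x (diffM A B) ↔ In x A ∧ ¬ In x B := by
  simp only [diffM, in_interM, in_complM]

variable [hM : Fact M.Base]

theorem rge_probM_zero (A : M.carrier ev) : RGe (probM A) 0 := by
  have h := (hP.sat axProb1 (by simp [contentAxioms]) A).1
  rw [natR, sat_constR_leR] at h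
  simpa using h

theorem rle_probM_one (A : M.carrier ev) : RLe (probM A) 1 := by
  have h := (hP.sat axProb1 (by simp [contentAxioms]) A).2
  rw [natR, sat_leR_constR] at h
  simpa using h

/-- The fourth content axiom: if `ℙ(A) > ℙ(B)`, some point lies in `A` but not in `B`. Events with
the same points are different objects in general, so all comparisons of contents go through this
lemma. -/
theorem leR_probM {A B : M.carrier ev} (h : ∀ x, In x A → In x B) :
    sat (Env.cons B (Env.cons A .nil)) (leR (prob v1) (prob v0)) := by
  intro hlt
  obtain ⟨x, hx⟩ := hP.sat axProb4 (by simp [contentAxioms]) A B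
  have h' : sat (Env.cons x (Env.cons B (Env.cons A .nil))) (ltR (prob v1) (prob v2)) := by
    rw [sat_ltR] at hlt ⊢
    exact hlt
  exact (hx h').2 (h x (hx h').1)

theorem RLe.probM_mono {A B : M.carrier ev} (h : ∀ x, In x A → In x B) {q : M.Rational}
    (hB : RLe (probM B) q) : RLe (probM A) q :=
  RLe.of_leR (leR_probM h) hB

theorem RGe.probM_mono {A B : M.carrier ev} (h : ∀ x, In x A → In x B) {q : M.Rational}
    (hA : RGe (probM A) q) : RGe (probM B) q :=
  RGe.of_leR (leR_probM h) hA

theorem abs_apx_probM_unionM (A B : M.carrier ev) (n : M.carrier nat) :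
    |apx (probM (unionM A B)) (suc n) - (apx (probM A) (suc (suc (suc n))) +
      apx (probM B) (suc (suc (suc n))) - apx (probM (interM A B)) (suc (suc n)))| < dl n := by
  have h := hP.sat axProb3 (by simp [contentAxioms]) A B
  rw [sat_eqR] at h
  have h' := h n
  rw [subR, apx_addR, apx_addR, apx_negR, ← sub_eq_add_neg] at h'
  exact h'

/-- Subadditivity: in the modular law the content of the intersection is nonnegative. The
approximations are taken at shifted indices, and `4` generously covers the errors. -/
theorem RLe.probM_unionM {A B : M.carrier ev} {q r : M.Rational} (hA : RLe (probM A) q)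
    (hB : RLe (probM B) r) : RLe (probM (unionM A B)) (q + r) := by
  refine RLe.of_apx_suc (C := 4) (by norm_num) fun n => ?_
  have h₁ := (abs_lt.1 (abs_apx_probM_unionM A B n)).2
  have h₂ := rge_probM_zero (interM A B) (suc (suc n))
  have h₃ := dl_suc n
  have h₄ := dl_suc (suc n)
  have h₅ := dl_suc (suc (suc n))
  linarith [hA (suc (suc (suc n))), hB (suc (suc (suc n))), dl_pos n]

theorem rle_probM_of_empty {A : M.carrier ev} (h : ∀ x, ¬ In x A) : RLe (probM A) 0 := by
  have h₀ : sat (M := M) .nil (eqR (prob empty) (natR zero)) :=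
    hP.sat axProb2 (by simp [contentAxioms])
  refine RLe.probM_mono (B := eval .nil empty) (fun x hx => (h x hx).elim) ?_
  rw [sat_eqR] at h₀
  refine RLe.of_apx_suc one_pos fun n => ?_
  have h₁ := (abs_lt.1 (h₀ n)).2
  rw [natR, apx_constR, val_natCode, eval_zero, map_zero] at h₁
  rw [eval_prob] at h₁
  linarith

/-- Additivity from below: the intersection has no points, so its content is at most `0` and the
modular law loses nothing. -/
theorem RGe.probM_unionM {A B : M.carrier ev} (h : ∀ x, In x A → ¬ In x B) {q r : M.Rational}
    (hA : RGe (probM A) q) (hB : RGe (probM B) r) : RGe (probM (unionM A B)) (q + r) := by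
  refine RGe.of_apx_suc (C := 4) (by norm_num) fun n => ?_
  have h₁ := (abs_lt.1 (abs_apx_probM_unionM A B n)).1
  have h₂ : RLe (probM (interM A B)) 0 := rle_probM_of_empty fun x hx =>
    h x (in_interM.1 hx).1 (in_interM.1 hx).2
  have h₃ := dl_suc n
  have h₄ := dl_suc (suc n)
  have h₅ := dl_suc (suc (suc n))
  linarith [hA (suc (suc (suc n))), hB (suc (suc (suc n))), dl_pos n, h₂ (suc (suc n))]

/-! # Finite unions and intersections -/

/-- The step functional `z` is a parameter known only through its equation, so the induction formula
can refer to it by a variable. -/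
theorem in_recM_union {A : M.carrier (nat ⇝ ev)} {n : M.carrier nat}
    {z : M.carrier (ev ⇝ nat ⇝ ev)}
    (hz : ∀ B d, M.app (M.app z B) d = unionM B (M.app A (suc (n + d)))) (x : M.carrier pt)
    (d : M.carrier nat) :
    In x (recM d (M.app A n) z) ↔ ∃ i, n ≤ i ∧ i ≤ n + d ∧ In x (M.app A i) := by
  refine induct' d (mem v4 (rc v0 (v1 ⬝ v2) v3) ⇔'
    .ex nat (le0 v3 v0 ⋏ le0 v0 (add v3 v1) ⋏ mem v5 (v2 ⬝ v0)))
    (Env.cons A (Env.cons n (Env.cons z (Env.cons x .nil)))) (fun d => ?_) ?_ fun d h => ?_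
  · simp -implicitDefEqProofs [Fml.iff, iff_def]
  · rw [recM_zero, add_zero]
    refine ⟨fun h => ⟨n, le_rfl, le_rfl, h⟩, fun ⟨i, h₁, h₂, h₃⟩ => ?_⟩
    rwa [le_antisymm h₁ h₂]
  · rw [recM_suc, hz, in_unionM, h, add_suc]
    constructor
    · rintro (⟨i, h₁, h₂, h₃⟩ | h')
      · exact ⟨i, h₁, h₂.trans (lt_suc_iff.2 le_rfl).le, h₃⟩
      · exact ⟨_, le_self_add.trans (lt_suc_iff.2 le_rfl).le, le_rfl, h'⟩
    · rintro ⟨i, h₁, h₂, h₃⟩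
      rcases h₂.lt_or_eq with h₂ | rfl
      · exact Or.inl ⟨i, h₁, lt_suc_iff.1 h₂, h₃⟩
      · exact Or.inr h₃

@[simp] theorem in_bigUnion {Γ : Ctx} (e : M.Env Γ) (n m : Tm Γ nat) (A : Tm Γ (nat ⇝ ev))
    (x : M.carrier pt) : In x (eval e (bigUnion n m A)) ↔
      ∃ i, eval e n ≤ i ∧ i ≤ eval e m ∧ In x (M.app (eval e A) i) := by
  rw [bigUnion, eval_app, eval_app, eval_app, bigUnionT, app_lam, app_lam, app_lam, eval_rc,
    eval_rc]
  -- The outer recursor is on `n ∸ m`: for `n ≤ m` it yields the inner recursion of length `m ∸ n`,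
  -- otherwise the empty event.
  rcases le_or_gt (eval e n) (eval e m) with h | h
  · have h₁ : eval e n - eval e m = 0 := tsub_eq_zero_of_le h
    obtain ⟨d, hd⟩ := exists_add_of_le h
    simp only [eval_monus, eval_var, Env.cons_zero, Env.cons_succ, h₁, recM_zero, eval_app]
    rw [in_recM_union, hd, add_tsub_cancel_left]
    intro B d
    simp
  · obtain ⟨d, hd⟩ := lt_iff.1 h
    have h₁ : eval e n - eval e m = suc d := by rw [hd, add_tsub_cancel_left]
    simp only [eval_monus, eval_var, Env.cons_zero, Env.cons_succ, h₁, recM_suc, app_lam]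
    refine ⟨fun h => (not_in_empty x h).elim, fun ⟨i, h₁, h₂, _⟩ => ?_⟩
    exact ((h₁.trans h₂).not_gt h).elim

@[simp] theorem in_bigInter {Γ : Ctx} (e : M.Env Γ) (n m : Tm Γ nat) (A : Tm Γ (nat ⇝ ev))
    (x : M.carrier pt) : In x (eval e (bigInter n m A)) ↔
      ∀ i, eval e n ≤ i → i ≤ eval e m → In x (M.app (eval e A) i) := by
  simp [bigInter]

end Content

end Model

namespace Model

/-! # Metastability and almost uniform convergence -/

variable {M : Model} [hM : Fact M.Base]

/-- Dependent choice for numbers, read semantically. If `A` ignores `y`, it is countable choice with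
the choice function shifted by one. -/
theorem exists_choice {Γ : Ctx} (e : M.Env Γ) (A : Fml (nat :: nat :: nat :: Γ))
    (h : ∀ m y, ∃ z, sat (Env.cons z (Env.cons y (Env.cons m e))) A) :
    ∃ f : M.carrier one, ∀ m,
      sat (Env.cons (M.app f (suc m)) (Env.cons (M.app f m) (Env.cons m e))) A := by
  obtain ⟨f, hf⟩ := hM.1.sat (.dc A) e h
  refine ⟨f, fun m => ?_⟩
  have := hf m
  rw [sat_subst] at this
  refine (congrArg (sat · A) ?_).mp this
  refine Env.cons_ext rfl fun τ v => ?_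
  cases v with
  | zero => rfl
  | succ v =>
    cases v with
    | zero => rfl
    | succ v => rfl

/-! ### Monotone families of events -/

section Families

variable [hP : Content M] (E : M.carrier (nat ⇝ nat ⇝ ev))

/-- The event `E m c`. -/
def app₂ (m c : M.carrier nat) : M.carrier ev := M.app (M.app E m) c

variable {E}

/-- If no `E m d` is stable up to `2⁻ˡ`, each can be enlarged by a disjoint piece of content at
least `2⁻ˡ`. The induction runs over the possibly nonstandard `i`, so the claim is stated by a
formula about codes. -/
theorem exists_rge_probM {m l : M.carrier nat}
    (hE : ∀ {c c'}, c ≤ c' → ∀ x, In x (app₂ E m c) → In x (app₂ E m c'))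
    (h : ∀ d, ∃ c, RGe (probM (diffM (app₂ E m c) (app₂ E m d))) (dl l)) (i : M.carrier nat) :
    ∃ d, RGe (probM (app₂ E m d)) (M.incl i * dl l) := by
  refine induct' i (.ex nat (leR (constR (dyadQ v1 v4)) (prob (v2 ⬝ v3 ⬝ v0))))
    (Env.cons E (Env.cons m (Env.cons l .nil)))
    (fun n => by simp [sat_constR_leR, app₂]) ⟨0, ?_⟩ ?_
  · rw [map_zero, zero_mul]
    exact rge_probM_zero _
  · rintro i ⟨d, hd⟩
    obtain ⟨c, hc⟩ := h d
    -- `d + c` serves as a common upper bound of `d` and `c`.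
    refine ⟨d + c, ?_⟩
    rw [incl_suc, add_mul, one_mul]
    refine RGe.probM_mono ?_ (RGe.probM_unionM (fun x hx hx' => (in_diffM.1 hx').2 hx) hd hc)
    intro x hx
    rcases in_unionM.1 hx with hx | hx
    · exact hE le_self_add x hx
    · exact hE le_add_self x (in_diffM.1 hx).1

/-- An increasing sequence of events is eventually stable up to `2⁻ˡ`. -/
theorem exists_forall_rle_diffM {m : M.carrier nat} (l : M.carrier nat)
    (hE : ∀ {c c'}, c ≤ c' → ∀ x, In x (app₂ E m c) → In x (app₂ E m c')) :
    ∃ d, ∀ c, RLe (probM (diffM (app₂ E m c) (app₂ E m d))) (dl l) := by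
  by_contra! h
  obtain ⟨d, hd⟩ := exists_rge_probM hE
    -- `2ˡ + 1` pieces of size `2⁻ˡ` contradict `ℙ ≤ 1`.
    (fun d => (h d).imp fun c hc => RGe.of_not_rle hc) (suc (pow2 l))
  have h₁ := hd.le (rle_probM_one _)
  have h₂ : M.incl (pow2 l) * dl l = 1 :=
    mul_inv_cancel₀ (incl_pos (zero_le.trans_lt (pow2_pos l)).ne').ne'
  rw [incl_suc, add_mul, h₂] at h₁
  linarith [dl_pos l]

/-- `F` picks for each `m` an index from which `E m` is stable up to `2⁻ᵏ⁻⁴⁻ᵐ`; metastability is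
applied to this `F`. It is assumed with an event `B` that contains the points of the intersection,
so the syntactic form of the latter is irrelevant. -/
theorem exists_forall_rle_probM {k : M.carrier nat}
    (hE : ∀ {m c c'}, c ≤ c' → ∀ x, In x (app₂ E m c) → In x (app₂ E m c'))
    (hE' : ∀ {m m' c}, m ≤ m' → ∀ x, In x (app₂ E m' c) → In x (app₂ E m c))
    (h : ∀ F : M.carrier one, ∃ b B, (∀ x, (∀ m ≤ b, In x (app₂ E m (M.app F m))) → In x B) ∧
      RLe (probM B) (dl (suc k))) :
    ∃ b, ∀ c, RLe (probM (app₂ E b c)) (dl k) := by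
  obtain ⟨f, hf⟩ := exists_choice (Env.cons E (Env.cons k .nil))
    -- The formula says of `(m, y, z)` that `ℙ(E m c \ E m z) ≤ 2⁻⁽ᵏ⁺⁴⁺ᵐ⁾` for all `c`; it ignores
    -- `y`.
    (.all nat (leR (prob (inter (v4 ⬝ v3 ⬝ v0) (compl (v4 ⬝ v3 ⬝ v1))))
      (invPowR (add (succ (succ (succ (succ v5)))) v3)))) (fun m y => by
        obtain ⟨d, hd⟩ := exists_forall_rle_diffM (m := m) (suc (suc (suc (suc k))) + m) hE
        refine ⟨d, fun c => ?_⟩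
        rw [invPowR, sat_leR_constR, val_invPowQ]
        simp only [eval_add, eval_succ]
        exact hd c)
  -- Dependent choice puts the value chosen for `m` at `f (m + 1)`, so `F` is the shift of `f`.
  obtain ⟨F, hF⟩ : ∃ F : M.carrier one, ∀ m, M.app F m = M.app f (suc m) :=
    ⟨eval (Env.cons f .nil) (lam (v1 ⬝ succ v0)), fun m => by simp⟩
  have hF' : ∀ m c, RLe (probM (diffM (app₂ E m c) (app₂ E m (M.app F m))))
      (dl (suc (suc (suc (suc k))) + m)) := by
    intro m c
    have := hf m c
    rw [invPowR, sat_leR_constR, val_invPowQ] at this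
    simp only [eval_add, eval_succ] at this
    rw [hF]
    exact this
  obtain ⟨b, B, hB, hBk⟩ := h F
  refine ⟨b, fun c => ?_⟩
  let e : M.Env [nat, ev, nat ⇝ nat ⇝ ev, one, nat] :=
    Env.cons b (Env.cons (app₂ E b c) (Env.cons E (Env.cons F (Env.cons k .nil))))
  have hI : ∀ b' x, In x (eval (Env.cons b' e)
      (bigInter zero v0 (lam (v4 ⬝ v0 ⬝ (v5 ⬝ v0))))) ↔
        ∀ m ≤ b', In x (app₂ E m (M.app F m)) := by
    intro b' x
    simp [e, app₂]
  -- The error events are added up by internal induction. The bound `2⁻ᵏ⁻² - 2⁻ᵏ⁻³⁻ᵇ'` gains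
  -- `2⁻ᵏ⁻⁴⁻ᵇ'` when `b'` grows by one, which covers the new error `2⁻ᵏ⁻⁵⁻ᵇ'`.
  have key : ∀ b', b' ≤ b → RLe (probM (diffM (app₂ E b c) (eval (Env.cons b' e)
      (bigInter zero v0 (lam (v4 ⬝ v0 ⬝ (v5 ⬝ v0)))))))
      (dl (suc (suc k)) - dl (suc (suc (suc k)) + b')) := by
    intro b'
    refine induct' b' (le0 v0 v1 ⟹ leR (prob (inter v2 (compl
      (bigInter zero v0 (lam (v4 ⬝ v0 ⬝ (v5 ⬝ v0)))))))
      (constR (subQ (invPowQ (succ (succ v5))) (invPowQ (add (succ (succ (succ v5))) v0))))) e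
      (fun n => ?_) ?_ ?_
    · rw [sat, sat_le0, sat_leR_constR]
      simp only [val_subQ, val_invPowQ, eval_add, eval_succ]
      rfl
    · intro _
      refine ((hF' 0 c).probM_mono fun x hx => ?_).mono ?_
      · simp only [in_diffM, hI] at hx ⊢
        refine ⟨hE' zero_le x hx.1, fun h' => hx.2 fun m hm => ?_⟩
        rw [nonpos_iff_eq_zero.1 hm]
        exact h'
      · rw [add_zero, add_zero]
        linarith [dl_suc (suc (suc k)), dl_suc (suc (suc (suc k))), dl_pos (suc (suc k))]
    · intro n ih hn
      have h₁ := ih ((lt_suc_iff.2 le_rfl).le.trans hn)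
      refine ((h₁.probM_unionM (hF' (suc n) c)).probM_mono fun x hx => ?_).mono ?_
      -- A point of `E b c` outside the longer intersection either leaves the shorter one or is not
      -- in `E (n+1) (F (n+1))`; in the latter case it is in `E (n+1) c` because `n + 1 ≤ b`.
      · simp only [in_unionM, in_diffM, hI] at hx ⊢
        by_contra! h'
        refine hx.2 fun m hm => ?_
        rcases hm.lt_or_eq with hm | rfl
        · exact h'.1 hx.1 m (lt_suc_iff.1 hm)
        · exact h'.2 (hE' hn x hx.1)
      · simp only [add_suc, suc_add]
        linarith [dl_suc (suc (suc (suc (k + n)))), dl_suc (suc (suc (suc (suc (k + n))))),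
          dl_suc (suc (suc (suc (suc (suc (k + n)))))), dl_pos (suc (suc (suc (k + n))))]
  refine ((key b le_rfl).probM_unionM hBk).probM_mono (fun x hx => ?_) |>.mono ?_
  · rw [in_unionM, in_diffM]
    by_cases hx' : In x B
    · exact Or.inr hx'
    · exact Or.inl ⟨hx, fun h' => hx' (hB x ((hI b x).1 h'))⟩
  · linarith [dl_suc k, dl_suc (suc k), dl_pos k, dl_pos (suc (suc (suc k)) + b)]

end Families

theorem almostUniform_of_metastable [hP : Content M] (h : M.sat .nil almostUniformMetastable) :
    M.sat .nil almostUniform := by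
  intro k a
  -- The family must be an element of the model, since induction and choice take it as a parameter.
  let E : M.carrier (nat ⇝ nat ⇝ ev) := eval (Env.cons a .nil)
    (lam (lam (bigUnion v1 v0 (lam (bigUnion v2 v1 (lam (compl (setP v4 v1 v0))))))))
  have hE : ∀ x m c, In x (app₂ E m c) ↔ ∃ i, m ≤ i ∧ i ≤ c ∧ ∃ j, m ≤ j ∧ j ≤ c ∧
      ¬ In x (eval (Env.cons j (Env.cons i (Env.cons a .nil))) (setP v2 v1 v0)) := by
    intro x m c
    simp -implicitDefEqProofs [E, app₂, setP]
  have hmono : ∀ {m c c'}, c ≤ c' → ∀ x, In x (app₂ E m c) → In x (app₂ E m c') := by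
    intro m c c' hc x
    rw [hE, hE]
    rintro ⟨i, h₁, h₂, j, h₃, h₄, h₅⟩
    exact ⟨i, h₁, h₂.trans hc, j, h₃, h₄.trans hc, h₅⟩
  have hanti : ∀ {m m' c}, m ≤ m' → ∀ x, In x (app₂ E m' c) → In x (app₂ E m c) := by
    intro m m' c hm x
    rw [hE, hE]
    rintro ⟨i, h₁, h₂, j, h₃, h₄, h₅⟩
    exact ⟨i, hm.trans h₁, h₂, j, hm.trans h₃, h₄, h₅⟩
  have hmet : ∀ F : M.carrier one, ∃ b B, (∀ x, (∀ m ≤ b, In x (app₂ E m (M.app F m))) → In x B) ∧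
      RLe (probM B) (dl (suc k)) := by
    intro F
    obtain ⟨b, hb⟩ := h (suc k) a F
    rw [invPowR, sat_leR_constR, val_invPowQ] at hb
    refine ⟨b, _, fun x hx => ?_, hb⟩
    rw [in_bigInter]
    intro m _ hm
    have := hx m hm
    rw [hE] at this
    simpa -implicitDefEqProofs [setP] using this
  obtain ⟨b, hb⟩ := exists_forall_rle_probM (E := E) (k := k) hmono hanti hmet
  refine ⟨b, fun c => ?_⟩
  rw [invPowR, sat_leR_constR, val_invPowQ]
  refine (hb c).probM_mono fun x hx => ?_
  rw [hE]
  simpa -implicitDefEqProofs [setP] using hx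

end Model

/-! ### From models back to derivations -/

theorem derives_almostUniform :
    Derives baseTheory (almostUniformMetastable :: Model.contentAxioms) almostUniform := by
  refine derives_of_models baseTheory_closed baseTheory_hasEq fun M hM h => ?_
  have : Fact M.Base := ⟨hM⟩
  have : M.Content := ⟨fun B hB => h B (List.mem_cons_of_mem _ hB)⟩
  exact Model.almostUniform_of_metastable (h _ (List.mem_cons_self ..))

/-- The content axioms are sentences, so they can be kept as open assumptions during the semantic
argument and cut away afterwards. The theory to which completeness is applied then stays
`baseTheory`. -/
theorem Derives.of_derives_context {T : Theory} {Γ : Ctx} {H : List (Fml Γ)} {A : Fml Γ}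
    (h : ∀ B ∈ H, Derives T [] B) (d : Derives T H A) : Derives T [] A := by
  induction H generalizing A with
  | nil => exact d
  | cons B H ih =>
    exact .impE (ih (fun C hC => h C (List.mem_cons_of_mem _ hC)) (.impI d))
      (h B (List.mem_cons_self ..))

theorem contentAxioms_subset_systemFPIX {A : Fml []} (h : A ∈ Model.contentAxioms) :
    A ∈ systemFPIX [] := by
  suffices h : A ∈ algebraAx [] ∨ A ∈ probAx [] by
    rcases h with h | h
    · exact Or.inl (Or.inl (Or.inl (Or.inl (Or.inl (Or.inr h)))))
    · exact Or.inl (Or.inl (Or.inl (Or.inl (Or.inr h))))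
  simp only [Model.contentAxioms, List.mem_cons, List.not_mem_nil, or_false] at h
  rcases h with rfl | rfl | rfl | rfl | rfl | rfl | rfl <;> simp [algebraAx, probAx]

end PContent

theorem mainTheorem4 :
    PContent.Provable PContent.systemFPIX
      (PContent.Fml.imp PContent.almostUniformMetastable PContent.almostUniform) := by
  refine PContent.Derives.of_derives_context (H := PContent.Model.contentAxioms)
    (fun B hB => .ax (PContent.contentAxioms_subset_systemFPIX hB)) ?_
  exact (PContent.derives_almostUniform.mono
    fun _ _ => PContent.baseTheory_subset_systemFPIX).impI
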